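/- **Problem.** A multiple knapsack constraint (MKC) over a finite set $I$ of items is a triple $(w,B,W)$ of item weights $w:I\to\mathbb{Q}_{\ge 0}$, a finite set $B$ of bins and capacities $W:B\to\mathbb{Q}_{\ge 0}$. An assignment $A:B\to 2^I$ is a feasible assignment of $S\subseteq I$ if $\sum_{i\in A(b)}w(i)\le W(b)$ for all $b\in B$ and $S=\bigcup_{b\in B}A(b)$. An instance of $d$-MKCP is $\mathcal{T}=(I,(w_t,B_t,W_t)_{t=1}^d,\mathcal{I},f)$, where the $(w_t,B_t,W_t)$ are MKCs over $I$, $f:2^I\to\mathbb{Q}_{\ge 0}$ is submodular, and the additional constraint $\mathcal{I}\subseteq 2^I$ is of one of four types: $\mathcal{I}=2^I$ (no additional constraint); $\mathcal{I}$ is the family of independent sets of a matroid on $I$; $\mathcal{I}$ is the intersection of two such families; $\mathcal{I}$ is the family of matchings of a simple graph with edge set $I$. A solution is a set $S\in\mathcal{I}$ with, for each $t$, a feasible assignment $A_t$ of $S$ with respect to $(w_t,B_t,W_t)$; its value is $f(S)$, and $\mathrm{OPT}$ is the maximal value of a solution. There are three types of function: modular (that is, $f(S\cup\{i\})-f(S)=f(T\cup\{i\})-f(T)$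 for all $S\subseteq T\subseteq I$ and $i\in I\setminus T$), monotone submodular, and "non-monotone" (arbitrary submodular). **Restricted instances.** Let $N,\xi\ge 1$ be integers. A partition $(K_j)_{j=0}^{\ell}$ of a set of bins is $N$-leveled if, for all $0\le j\le\ell$, all bins in $K_j$ have the same capacity and $|K_j|=N^{\lfloor j/N^2\rfloor}$. An instance of $(N,\xi)$-restricted $d$-MKCP is an instance of $d$-MKCP with an $N$-leveled partition of $B_t$ for each $t$, which is part of the input, such that $f(\{i\})-f(\emptyset)\le \mathrm{OPT}/\xi$ for every $i\in I$. **Algorithms.** Items, bins, weights, capacities and partitions are given explicitly, with numbers in binary; $f$ is given by a value oracle and $\mathcal{I}$ by a membership oracle (one for each matroid in the case of a matroid intersection). The input size is the length of the explicit input plus the maximal bit length of a value $f(S)$, $S\subseteq I$. Arithmetic is charged by the bit length of the numbers, and an oracle call by the length of the query and of the answer. A polynomial-time $\alpha$-approximation is an algorithm, possibly randomized by fair coin flips, which on every instance and for all outcomes of its coin flips halts within a number of steps that is polynomial in the input size and returns a solution (the set and its assignments), such that the expected value of the returned solution is at least $\alpha\cdot\mathrm{OPT}$. **Lemma.** Let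 $N,\xi\ge 1$ and $d\ge 0$ be integers, let $c\in[0,1]$, and fix one of the three types of function and one of the four types of additional constraint. If there is a polynomial-time $c$-approximation for $(N,\xi)$-restricted $d$-MKCP with this type of function and this type of additional constraint, then there is a polynomial-time $c\cdot\left(1-\frac dN\right)$-approximation for $d$-MKCP with the same type of function and the same type of additional constraint. If the former algorithm is deterministic, then the latter can be chosen deterministic. -/

import Mathlib

namespace MKCP

/-! ## Data and programs

Data are binary trees with rational numbers at the leaves.  A list is coded by right-nested nodes
ending in the leaf `0`.  The size of a datum counts the nodes, and the bits of the numerators and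
denominators of the leaves. -/

inductive Val : Type
  | leaf : ℚ → Val
  | node : Val → Val → Val
  deriving DecidableEq

/-- Length of the binary encoding of a rational number. -/
def bitLength (q : ℚ) : ℕ := q.num.natAbs.size + q.den.size + 1

namespace Val

def size : Val → ℕ
  | leaf q => bitLength q
  | node a b => a.size + b.size + 1

def fst : Val → Val
  | leaf _ => leaf 0
  | node a _ => a

def snd : Val → Val
  | leaf _ => leaf 0
  | node _ b => b

def num : Val → ℚ
  | leaf q => q
  | node _ _ => 0

def isNode : Val → Bool
  | leaf _ => false
  | node _ _ => true

def ofBool (b : Bool) : Val := leaf (if b then 1 else 0)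

def ofList : List Val → Val
  | [] => leaf 0
  | a :: l => node a (ofList l)

def toList : Val → List Val
  | leaf _ => []
  | node a b => a :: toList b

/-- The item or bin named by a datum. -/
def label (v : Val) : ℕ := ⌊v.num⌋₊

/-- The finite set of labels listed by a datum. -/
def toSet (v : Val) : Finset ℕ := (v.toList.map label).toFinset

/-- A datum that lists pairs `(b, i)` describes the assignment that puts item `i` into bin `b`
for every listed pair. -/
def toAssignment (v : Val) (b : ℕ) : Finset ℕ :=
  ((v.toList.filter fun p => p.fst.label = b).map fun p => p.snd.label).toFinset

def ofNat (n : ℕ) : Val := leaf (n : ℚ)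

def ofNatList (l : List ℕ) : Val := ofList (l.map ofNat)

end Val

/-- A value oracle and two membership oracles. -/
structure Oracles where
  value : Finset ℕ → ℚ
  mem : Fin 2 → Finset ℕ → Bool

/-- Elementary operations. -/
inductive Op : Type
  | id | fst | snd | isNode
  | const (v : Val)
  | add | sub | mul | div | floor | le
  | value
  | mem (k : Fin 2)

def Op.eval (O : Oracles) : Op → Val → Val
  | .id, v => v
  | .fst, v => v.fst
  | .snd, v => v.snd
  | .isNode, v => Val.ofBool v.isNode
  | .const w, _ => w
  | .add, v => .leaf (v.fst.num + v.snd.num)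
  | .sub, v => .leaf (v.fst.num - v.snd.num)
  | .mul, v => .leaf (v.fst.num * v.snd.num)
  | .div, v => .leaf (v.fst.num / v.snd.num)
  | .floor, v => .leaf (⌊v.num⌋ : ℤ)
  | .le, v => Val.ofBool (decide (v.fst.num ≤ v.snd.num))
  | .value, v => .leaf (O.value v.toSet)
  | .mem k, v => Val.ofBool (O.mem k v.toSet)

/-- Programs; each computes a (possibly randomized, possibly partial) map from data to data.
* `op o` performs an elementary operation, `flip` returns a fair coin flip;
* `pair p q` runs `p` and `q` on the input and pairs the results;
* `comp p q` runs `p` on the input, then `q` on the result;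
* `cond b p q` runs `p` on the input if `b` returns something else than the leaf `0`, else `q`;
* `loop p` runs `p` on the current datum, which results in a pair `(flag, w)`; it returns `w` if
  `flag` is the leaf `0` and repeats with `w` as the current datum otherwise. -/
inductive Prog : Type
  | op (o : Op)
  | flip
  | pair (p q : Prog)
  | comp (p q : Prog)
  | cond (b p q : Prog)
  | loop (p : Prog)

/-- A program is deterministic if it flips no coins. -/
def Prog.Deterministic : Prog → Prop
  | .op _ => True
  | .flip => False
  | .pair p q => p.Deterministic ∧ q.Deterministic
  | .comp p q => p.Deterministic ∧ q.Deterministic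
  | .cond b p q => b.Deterministic ∧ p.Deterministic ∧ q.Deterministic
  | .loop p => p.Deterministic

/-- Finite trees of fair coin flips: the outcomes of a halting randomized computation. -/
inductive CoinTree (α : Type) : Type
  | ret : α → CoinTree α
  | branch : CoinTree α → CoinTree α → CoinTree α

namespace CoinTree

def bind {α β : Type} : CoinTree α → (α → CoinTree β) → CoinTree β
  | ret a, k => k a
  | branch l r, k => branch (l.bind k) (r.bind k)

def map {α β : Type} (g : α → β) (D : CoinTree α) : CoinTree β := D.bind fun a => ret (g a)

/-- All possible outcomes. -/
def leaves {α : Type} : CoinTree α → List α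
  | ret a => [a]
  | branch l r => l.leaves ++ r.leaves

/-- Expected value. -/
def expect {α : Type} (g : α → ℚ) : CoinTree α → ℚ
  | ret a => g a
  | branch l r => (l.expect g + r.expect g) / 2

end CoinTree

/-- Add `n` steps to a computation. -/
def delay (n : ℕ) (D : CoinTree (Val × ℕ)) : CoinTree (Val × ℕ) := D.map fun x => (x.1, n + x.2)

/-- `Exec O p v D`: with the oracles `O`, the program `p` halts on input `v` for all outcomes of its
coin flips, and `D` is the resulting tree of pairs (output, number of steps).  An elementary
operation costs one step plus the sizes of its argument and of its result; so arithmetic is charged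
by bit length, and an oracle call by the length of the query and of the answer.  The copying of data
is charged by size. -/
inductive Exec (O : Oracles) : Prog → Val → CoinTree (Val × ℕ) → Prop
  | op (o : Op) (v : Val) :
      Exec O (.op o) v (.ret (o.eval O v, 1 + v.size + (o.eval O v).size))
  | flip (v : Val) :
      Exec O .flip v (.branch
        (.ret (Val.ofBool false, 1 + v.size + (Val.ofBool false).size))
        (.ret (Val.ofBool true, 1 + v.size + (Val.ofBool true).size)))
  | pair {p q : Prog} {v : Val} {D E : CoinTree (Val × ℕ)} :
      Exec O p v D → Exec O q v E →
      Exec O (.pair p q) v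
        (D.bind fun x => E.map fun y => (.node x.1 y.1, 1 + v.size + x.2 + y.2))
  | comp {p q : Prog} {v : Val} {D : CoinTree (Val × ℕ)} {K : Val × ℕ → CoinTree (Val × ℕ)} :
      Exec O p v D → (∀ x ∈ D.leaves, Exec O q x.1 (K x)) →
      Exec O (.comp p q) v (D.bind fun x => delay (1 + x.2) (K x))
  | cond {b p q : Prog} {v : Val} {D : CoinTree (Val × ℕ)} {K : Val × ℕ → CoinTree (Val × ℕ)} :
      Exec O b v D → (∀ x ∈ D.leaves, Exec O (if x.1 = .leaf 0 then q else p) v (K x)) →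
      Exec O (.cond b p q) v (D.bind fun x => delay (1 + v.size + x.2) (K x))
  | loop {p : Prog} {v : Val} {D : CoinTree (Val × ℕ)} {K : Val × ℕ → CoinTree (Val × ℕ)} :
      Exec O p v D → (∀ x ∈ D.leaves, x.1.fst ≠ .leaf 0 → Exec O (.loop p) x.1.snd (K x)) →
      Exec O (.loop p) v
        (D.bind fun x =>
          if x.1.fst = .leaf 0 then .ret (x.1.snd, 1 + x.2) else delay (1 + x.2) (K x))

/-! ## The problem -/

/-- A multiple knapsack constraint: item weights, bins, bin capacities.  Only the weights of items
of the instance and the capacities of bins in the list matter. -/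
structure MKC where
  weight : ℕ → ℚ
  bins : List ℕ
  cap : ℕ → ℚ

/-- An instance with `d` multiple knapsack constraints.  Items and bins are named by natural
numbers.  The additional constraint is given by `mem`, the objective function is `f`; only their
values on subsets of the set of items matter. -/
structure Instance (d : ℕ) where
  items : List ℕ
  mkc : Fin d → MKC
  mem : Fin 2 → Finset ℕ → Bool
  f : Finset ℕ → ℚ

inductive FunctionType : Type
  | modular | monotone | nonMonotone

inductive ConstraintType : Type
  | unconstrained | matroid | matroidIntersection | matching

/-- Non-negative submodular functions on the subsets of `I`. -/
def IsSubmodular (I : Finset ℕ) (f : Finset ℕ → ℚ) : Prop :=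
  (∀ S ⊆ I, 0 ≤ f S) ∧
  ∀ S T : Finset ℕ, S ⊆ T → T ⊆ I → ∀ i ∈ I \ T,
    f (insert i T) - f T ≤ f (insert i S) - f S

def FunctionType.Holds : FunctionType → Finset ℕ → (Finset ℕ → ℚ) → Prop
  | .modular, I, f => IsSubmodular I f ∧
      ∀ S T : Finset ℕ, S ⊆ T → T ⊆ I → ∀ i ∈ I \ T,
        f (insert i S) - f S = f (insert i T) - f T
  | .monotone, I, f => IsSubmodular I f ∧ ∀ S T : Finset ℕ, S ⊆ T → T ⊆ I → f S ≤ f T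
  | .nonMonotone, I, f => IsSubmodular I f

/-- The oracle accepts precisely the independent sets of a matroid with ground set `I`. -/
def IsMatroidOracle (I : Finset ℕ) (m : Finset ℕ → Bool) : Prop :=
  ∃ M : Matroid ℕ, M.E = (I : Set ℕ) ∧ ∀ S ⊆ I, m S = true ↔ M.Indep (S : Set ℕ)

/-- The oracle accepts precisely the matchings of a graph whose edges are the elements of `I`. -/
def IsMatchingOracle (I : Finset ℕ) (m : Finset ℕ → Bool) : Prop :=
  ∃ (V : Type) (G : SimpleGraph V) (e : ℕ → Sym2 V), Set.BijOn e (I : Set ℕ) G.edgeSet ∧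
    ∀ S ⊆ I, m S = true ↔ ∀ i ∈ S, ∀ j ∈ S, i ≠ j → ∀ v : V, ¬(v ∈ e i ∧ v ∈ e j)

/-- The oracle accepts all subsets of `I`. -/
def IsTrivialOracle (I : Finset ℕ) (m : Finset ℕ → Bool) : Prop := ∀ S ⊆ I, m S = true

/-- The constraint is always the conjunction of both oracles; the second one is used only for the
intersection of two matroids. -/
def ConstraintType.Holds : ConstraintType → Finset ℕ → (Fin 2 → Finset ℕ → Bool) → Prop
  | .unconstrained, I, m => IsTrivialOracle I (m 0) ∧ IsTrivialOracle I (m 1)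
  | .matroid, I, m => IsMatroidOracle I (m 0) ∧ IsTrivialOracle I (m 1)
  | .matroidIntersection, I, m => IsMatroidOracle I (m 0) ∧ IsMatroidOracle I (m 1)
  | .matching, I, m => IsMatchingOracle I (m 0) ∧ IsTrivialOracle I (m 1)

/-- `A` is a feasible assignment of the set `S`. -/
def MKC.IsFeasibleAssignment (κ : MKC) (A : ℕ → Finset ℕ) (S : Finset ℕ) : Prop :=
  (∀ b ∈ κ.bins, ∑ i ∈ A b, κ.weight i ≤ κ.cap b) ∧ S = κ.bins.toFinset.biUnion A

namespace Instance

variable {d : ℕ}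

/-- The set of items. -/
def I (T : Instance d) : Finset ℕ := T.items.toFinset

/-- `T` is an instance of d-MKCP with the given types of function and of additional constraint. -/
structure Valid (F : FunctionType) (C : ConstraintType) (T : Instance d) : Prop where
  items_nodup : T.items.Nodup
  bins_nodup : ∀ t, (T.mkc t).bins.Nodup
  weight_nonneg : ∀ t, ∀ i ∈ T.items, 0 ≤ (T.mkc t).weight i
  cap_nonneg : ∀ t, ∀ b ∈ (T.mkc t).bins, 0 ≤ (T.mkc t).cap b
  function_type : F.Holds T.I T.f
  constraint_type : C.Holds T.I T.mem

/-- `S` with the assignments `A t` is a solution. -/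
def IsSolution (T : Instance d) (S : Finset ℕ) (A : Fin d → ℕ → Finset ℕ) : Prop :=
  S ⊆ T.I ∧ (∀ k, T.mem k S = true) ∧ ∀ t, (T.mkc t).IsFeasibleAssignment (A t) S

/-- `v` is the value of an optimal solution. -/
def IsOpt (T : Instance d) (v : ℚ) : Prop :=
  IsGreatest {x | ∃ S A, T.IsSolution S A ∧ x = T.f S} v

/-- For each constraint, a partition `K₀, …, K_ℓ` of the bins into blocks of equal capacities such
that `K_j` has `N ^ ⌊j / N ^ 2⌋` bins. -/
def IsLeveled (N : ℕ) (T : Instance d) (K : Fin d → List (List ℕ)) : Prop :=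
  ∀ t, K t ≠ [] ∧ (K t).flatten.Perm (T.mkc t).bins ∧
    (∀ (j : ℕ) (hj : j < (K t).length), ((K t)[j]).length = N ^ (j / N ^ 2)) ∧
    ∀ B ∈ K t, ∀ b ∈ B, ∀ b' ∈ B, (T.mkc t).cap b = (T.mkc t).cap b'

/-- Every single item gains at most a `1 / ξ` fraction of the optimum. -/
def HasSmallItems (ξ : ℕ) (T : Instance d) : Prop :=
  ∃ v, T.IsOpt v ∧ ∀ i ∈ T.I, T.f {i} - T.f ∅ ≤ v / ξ

/-! ### Encoding of inputs and outputs -/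

def oracles (T : Instance d) : Oracles := ⟨T.f, T.mem⟩

/-- The explicit part of the input: the items, and for each constraint the list of pairs
(item, weight) and the list of pairs (bin, capacity). -/
def code (T : Instance d) : Val :=
  .node (Val.ofNatList T.items) (Val.ofList (List.ofFn fun t =>
    .node (Val.ofList (T.items.map fun i => .node (Val.ofNat i) (.leaf ((T.mkc t).weight i))))
      (Val.ofList ((T.mkc t).bins.map fun b => .node (Val.ofNat b) (.leaf ((T.mkc t).cap b))))))

def partitionCode (K : Fin d → List (List ℕ)) : Val :=
  Val.ofList (List.ofFn fun t => Val.ofList ((K t).map Val.ofNatList))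

/-- The maximal bit length of a value of the objective function. -/
def valueSize (T : Instance d) : ℕ := T.I.powerset.sup fun S => bitLength (T.f S)

/-- An output is a pair: the list of selected items, and the list of the `d` assignments. -/
def outSet (x : Val) : Finset ℕ := x.fst.toSet

def outAssignment (x : Val) (t : Fin d) : ℕ → Finset ℕ :=
  (x.snd.toList.getD t (.leaf 0)).toAssignment

/-- On the instance `T`, given as `input` together with its oracles, the program `P` halts within
`bound` many steps and returns a solution, for all outcomes of its coin flips; and the expected
value of the returned solution is at least `c` times the optimum. -/
def SolvedBy (T : Instance d) (P : Prog) (input : Val) (bound : ℕ) (c : ℝ) : Prop :=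
  ∃ D : CoinTree (Val × ℕ), Exec T.oracles P input D ∧
    (∀ x ∈ D.leaves, x.2 ≤ bound ∧ T.IsSolution (outSet x.1) (outAssignment x.1)) ∧
    ∀ v, T.IsOpt v → c * (v : ℝ) ≤ (D.expect fun x => T.f (outSet x.1) : ℚ)

end Instance

/-- `P` is a polynomial-time `c`-approximation for d-MKCP with the given types of function and of
additional constraint.  The input size is the size of the explicit input plus the maximal bit
length of a value of the objective function. -/
def IsApprox (F : FunctionType) (C : ConstraintType) (d : ℕ) (c : ℝ) (P : Prog) : Prop :=
  ∃ p : Polynomial ℕ, ∀ T : Instance d, T.Valid F C →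
    T.SolvedBy P T.code (p.eval (T.code.size + T.valueSize)) c

/-- `P` is a polynomial-time `c`-approximation for (N, ξ)-restricted d-MKCP with the given types of
function and of additional constraint.  The input includes the leveled partitions. -/
def IsRestrictedApprox (F : FunctionType) (C : ConstraintType) (N ξ d : ℕ) (c : ℝ) (P : Prog) :
    Prop :=
  ∃ p : Polynomial ℕ, ∀ (T : Instance d) (K : Fin d → List (List ℕ)), T.Valid F C →
    T.IsLeveled N K → T.HasSmallItems ξ →
    T.SolvedBy P (.node T.code (Instance.partitionCode K))
      (p.eval ((Val.node T.code (Instance.partitionCode K)).size + T.valueSize)) c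

end MKCP

/-!
An arbitrary instance is reduced to restricted ones by guessing a few items of large value and by
cutting the sorted bins into blocks.

**Guessing.** Let `S` be an optimal solution, and choose `ξ` of its items greedily, say the set `G`.
By submodularity no other item of `S` gains more than `f G / ξ` (`IsSubmodular.exists_greedy`).  If
`G` and the bins of its items are known, it remains to solve the instance in which the items of `G`
have been placed: its function is `U ↦ f (G ∪ U)`, capacities are reduced, and the additional
constraint is contracted, which preserves each of the types.  The value of the empty set is now
`f G`, so that an item that gains more than a fraction `1 / ξ` of it can be dropped, and all others
gain at most `OPT / ξ`, as the definition of restricted instances requires.  The items of `G` are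
guessed one at a time: from an algorithm that allows for `k` guesses, `Instance.guessItem` obtains
one that allows for `k + 1`, by trying all placements of one item in any bins and keeping the best
output.  Since `ξ` is a constant, the time stays polynomial.  Keeping the better output cannot
decrease the value for any outcome of the coin flips, hence the expected value is at least the
expectation for the right guess (`CoinTree.le_expect_foldl`).

**Leveling.** The bins of a constraint are sorted by decreasing capacity and cut into blocks of
sizes `N ^ (j / N ^ 2)`; the incomplete last block is dropped, and all capacities in a block are
lowered to that of its last bin.  A solution survives with a fraction `1 - 1 / N` of its value
(`exists_subset_level`): among the `N` residue classes of positions of bins, one can be emptied at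
the cost of at most a fraction `1 / N`, and then the contents of each other position `k` can move
forwards by at least `k / N` positions.
As every block of size `z > 1` begins after at least `N * z` bins, this passes the end of a block,
where the lowered capacity is large enough (`le_blockCap`).  Doing this for all `d` constraints
retains the fraction `(1 - 1 / N) ^ d ≥ 1 - d / N`.

**Running time.** `Computes σ inp out` says that one program computes the random output `out x` from
`inp x` in polynomial time, for all `x` under consideration; the closure of this notion under
composition, case distinction and folds over lists yields the algorithm.  Whether coins are allowed
is recorded in `σ`, so the same construction serves the deterministic claim.  The hypothetical
algorithm for restricted instances is called on contracted instances, whose oracles are those of the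
input with the guessed item added to every query; `exec_contract` simulates such a program with the
oracles of the input.
-/

namespace MKCP

/-! ### Trees of coin flips -/

namespace CoinTree

variable {α β γ : Type}

@[simp] theorem bind_ret (a : α) (k : α → CoinTree β) : (ret a).bind k = k a := rfl

@[simp] theorem map_ret (g : α → β) (a : α) : (ret a).map g = ret (g a) := rfl

@[simp] theorem leaves_ret (a : α) : (ret a).leaves = [a] := rfl

@[simp] theorem expect_ret (g : α → ℚ) (a : α) : (ret a).expect g = g a := rfl

theorem bind_assoc (D : CoinTree α) (k : α → CoinTree β) (m : β → CoinTree γ) :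
    (D.bind k).bind m = D.bind fun a => (k a).bind m := by
  induction D with
  | ret a => rfl
  | branch l r hl hr => simp [bind, hl, hr]

theorem bind_map (D : CoinTree α) (g : α → β) (k : β → CoinTree γ) :
    (D.map g).bind k = D.bind fun a => k (g a) := by
  simp [map, bind_assoc]

theorem map_bind (D : CoinTree α) (k : α → CoinTree β) (g : β → γ) :
    (D.bind k).map g = D.bind fun a => (k a).map g := by
  simp [map, bind_assoc]

theorem map_map (D : CoinTree α) (g : α → β) (h : β → γ) :
    (D.map g).map h = D.map fun a => h (g a) := by
  simp [map, bind_assoc]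

theorem bind_ret_right (D : CoinTree α) : D.bind ret = D := by
  induction D with
  | ret a => rfl
  | branch l r hl hr => simp [bind, hl, hr]

@[simp] theorem mem_leaves_bind {D : CoinTree α} {k : α → CoinTree β} {b : β} :
    b ∈ (D.bind k).leaves ↔ ∃ a ∈ D.leaves, b ∈ (k a).leaves := by
  induction D with
  | ret a => simp
  | branch l r hl hr => simp [bind, leaves, hl, hr, or_and_right, exists_or]

@[simp] theorem mem_leaves_map {D : CoinTree α} {g : α → β} {b : β} :
    b ∈ (D.map g).leaves ↔ ∃ a ∈ D.leaves, g a = b := by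
  simp [map, eq_comm]

theorem bind_congr {D : CoinTree α} {k m : α → CoinTree β} (h : ∀ a ∈ D.leaves, k a = m a) :
    D.bind k = D.bind m := by
  induction D with
  | ret a => exact h a (by simp)
  | branch l r hl hr =>
    simp only [bind]
    rw [hl fun a ha => h a (by simp [leaves, ha]), hr fun a ha => h a (by simp [leaves, ha])]

theorem expect_bind (D : CoinTree α) (k : α → CoinTree β) (g : β → ℚ) :
    (D.bind k).expect g = D.expect fun a => (k a).expect g := by
  induction D with
  | ret a => rfl
  | branch l r hl hr => simp [bind, expect, hl, hr]

theorem expect_map (D : CoinTree α) (h : α → β) (g : β → ℚ) :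
    (D.map h).expect g = D.expect fun a => g (h a) := by
  simp [map, expect_bind]

theorem expect_mono {D : CoinTree α} {g h : α → ℚ} (H : ∀ a ∈ D.leaves, g a ≤ h a) :
    D.expect g ≤ D.expect h := by
  induction D with
  | ret a => exact H a (by simp)
  | branch l r hl hr =>
    have := hl fun a ha => H a (by simp [leaves, ha])
    have := hr fun a ha => H a (by simp [leaves, ha])
    simp only [expect]
    linarith

@[simp] theorem expect_const (D : CoinTree α) (q : ℚ) : (D.expect fun _ => q) = q := by
  induction D with
  | ret a => rfl
  | branch l r hl hr => simp [expect, hl, hr]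

/-- Two trees have the same shape, and corresponding outcomes are related. -/
inductive Rel (R : α → β → Prop) : CoinTree α → CoinTree β → Prop
  | ret {a : α} {b : β} : R a b → Rel R (.ret a) (.ret b)
  | branch {l r : CoinTree α} {l' r' : CoinTree β} :
      Rel R l l' → Rel R r r' → Rel R (.branch l r) (.branch l' r')

theorem Rel.bind {α' β' : Type} {R : α → β → Prop} {R' : α' → β' → Prop} {D : CoinTree α}
    {D' : CoinTree β} {k : α → CoinTree α'} {k' : β → CoinTree β'} (h : Rel R D D')
    (hk : ∀ a ∈ D.leaves, ∀ b ∈ D'.leaves, R a b → Rel R' (k a) (k' b)) :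
    Rel R' (D.bind k) (D'.bind k') := by
  induction h with
  | ret h => exact hk _ (by simp) _ (by simp) h
  | branch _ _ hl hr =>
    exact .branch (hl fun a ha b hb => hk a (by simp [leaves, ha]) b (by simp [leaves, hb]))
      (hr fun a ha b hb => hk a (by simp [leaves, ha]) b (by simp [leaves, hb]))

theorem Rel.map_eq {R : α → β → Prop} {D : CoinTree α} {D' : CoinTree β} {g : α → γ} {g' : β → γ}
    (h : Rel R D D') (H : ∀ a b, R a b → g a = g' b) : D.map g = D'.map g' := by
  induction h with
  | ret h => simp [H _ _ h]
  | branch _ _ hl hr => exact congrArg₂ CoinTree.branch hl hr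

theorem Rel.exists_left {R : α → β → Prop} {D : CoinTree α} {D' : CoinTree β} (h : Rel R D D')
    {b : β} (hb : b ∈ D'.leaves) : ∃ a ∈ D.leaves, R a b := by
  induction h with
  | @ret a c h =>
    obtain rfl : b = c := by simpa using hb
    exact ⟨a, by simp, h⟩
  | branch _ _ hl hr =>
    rcases List.mem_append.1 hb with hb | hb
    · obtain ⟨a, ha, h⟩ := hl hb
      exact ⟨a, List.mem_append_left _ ha, h⟩
    · obtain ⟨a, ha, h⟩ := hr hb
      exact ⟨a, List.mem_append_right _ ha, h⟩

/-- A left fold over a list whose steps flip coins. -/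
def foldl (f : β → α → CoinTree β) : β → List α → CoinTree β
  | b, [] => .ret b
  | b, a :: l => (f b a).bind fun b' => foldl f b' l

theorem foldl_ret (f : β → α → β) (b : β) (l : List α) :
    foldl (fun b a => ret (f b a)) b l = ret (l.foldl f b) := by
  induction l generalizing b with
  | nil => rfl
  | cons a l ih => simp [foldl, ih]

theorem foldl_invariant {f : β → α → CoinTree β} {l : List α} {P : β → Prop}
    (hf : ∀ a ∈ l, ∀ b, P b → ∀ b' ∈ (f b a).leaves, P b') {b : β} (hb : P b) :
    ∀ b' ∈ (foldl f b l).leaves, P b' := by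
  induction l generalizing b with
  | nil => simpa [foldl] using hb
  | cons a l ih =>
    intro b' hb'
    obtain ⟨c, hc, hb'⟩ := mem_leaves_bind.1 hb'
    exact ih (fun a ha => hf a (List.mem_cons_of_mem _ ha))
      (hf a List.mem_cons_self b hb c hc) b' hb'

/-- If no step ever decreases `g`, then the expected final value of `g` is at least its expected
value right after the step for any given list element. -/
theorem le_expect_foldl {f : β → α → CoinTree β} {l : List α} {g : β → ℚ} {P : β → Prop}
    (hP : ∀ a ∈ l, ∀ b, P b → ∀ b' ∈ (f b a).leaves, P b')
    (hg : ∀ a ∈ l, ∀ b, P b → ∀ b' ∈ (f b a).leaves, g b ≤ g b') {b : β} (hb : P b) :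
    g b ≤ (foldl f b l).expect g ∧
      ∀ a ∈ l, ∀ q : ℚ, (∀ b, P b → q ≤ (f b a).expect g) → q ≤ (foldl f b l).expect g := by
  induction l generalizing b with
  | nil => simp [foldl]
  | cons a l ih =>
    have key : ∀ c, P c → g c ≤ (foldl f c l).expect g ∧ _ := fun c hc =>
      ih (fun a ha => hP a (List.mem_cons_of_mem _ ha))
        (fun a ha => hg a (List.mem_cons_of_mem _ ha)) hc
    have hab := hP a List.mem_cons_self b hb
    have h0 : (f b a).expect g ≤ (foldl f b (a :: l)).expect g := by
      simp only [foldl, expect_bind]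
      exact expect_mono fun c hc => (key c (hab c hc)).1
    refine ⟨?_, fun a' ha' q hq => ?_⟩
    · refine le_trans ?_ h0
      rw [← expect_const (f b a) (g b)]
      exact expect_mono fun c hc => hg a List.mem_cons_self b hb c hc
    · rcases List.mem_cons.1 ha' with rfl | ha'
      · exact (hq b hb).trans h0
      · simp only [foldl, expect_bind]
        rw [← expect_const (f b a) q]
        exact expect_mono fun c hc => (key c (hab c hc)).2 a' ha' q hq

end CoinTree

/-! ### Executions -/

@[simp] theorem mem_leaves_delay {n : ℕ} {D : CoinTree (Val × ℕ)} {y : Val × ℕ} :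
    y ∈ (delay n D).leaves ↔ ∃ x ∈ D.leaves, (x.1, n + x.2) = y := by
  simp [delay]

theorem map_fst_delay (n : ℕ) (D : CoinTree (Val × ℕ)) :
    (delay n D).map Prod.fst = D.map Prod.fst := by
  simp [delay, CoinTree.map_map]

@[simp] theorem Val.fst_node (a b : Val) : (Val.node a b).fst = a := rfl

@[simp] theorem Val.snd_node (a b : Val) : (Val.node a b).snd = b := rfl

@[simp] theorem Val.size_node (a b : Val) : (Val.node a b).size = a.size + b.size + 1 := rfl

theorem Val.one_le_size (v : Val) : 1 ≤ v.size := by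
  cases v <;> simp [Val.size, bitLength]

theorem Val.size_fst_le (v : Val) : v.fst.size ≤ v.size + 2 := by
  cases v with
  | leaf q => simp [Val.fst, Val.size, bitLength]
  | node a b => simp only [Val.fst, Val.size]; omega

theorem Val.size_snd_le (v : Val) : v.snd.size ≤ v.size := by
  cases v with
  | leaf q =>
    have : 0 < q.den.size := Nat.size_pos.2 q.den_pos
    simp [Val.snd, Val.size, bitLength]; omega
  | node a b => simp only [Val.snd, Val.size]; omega

namespace Exec

variable {O : Oracles} {p q : Prog} {v : Val} {D E : CoinTree (Val × ℕ)}

theorem unique (hD : Exec O p v D) (hE : Exec O p v E) : D = E := by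
  induction hD generalizing E with
  | op o v => cases hE; rfl
  | flip v => cases hE; rfl
  | pair _ _ hp hq =>
    cases hE with
    | pair hp' hq' => rw [hp hp', hq hq']
  | comp _ _ hp hq =>
    cases hE with
    | comp hp' hq' =>
      obtain rfl := hp hp'
      exact CoinTree.bind_congr fun x hx => by rw [hq x hx (hq' x hx)]
  | cond _ _ hb hq =>
    cases hE with
    | cond hb' hq' =>
      obtain rfl := hb hb'
      exact CoinTree.bind_congr fun x hx => by rw [hq x hx (hq' x hx)]
  | loop _ _ hp hq =>
    cases hE with
    | loop hp' hq' =>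
      obtain rfl := hp hp'
      refine CoinTree.bind_congr fun x hx => ?_
      split_ifs with h
      · rfl
      · rw [hq x hx h (hq' x hx h)]

/-- Reading the input and writing the output is charged. -/
theorem size_le (h : Exec O p v D) : ∀ x ∈ D.leaves, v.size ≤ x.2 ∧ x.1.size ≤ x.2 := by
  induction h with
  | op o v => simp; omega
  | flip v => simp [CoinTree.leaves]; omega
  | pair _ _ hp hq =>
    intro z hz
    simp only [CoinTree.mem_leaves_bind, CoinTree.mem_leaves_map] at hz
    obtain ⟨x, hx, y, hy, rfl⟩ := hz
    have := hp x hx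
    have := hq y hy
    simp only [Val.size]
    omega
  | comp _ _ hp hq =>
    intro z hz
    simp only [CoinTree.mem_leaves_bind, mem_leaves_delay] at hz
    obtain ⟨x, hx, y, hy, rfl⟩ := hz
    have := hp x hx
    have := hq x hx y hy
    simp only
    omega
  | cond _ _ hb hq =>
    intro z hz
    simp only [CoinTree.mem_leaves_bind, mem_leaves_delay] at hz
    obtain ⟨x, hx, y, hy, rfl⟩ := hz
    have := hq x hx y hy
    simp only
    omega
  | loop _ _ hp hq =>
    intro z hz
    simp only [CoinTree.mem_leaves_bind] at hz
    obtain ⟨x, hx, hz⟩ := hz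
    have := hp x hx
    split_ifs at hz with h
    · have := Val.size_snd_le x.1
      simp only [CoinTree.leaves_ret, List.mem_singleton] at hz
      subst hz
      simp only
      omega
    · simp only [mem_leaves_delay] at hz
      obtain ⟨y, hy, rfl⟩ := hz
      have := hq x hx h y hy
      simp only
      omega

end Exec

open Classical in
/-- The tree of outcomes of a program, with an arbitrary value if the program may run forever. -/
noncomputable def outcomes (O : Oracles) (p : Prog) (v : Val) : CoinTree (Val × ℕ) :=
  if h : ∃ D, Exec O p v D then h.choose else .ret (.leaf 0, 0)

theorem Exec.outcomes_eq {O : Oracles} {p : Prog} {v : Val} {D : CoinTree (Val × ℕ)}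
    (h : Exec O p v D) : outcomes O p v = D := by
  have h' : ∃ D, Exec O p v D := ⟨D, h⟩
  rw [outcomes, dif_pos h']
  exact h'.choose_spec.unique h

theorem Exec.exec_outcomes {O : Oracles} {p : Prog} {v : Val} {D : CoinTree (Val × ℕ)}
    (h : Exec O p v D) : Exec O p v (outcomes O p v) := by
  rwa [h.outcomes_eq]

/-! ### Simulation with an item added to every oracle query -/

/-- The oracles with item `i` added to every query. -/
def Oracles.contract (O : Oracles) (i : ℕ) : Oracles :=
  ⟨fun S => O.value (insert i S), fun k S => O.mem k (insert i S)⟩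

/-- Maps `node r i` to `node r.fst (node i r.snd)`. -/
def Prog.reassociate : Prog :=
  .pair (.comp (.op .fst) (.op .fst)) (.pair (.op .snd) (.comp (.op .fst) (.op .snd)))

/-- `p.contract` does on `node i v` what `p` does on `v` if item `i` is added to every query: as
data that list sets, `node i v` is `v` with `i` added, so an oracle call simply uses the whole
input. -/
def Prog.contract : Prog → Prog
  | .op .value => .op .value
  | .op (.mem k) => .op (.mem k)
  | .op o => .comp (.op .snd) (.op o)
  | .flip => .flip
  | .pair p q => .pair p.contract q.contract
  | .comp p q => .comp (.pair (.op .fst) p.contract) q.contract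
  | .cond b p q => .cond b.contract p.contract q.contract
  | .loop p => .comp (.loop (.comp (.pair p.contract (.op .fst)) .reassociate)) (.op .snd)

theorem Prog.Deterministic.contract {p : Prog} (h : p.Deterministic) :
    p.contract.Deterministic := by
  induction p with
  | op o => cases o <;> simp [Prog.contract, Prog.Deterministic]
  | flip => exact h
  | pair p q hp hq => exact ⟨hp h.1, hq h.2⟩
  | comp p q hp hq => exact ⟨⟨trivial, hp h.1⟩, hq h.2⟩
  | cond b p q hb hp hq => exact ⟨hb h.1, hp h.2.1, hq h.2.2⟩
  | loop p hp =>
    simp only [Prog.contract, Prog.Deterministic, Prog.reassociate, and_true]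
    exact hp h

theorem Val.toSet_node (i v : Val) : (Val.node i v).toSet = insert i.label v.toSet := by
  simp [Val.toSet, Val.toList]

theorem Exec.comp_ret {O : Oracles} {p q : Prog} {v w : Val} {n : ℕ} {E : CoinTree (Val × ℕ)}
    (hp : Exec O p v (.ret (w, n))) (hq : Exec O q w E) :
    Exec O (.comp p q) v (delay (1 + n) E) := by
  simpa using Exec.comp (K := fun _ => E) hp (by simpa using hq)

theorem Exec.comp_outcomes {O : Oracles} {p q : Prog} {v : Val} {D : CoinTree (Val × ℕ)}
    (hp : Exec O p v D) (hq : ∀ x ∈ D.leaves, ∃ E, Exec O q x.1 E) :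
    Exec O (.comp p q) v (D.bind fun x => delay (1 + x.2) (outcomes O q x.1)) :=
  .comp hp fun x hx => (hq x hx).choose_spec.exec_outcomes

theorem Exec.pair_ret {O : Oracles} {p q : Prog} {v a b : Val} {m n : ℕ}
    (hp : Exec O p v (.ret (a, m))) (hq : Exec O q v (.ret (b, n))) :
    Exec O (.pair p q) v (.ret (.node a b, 1 + v.size + m + n)) := by
  simpa using Exec.pair hp hq

theorem exec_reassociate (O : Oracles) (r i : Val) :
    ∃ n ≤ 30 * (r.size + i.size), Exec O .reassociate (.node r i)
      (.ret (.node r.fst (.node i r.snd), n)) := by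
  have h1 := Exec.comp_ret (.op (O := O) .fst (.node r i)) (.op .fst r)
  have h2 := Exec.comp_ret (.op (O := O) .fst (.node r i)) (.op .snd r)
  have h3 := Exec.pair_ret (Exec.op (O := O) .snd (.node r i)) h2
  refine ⟨_, ?_, Exec.pair_ret h1 h3⟩
  have := r.size_fst_le
  have := r.size_snd_le
  have := r.one_le_size
  have := i.one_le_size
  simp only [Op.eval, Val.fst_node, Val.snd_node, Val.size_node] at *
  omega

/-- The correspondence between an outcome of a program and one of its simulation. -/
def SlowerBy (k : ℕ) (x y : Val × ℕ) : Prop := x.1 = y.1 ∧ y.2 ≤ k * x.2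

/-- With the oracles `O`, the program `p.contract` simulates what `p` does with the contracted
oracles.  It is slower by a factor linear in the size of the item, which is carried along. -/
theorem exec_contract (p : Prog) : ∃ C : ℕ, ∀ (O : Oracles) (i v : Val) (D : CoinTree (Val × ℕ)),
    Exec (O.contract i.label) p v D →
      ∃ D', Exec O p.contract (.node i v) D' ∧ CoinTree.Rel (SlowerBy (C * (i.size + 1))) D D' := by
  induction p with
  | op o =>
    refine ⟨4, fun O i v D h => ?_⟩
    cases h
    have hv : ∀ s w : ℕ, 1 + (s + v.size + 1) + w ≤ 4 * (s + 1) * (1 + v.size + w) := by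
      intro s w
      have : s * v.size + s * w + v.size + w ≥ 0 := Nat.zero_le _
      nlinarith
    have key : ∀ o : Op, o.eval (O.contract i.label) v = o.eval O v →
        ∃ D', Exec O (.comp (.op .snd) (.op o)) (.node i v) D' ∧
          CoinTree.Rel (SlowerBy (4 * (i.size + 1)))
          (.ret (o.eval (O.contract i.label) v, 1 + v.size + (o.eval (O.contract i.label) v).size))
            D' := by
      intro o ho
      refine ⟨_, Exec.comp_ret (.op .snd _) (.op o _), .ret ⟨ho, ?_⟩⟩
      rw [ho]
      simp only [Op.eval, Val.snd, Val.size]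
      have : i.size * v.size + i.size * (o.eval O v).size ≥ 0 := Nat.zero_le _
      nlinarith
    have ho : ∀ o : Op, o.eval (O.contract i.label) v = o.eval O (.node i v) →
        SlowerBy (4 * (i.size + 1))
          (o.eval (O.contract i.label) v, 1 + v.size + (o.eval (O.contract i.label) v).size)
          (o.eval O (.node i v), 1 + (Val.node i v).size + (o.eval O (.node i v)).size) :=
      fun o ho => ⟨ho, by rw [ho]; exact hv _ _⟩
    cases o with
    | value =>
      refine ⟨_, .op _ _, .ret (ho _ ?_)⟩
      simp [Op.eval, Oracles.contract, Val.toSet_node]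
    | mem k =>
      refine ⟨_, .op _ _, .ret (ho _ ?_)⟩
      simp [Op.eval, Oracles.contract, Val.toSet_node]
    | _ => exact key _ rfl
  | flip =>
    refine ⟨4, fun O i v D h => ?_⟩
    cases h
    refine ⟨_, .flip _, .branch (.ret ⟨rfl, ?_⟩) (.ret ⟨rfl, ?_⟩)⟩ <;>
    · simp only [Val.size]
      nlinarith [Nat.zero_le (i.size * v.size)]
  | pair p q hp hq =>
    obtain ⟨Cp, hp⟩ := hp
    obtain ⟨Cq, hq⟩ := hq
    refine ⟨Cp + Cq + 2, fun O i v D h => ?_⟩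
    cases h with
    | pair h₁ h₂ =>
      obtain ⟨D', h₁', r₁⟩ := hp O i v _ h₁
      obtain ⟨E', h₂', r₂⟩ := hq O i v _ h₂
      refine ⟨_, .pair h₁' h₂', r₁.bind fun x hx x' hx' hxx' => r₂.bind fun y hy y' hy' hyy' =>
        .ret ⟨congrArg₂ Val.node hxx'.1 hyy'.1, ?_⟩⟩
      have h1 := hxx'.2
      have h2 := hyy'.2
      simp only [Val.size]
      nlinarith [Nat.zero_le (Cp * (i.size + 1) * (1 + v.size + y.2)),
        Nat.zero_le (Cq * (i.size + 1) * (1 + v.size + x.2)),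
        Nat.zero_le (i.size * v.size), Nat.zero_le ((i.size + 1) * (x.2 + y.2))]
  | comp p q hp hq =>
    obtain ⟨Cp, hp⟩ := hp
    obtain ⟨Cq, hq⟩ := hq
    refine ⟨Cp + Cq + 5, fun O i v D h => ?_⟩
    cases h with
    | @comp _ _ _ D K h₁ h₂ =>
      obtain ⟨D', h₁', r₁⟩ := hp O i v _ h₁
      refine ⟨_, .comp_outcomes (.pair (.op .fst _) h₁') ?_, ?_⟩
      · intro z hz
        simp only [Op.eval, Val.fst, CoinTree.bind_ret, CoinTree.mem_leaves_map] at hz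
        obtain ⟨y, hy, rfl⟩ := hz
        obtain ⟨x, hx, hxy⟩ := r₁.exists_left hy
        obtain ⟨E, hE, -⟩ := hq O i x.1 _ (h₂ x hx)
        exact ⟨E, by simpa [hxy.1] using hE⟩
      · simp only [CoinTree.bind_ret, CoinTree.bind_map]
        refine r₁.bind fun x hx x' hx' hxx' => ?_
        obtain ⟨E, hE, r₂⟩ := hq O i x.1 _ (h₂ x hx)
        rw [hxx'.1] at hE
        simp only [Op.eval, Val.fst]
        rw [hE.outcomes_eq]
        refine r₂.bind fun y hy y' hy' hyy' => .ret ⟨hyy'.1, ?_⟩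
        have h1 := hxx'.2
        have h2 := hyy'.2
        have h3 := (h₁.size_le x hx).1
        simp only [Val.size]
        nlinarith [Nat.zero_le (Cp * (i.size + 1) * (1 + y.2)),
          Nat.zero_le (Cq * (i.size + 1) * (1 + x.2)),
          Nat.zero_le (i.size * x.2), Nat.zero_le ((i.size + 1) * y.2)]
  | cond b p q hb hp hq =>
    obtain ⟨Cb, hb⟩ := hb
    obtain ⟨Cp, hp⟩ := hp
    obtain ⟨Cq, hq⟩ := hq
    refine ⟨Cb + Cp + Cq + 2, fun O i v D h => ?_⟩
    cases h with
    | @cond _ _ _ _ D K h₁ h₂ =>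
      obtain ⟨D', h₁', r₁⟩ := hb O i v _ h₁
      have hq' : ∀ x ∈ D.leaves, ∃ E, Exec O (if x.1 = .leaf 0 then q.contract else p.contract)
          (.node i v) E ∧ CoinTree.Rel (SlowerBy ((Cp + Cq) * (i.size + 1))) (K x) E := by
        intro x hx
        have h2 := h₂ x hx
        split_ifs at h2 ⊢
        · obtain ⟨E, hE, r⟩ := hq O i v _ h2
          refine ⟨E, hE, ?_⟩
          have := r.bind (k := CoinTree.ret) (k' := CoinTree.ret)
            (R' := SlowerBy ((Cp + Cq) * (i.size + 1))) fun a ha b hb hab => .ret ⟨hab.1,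
              hab.2.trans (by gcongr; omega)⟩
          simpa [CoinTree.bind_ret_right] using this
        · obtain ⟨E, hE, r⟩ := hp O i v _ h2
          refine ⟨E, hE, ?_⟩
          have := r.bind (k := CoinTree.ret) (k' := CoinTree.ret)
            (R' := SlowerBy ((Cp + Cq) * (i.size + 1))) fun a ha b hb hab => .ret ⟨hab.1,
              hab.2.trans (by gcongr; omega)⟩
          simpa [CoinTree.bind_ret_right] using this
      refine ⟨_, .cond (K := fun y => outcomes O (if y.1 = .leaf 0 then q.contract else p.contract)
        (.node i v)) h₁' ?_, ?_⟩
      · intro y hy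
        obtain ⟨x, hx, hxy⟩ := r₁.exists_left hy
        obtain ⟨E, hE, -⟩ := hq' x hx
        rw [hxy.1] at hE
        exact hE.exec_outcomes
      · refine r₁.bind fun x hx x' hx' hxx' => ?_
        obtain ⟨E, hE, r₂⟩ := hq' x hx
        rw [hxx'.1] at hE
        rw [hE.outcomes_eq]
        refine r₂.bind fun y hy y' hy' hyy' => .ret ⟨hyy'.1, ?_⟩
        have h1 := hxx'.2
        have h2 := hyy'.2
        simp only [Val.size]
        nlinarith [Nat.zero_le (Cb * (i.size + 1) * (1 + v.size + y.2)),
          Nat.zero_le ((Cp + Cq) * (i.size + 1) * (1 + v.size + x.2)),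
          Nat.zero_le (i.size * v.size), Nat.zero_le ((i.size + 1) * (x.2 + y.2))]
  | loop p hp =>
    obtain ⟨C, hp⟩ := hp
    have key : ∀ (O : Oracles) (i v : Val) (D : CoinTree (Val × ℕ)),
        Exec (O.contract i.label) (.loop p) v D →
        ∃ D', Exec O (.loop (.comp (.pair p.contract (.op .fst)) .reassociate)) (.node i v) D' ∧
          CoinTree.Rel (fun x y => y.1 = .node i x.1 ∧ y.2 ≤ (C + 60) * (i.size + 1) * x.2)
            D D' := by
      intro O i v D h
      generalize hl : Prog.loop p = l at h
      induction h with
      | op | flip | pair | comp | cond => simp at hl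
      | @loop _ v D K h₁ h₂ _ ih =>
        cases hl
        obtain ⟨D', h₁', r₁⟩ := hp O i v _ h₁
        choose n hn hn' using exec_reassociate O
        have hbody : Exec O (.comp (.pair p.contract (.op .fst)) .reassociate) (.node i v)
            (D'.map fun y => (.node y.1.fst (.node i y.1.snd),
              1 + (1 + (Val.node i v).size + y.2 + (1 + (Val.node i v).size + i.size))
                + n y.1 i)) := by
          have := Exec.comp (K := fun z => .ret (.node z.1.fst.fst (.node z.1.snd z.1.fst.snd),
            n z.1.fst z.1.snd)) (Exec.pair h₁' (.op .fst (.node i v))) (q := .reassociate) (by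
              intro z hz
              simp only [Op.eval, CoinTree.map_ret, CoinTree.mem_leaves_bind,
                CoinTree.leaves_ret, List.mem_singleton] at hz
              obtain ⟨y, hy, rfl⟩ := hz
              exact hn' _ _)
          simpa [CoinTree.bind_assoc, Op.eval, delay, CoinTree.map, Val.fst, Val.snd] using this
        refine ⟨_, .loop (K := fun z => outcomes O
          (.loop (.comp (.pair p.contract (.op .fst)) .reassociate)) z.1.snd) hbody ?_, ?_⟩
        · intro z hz hz0
          obtain ⟨y, hy, rfl⟩ := CoinTree.mem_leaves_map.1 hz
          obtain ⟨x, hx, hxy⟩ := r₁.exists_left hy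
          obtain ⟨E, hE, -⟩ := ih x hx (by rw [hxy.1]; exact hz0) rfl
          rw [hxy.1] at hE
          exact hE.exec_outcomes
        · rw [CoinTree.bind_map]
          refine r₁.bind fun x hx x' hx' hxx' => ?_
          obtain ⟨x'1, x'2⟩ := x'
          obtain ⟨rfl, h1⟩ := hxx'
          have h3 := h₁.size_le x hx
          have hn1 := hn x.1 i
          have hx1 := x.1.one_le_size
          have hb : 1 + (1 + (1 + (Val.node i v).size + x'2 + (1 + (Val.node i v).size
              + i.size)) + n x.1 i) ≤ (C + 60) * (i.size + 1) * x.2 := by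
            have : i.size ≤ i.size * x.2 := Nat.le_mul_of_pos_right _ (by omega)
            simp only [Val.size_node]
            nlinarith [Nat.zero_le (i.size * x.2)]
          show CoinTree.Rel _ (if x.1.fst = .leaf 0 then _ else _)
            (if x.1.fst = .leaf 0 then _ else _)
          by_cases h0 : x.1.fst = .leaf 0
          · rw [if_pos h0, if_pos h0]
            refine .ret ⟨rfl, ?_⟩
            simp only
            have : (C + 60) * (i.size + 1) * x.2 ≤ (C + 60) * (i.size + 1) * (1 + x.2) := by
              gcongr; omega
            exact hb.trans this
          · obtain ⟨E, hE, r₂⟩ := ih x hx h0 rfl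
            rw [if_neg h0, if_neg h0]
            simp only [Val.snd_node]
            rw [hE.outcomes_eq]
            refine r₂.bind fun y hy y' hy' hyy' => .ret ⟨hyy'.1, ?_⟩
            have h2 := hyy'.2
            nlinarith
    refine ⟨C + 70, fun O i v D h => ?_⟩
    obtain ⟨D', hD', r⟩ := key O i v D h
    refine ⟨_, .comp hD' fun x _ => .op .snd x.1, ?_⟩
    rw [← CoinTree.bind_ret_right D]
    refine r.bind fun x hx y hy hxy => .ret ⟨by simp [hxy.1, Op.eval], ?_⟩
    have h2 := hxy.2
    have h3 := (h.size_le x hx).2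
    have := x.1.one_le_size
    simp only [hxy.1, Op.eval, Val.snd_node, Val.size_node]
    have : i.size ≤ i.size * x.2 := Nat.le_mul_of_pos_right _ (by omega)
    nlinarith [Nat.zero_le (i.size * x.2)]

/-! ### Polynomial-time computations -/

variable {X Y : Type}

/-- The circumstances of a family of computations, indexed by `X`: whether coins may be flipped, the
indices that matter, the oracles, and a number to be added to the size of the input in time
bounds. -/
structure Setting (X : Type) where
  coins : Prop
  dom : X → Prop
  orc : X → Oracles
  extra : X → ℕ

/-- The circumstances for computations indexed by `Y` that are parts of the computations indexed
by `X`. -/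
def Setting.pull (σ : Setting X) (φ : Y → X) (dom : Y → Prop) : Setting Y :=
  ⟨σ.coins, dom, fun y => σ.orc (φ y), fun y => σ.extra (φ y)⟩

/-- The same circumstances, with fewer indices that matter. -/
def Setting.restrict (σ : Setting X) (c : X → Prop) : Setting X :=
  σ.pull id fun x => σ.dom x ∧ c x

/-- `g` is at most a polynomial in the input size. -/
def PolyBounded (σ : Setting X) (inp : X → Val) (g : X → ℕ) : Prop :=
  ∃ p : Polynomial ℕ, ∀ x, σ.dom x → g x ≤ p.eval ((inp x).size + σ.extra x)

/-- A single program, given `inp x`, outputs the tree of data `out x` in polynomial time. -/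
def Computes (σ : Setting X) (inp : X → Val) (out : X → CoinTree Val) : Prop :=
  ∃ P : Prog, (σ.coins ∨ P.Deterministic) ∧ ∃ g : X → ℕ, PolyBounded σ inp g ∧
    ∀ x, σ.dom x → ∃ E, Exec (σ.orc x) P (inp x) E ∧ E.map Prod.fst = out x ∧
      ∀ y ∈ E.leaves, y.2 ≤ g x

/-- A single program computes `f x` from `inp x` in polynomial time, for all outcomes of its coin
flips. -/
abbrev Det (σ : Setting X) (inp : X → Val) (f : X → Val) : Prop :=
  Computes σ inp fun x => .ret (f x)

theorem eval_le_eval (p : Polynomial ℕ) {a b : ℕ} (h : a ≤ b) : p.eval a ≤ p.eval b := by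
  simp only [Polynomial.eval_eq_sum_range]
  gcongr

namespace PolyBounded

variable {σ : Setting X} {inp : X → Val} {g h : X → ℕ}

theorem mono (hh : PolyBounded σ inp h) (H : ∀ x, σ.dom x → g x ≤ h x) : PolyBounded σ inp g := by
  obtain ⟨p, hp⟩ := hh
  exact ⟨p, fun x hx => (H x hx).trans (hp x hx)⟩

theorem add (hg : PolyBounded σ inp g) (hh : PolyBounded σ inp h) :
    PolyBounded σ inp fun x => g x + h x := by
  obtain ⟨p, hp⟩ := hg
  obtain ⟨q, hq⟩ := hh
  exact ⟨p + q, fun x hx => by simpa using add_le_add (hp x hx) (hq x hx)⟩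

theorem mul (hg : PolyBounded σ inp g) (hh : PolyBounded σ inp h) :
    PolyBounded σ inp fun x => g x * h x := by
  obtain ⟨p, hp⟩ := hg
  obtain ⟨q, hq⟩ := hh
  exact ⟨p * q, fun x hx => by simpa using Nat.mul_le_mul (hp x hx) (hq x hx)⟩

theorem const (n : ℕ) : PolyBounded σ inp fun _ => n :=
  ⟨.C n, fun x _ => by simp⟩

theorem inp_size : PolyBounded σ inp fun x => (inp x).size :=
  ⟨.X, fun x _ => by simp⟩

theorem extra : PolyBounded σ inp σ.extra :=
  ⟨.X, fun x _ => by simp⟩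

theorem eval (hg : PolyBounded σ inp g) (p : Polynomial ℕ) :
    PolyBounded σ inp fun x => p.eval (g x) := by
  obtain ⟨q, hq⟩ := hg
  exact ⟨p.comp q, fun x hx => by simpa using eval_le_eval p (hq x hx)⟩

theorem pull (hg : PolyBounded σ inp g) (φ : Y → X) {dom : Y → Prop} {inp' : Y → Val}
    (hd : ∀ y, dom y → σ.dom (φ y)) (hi : ∀ y, dom y → (inp (φ y)).size ≤ (inp' y).size) :
    PolyBounded (σ.pull φ dom) inp' fun y => g (φ y) := by
  obtain ⟨p, hp⟩ := hg
  exact ⟨p, fun y hy => (hp _ (hd y hy)).trans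
    (eval_le_eval p (Nat.add_le_add_right (hi y hy) _))⟩

end PolyBounded

namespace Computes

variable {σ : Setting X} {inp mid : X → Val} {out out' : X → CoinTree Val}

theorem congr (h : Computes σ inp out) (H : ∀ x, σ.dom x → out x = out' x) :
    Computes σ inp out' := by
  obtain ⟨P, hP, g, hg, H'⟩ := h
  refine ⟨P, hP, g, hg, fun x hx => ?_⟩
  rw [← H x hx]
  exact H' x hx

/-- Passes to other indices: every index of the new family has a counterpart with the same oracles,
input and output, and not more time. -/
theorem transfer {τ : Setting Y} {inp' : Y → Val} {out' : Y → CoinTree Val}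
    (h : Computes σ inp out) (hc : σ.coins → τ.coins)
    (H : ∀ y, τ.dom y → ∃ x, σ.dom x ∧ σ.orc x = τ.orc y ∧ σ.extra x ≤ τ.extra y ∧
      inp x = inp' y ∧ out x = out' y) : Computes τ inp' out' := by
  obtain ⟨P, hP, g, ⟨p, hp⟩, H'⟩ := h
  refine ⟨P, hP.imp_left hc, fun y => p.eval ((inp' y).size + τ.extra y), ⟨p, fun _ _ => le_rfl⟩,
    fun y hy => ?_⟩
  obtain ⟨x, hx, ho, he, hi, hu⟩ := H y hy
  obtain ⟨E, hE, hE', hEg⟩ := H' x hx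
  refine ⟨E, by rwa [← ho, ← hi], by rw [hE', hu], fun z hz => ?_⟩
  refine (hEg z hz).trans ((hp x hx).trans (eval_le_eval p ?_))
  rw [hi]
  omega

theorem pull (h : Computes σ inp out) (φ : Y → X) {dom : Y → Prop}
    (hd : ∀ y, dom y → σ.dom (φ y)) :
    Computes (σ.pull φ dom) (fun y => inp (φ y)) fun y => out (φ y) :=
  h.transfer id fun y hy => ⟨φ y, hd y hy, rfl, le_rfl, rfl, rfl⟩

theorem restrict (h : Computes σ inp out) (c : X → Prop) : Computes (σ.restrict c) inp out :=
  h.pull id fun _ hx => hx.1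

theorem leaves_size (h : Computes σ inp out) :
    ∃ g, PolyBounded σ inp g ∧ ∀ x, σ.dom x → ∀ v ∈ (out x).leaves, v.size ≤ g x := by
  obtain ⟨P, -, g, hg, H⟩ := h
  refine ⟨g, hg, fun x hx v hv => ?_⟩
  obtain ⟨E, hE, hE', hEg⟩ := H x hx
  rw [← hE', CoinTree.mem_leaves_map] at hv
  obtain ⟨y, hy, rfl⟩ := hv
  exact ((hE.size_le y hy).2).trans (hEg y hy)

/-- Composition: the first program flips the coins of `M` and outputs the code of the result, from
which the second one continues.  Only results that can occur matter for the second one. -/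
theorem bind {β : Type} {M : X → CoinTree β} {enc : X → β → Val} {K : X → β → CoinTree Val}
    (h₁ : Computes σ inp fun x => (M x).map (enc x))
    (h₂ : Computes (σ.pull Prod.fst fun y : X × β => σ.dom y.1 ∧ y.2 ∈ (M y.1).leaves)
      (fun y => enc y.1 y.2) fun y => K y.1 y.2) :
    Computes σ inp fun x => (M x).bind (K x) := by
  obtain ⟨P, hP, g, hg, H⟩ := h₁
  obtain ⟨Q, hQ, h, ⟨q, hq⟩, H'⟩ := h₂
  have hPQ : σ.coins ∨ (Prog.comp P Q).Deterministic := by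
    rcases hP with hP | hP
    · exact .inl hP
    · rcases hQ with hQ | hQ
      · exact .inl hQ
      · exact .inr ⟨hP, hQ⟩
  refine ⟨_, hPQ, fun x => 1 + g x + q.eval (g x + σ.extra x),
    (((PolyBounded.const 1).add hg).add ((hg.add PolyBounded.extra).eval q)), fun x hx => ?_⟩
  obtain ⟨E, hE, hE', hEg⟩ := H x hx
  have key : ∀ y ∈ E.leaves, ∃ b ∈ (M x).leaves, enc x b = y.1 := fun y hy => by
    have : y.1 ∈ (E.map Prod.fst).leaves := CoinTree.mem_leaves_map.2 ⟨y, hy, rfl⟩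
    rwa [hE', CoinTree.mem_leaves_map] at this
  refine ⟨_, .comp_outcomes hE fun y hy => ?_, ?_, fun z hz => ?_⟩
  · obtain ⟨b, hb, hby⟩ := key y hy
    obtain ⟨F, hF, -⟩ := H' (x, b) ⟨hx, hb⟩
    exact ⟨F, by rw [← hby]; exact hF⟩
  · simp only [CoinTree.map_bind, map_fst_delay]
    rw [← CoinTree.bind_map E Prod.fst fun v => (outcomes (σ.orc x) Q v).map Prod.fst, hE',
      CoinTree.bind_map]
    refine CoinTree.bind_congr fun b hb => ?_
    obtain ⟨F, hF, hF', -⟩ := H' (x, b) ⟨hx, hb⟩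
    exact (congrArg _ (Exec.outcomes_eq hF)).trans hF'
  · simp only [CoinTree.mem_leaves_bind, mem_leaves_delay] at hz
    obtain ⟨y, hy, w, hw, rfl⟩ := hz
    obtain ⟨b, hb, hby⟩ := key y hy
    obtain ⟨F, hF, hF', hFg⟩ := H' (x, b) ⟨hx, hb⟩
    have hF : Exec (σ.orc x) Q y.1 F := by rw [← hby]; exact hF
    rw [hF.outcomes_eq] at hw
    have h1 := (hFg w hw).trans (hq (x, b) ⟨hx, hb⟩)
    have h2 := hEg y hy
    have h3 : q.eval ((enc x b).size + σ.extra x) ≤ q.eval (g x + σ.extra x) := by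
      refine eval_le_eval q (Nat.add_le_add_right ?_ _)
      rw [hby]
      exact (hE.size_le y hy).2.trans h2
    have h4 := h1.trans h3
    simp only
    omega

/-- For the second part of a computation, the size of the initial input may enter time bounds. -/
theorem seq_extra (h₁ : Det σ inp mid)
    (h₂ : Computes { σ with extra := fun x => (inp x).size + σ.extra x } mid out) :
    Computes σ inp out := by
  obtain ⟨P, hP, g, hg, H⟩ := h₁
  obtain ⟨Q, hQ, h, ⟨q, hq⟩, H'⟩ := h₂
  have hPQ : σ.coins ∨ (Prog.comp P Q).Deterministic := by
    rcases hP with hP | hP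
    · exact .inl hP
    · rcases hQ with hQ | hQ
      · exact .inl hQ
      · exact .inr ⟨hP, hQ⟩
  refine ⟨_, hPQ, fun x => 1 + g x + q.eval (g x + ((inp x).size + σ.extra x)),
    (((PolyBounded.const 1).add hg).add ((hg.add (PolyBounded.inp_size.add .extra)).eval q)),
    fun x hx => ?_⟩
  obtain ⟨E, hE, hE', hEg⟩ := H x hx
  obtain ⟨F, hF, hF', hFg⟩ := H' x hx
  have hEv : ∀ y ∈ E.leaves, y.1 = mid x := fun y hy => by
    have : y.1 ∈ (E.map Prod.fst).leaves := CoinTree.mem_leaves_map.2 ⟨y, hy, rfl⟩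
    simpa [hE'] using this
  refine ⟨_, .comp (K := fun _ => F) hE fun y hy => by rw [hEv y hy]; exact hF, ?_,
    fun z hz => ?_⟩
  · simp only [CoinTree.map_bind, map_fst_delay]
    rw [← CoinTree.bind_map E Prod.fst fun _ => F.map Prod.fst, hE']
    exact hF'
  · simp only [CoinTree.mem_leaves_bind, mem_leaves_delay] at hz
    obtain ⟨y, hy, w, hw, rfl⟩ := hz
    have h1 := (hFg w hw).trans (hq x hx)
    have h2 := hEg y hy
    have h3 : q.eval ((mid x).size + ((inp x).size + σ.extra x)) ≤
        q.eval (g x + ((inp x).size + σ.extra x)) := by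
      refine eval_le_eval q (Nat.add_le_add_right ?_ _)
      rw [← hEv y hy]
      exact (hE.size_le y hy).2.trans h2
    have h4 := h1.trans h3
    simp only
    omega

theorem seq (h₁ : Det σ inp mid) (h₂ : Computes σ mid out) : Computes σ inp out :=
  seq_extra h₁ (h₂.transfer id fun x hx => ⟨x, hx, rfl, Nat.le_add_left _ _, rfl, rfl⟩)

/-- The deterministic result `c x` is kept for later use, next to the output of a computation. -/
theorem pair_left {c : X → Val} (hc : Det σ inp c) (h : Computes σ inp out) :
    Computes σ inp fun x => (out x).map fun v => .node (c x) v := by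
  obtain ⟨P, hP, g, hg, H⟩ := hc
  obtain ⟨Q, hQ, h, hh, H'⟩ := h
  have hPQ : σ.coins ∨ (Prog.pair P Q).Deterministic := by
    rcases hP with hP | hP
    · exact .inl hP
    · rcases hQ with hQ | hQ
      · exact .inl hQ
      · exact .inr ⟨hP, hQ⟩
  refine ⟨_, hPQ, fun x => 1 + (inp x).size + g x + h x,
    (((PolyBounded.const 1).add .inp_size).add hg).add hh, fun x hx => ?_⟩
  obtain ⟨E, hE, hE', hEg⟩ := H x hx
  obtain ⟨F, hF, hF', hFg⟩ := H' x hx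
  refine ⟨_, .pair hE hF, ?_, fun z hz => ?_⟩
  · simp only [CoinTree.map_bind, CoinTree.map_map]
    rw [← hF', CoinTree.map_map]
    rw [← CoinTree.bind_map E Prod.fst fun v => F.map fun a => Val.node v a.1, hE']
    rfl
  · simp only [CoinTree.mem_leaves_bind, CoinTree.mem_leaves_map] at hz
    obtain ⟨y, hy, w, hw, rfl⟩ := hz
    have := hEg y hy
    have := hFg w hw
    simp only
    omega

theorem ite {c : X → Prop} [DecidablePred c] (hc : Det σ inp fun x => Val.ofBool (decide (c x)))
    (h : Computes (σ.restrict c) inp out) (h' : Computes (σ.restrict fun x => ¬ c x) inp out') :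
    Computes σ inp fun x => if c x then out x else out' x := by
  obtain ⟨B, hB, g, hg, H⟩ := hc
  obtain ⟨P, hP, g₁, ⟨p₁, hp₁⟩, H₁⟩ := h
  obtain ⟨Q, hQ, g₂, ⟨p₂, hp₂⟩, H₂⟩ := h'
  have hPQ : σ.coins ∨ (Prog.cond B P Q).Deterministic := by
    by_cases h : σ.coins
    · exact .inl h
    · exact .inr ⟨hB.resolve_left h, hP.resolve_left h, hQ.resolve_left h⟩
  refine ⟨_, hPQ, fun x => 1 + (inp x).size + g x + (p₁.eval ((inp x).size + σ.extra x)
    + p₂.eval ((inp x).size + σ.extra x)),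
    (((PolyBounded.const 1).add .inp_size).add hg).add
      (((PolyBounded.inp_size.add .extra).eval p₁).add
        ((PolyBounded.inp_size.add .extra).eval p₂)), fun x hx => ?_⟩
  obtain ⟨E, hE, hE', hEg⟩ := H x hx
  have hEv : ∀ y ∈ E.leaves, y.1 = Val.ofBool (decide (c x)) := fun y hy => by
    have : y.1 ∈ (E.map Prod.fst).leaves := CoinTree.mem_leaves_map.2 ⟨y, hy, rfl⟩
    simpa [hE'] using this
  have key : ∃ F, (∀ y ∈ E.leaves, Exec (σ.orc x) (if y.1 = .leaf 0 then Q else P) (inp x) F) ∧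
      F.map Prod.fst = (if c x then out x else out' x) ∧ ∀ y ∈ F.leaves,
        y.2 ≤ p₁.eval ((inp x).size + σ.extra x) + p₂.eval ((inp x).size + σ.extra x) := by
    by_cases hcx : c x
    · obtain ⟨F, hF, hF', hFg⟩ := H₁ x ⟨hx, hcx⟩
      refine ⟨F, fun y hy => ?_, by rw [hF', if_pos hcx], fun y hy => ?_⟩
      · rw [hEv y hy, if_neg (by simp [hcx, Val.ofBool])]
        exact hF
      · exact ((hFg y hy).trans (hp₁ x ⟨hx, hcx⟩)).trans (Nat.le_add_right _ _)
    · obtain ⟨F, hF, hF', hFg⟩ := H₂ x ⟨hx, hcx⟩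
      refine ⟨F, fun y hy => ?_, by rw [hF', if_neg hcx], fun y hy => ?_⟩
      · rw [hEv y hy, if_pos (by simp [hcx, Val.ofBool])]
        exact hF
      · exact ((hFg y hy).trans (hp₂ x ⟨hx, hcx⟩)).trans (Nat.le_add_left _ _)
  obtain ⟨F, hF, hF', hFg⟩ := key
  refine ⟨_, .cond (K := fun _ => F) hE hF, ?_, fun z hz => ?_⟩
  · simp only [CoinTree.map_bind, map_fst_delay]
    rw [← CoinTree.bind_map E Prod.fst fun _ => F.map Prod.fst, hE']
    exact hF'
  · simp only [CoinTree.mem_leaves_bind, mem_leaves_delay] at hz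
    obtain ⟨y, hy, w, hw, rfl⟩ := hz
    have := hEg y hy
    have := hFg w hw
    simp only
    omega

end Computes

namespace Det

variable {σ : Setting X} {inp f h : X → Val}

theorem congr (hf : Det σ inp f) (H : ∀ x, σ.dom x → f x = h x) : Det σ inp h :=
  Computes.congr hf fun x hx => by rw [H x hx]

theorem polyBounded (hf : Det σ inp f) : PolyBounded σ inp fun x => (f x).size := by
  obtain ⟨g, hg, H⟩ := Computes.leaves_size hf
  exact hg.mono fun x hx => H x hx _ (by simp)

theorem comp {g : X → Val} (hf : Det σ inp f) (hg : Det σ f g) : Det σ inp g :=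
  Computes.seq hf hg

theorem node (hf : Det σ inp f) (hh : Det σ inp h) : Det σ inp fun x => .node (f x) (h x) :=
  Computes.pair_left hf hh

theorem op (o : Op) (ho : PolyBounded σ f fun x => (o.eval (σ.orc x) (f x)).size)
    (hf : Det σ inp f) : Det σ inp fun x => o.eval (σ.orc x) (f x) := by
  refine hf.comp ⟨.op o, .inr trivial, fun x => 1 + (f x).size + (o.eval (σ.orc x) (f x)).size,
    ((PolyBounded.const 1).add .inp_size).add ho, fun x hx => ⟨_, .op _ _, rfl, ?_⟩⟩
  simp

theorem input : Det σ inp inp :=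
  ⟨.op .id, .inr trivial, fun x => 1 + (inp x).size + (inp x).size,
    ((PolyBounded.const 1).add .inp_size).add .inp_size,
    fun x hx => ⟨_, .op _ _, rfl, by simp [Op.eval]⟩⟩

theorem const (w : Val) : Det σ inp fun _ => w :=
  op (.const w) (PolyBounded.const w.size) input

theorem fst (hf : Det σ inp f) : Det σ inp fun x => (f x).fst :=
  op .fst ((PolyBounded.inp_size.add (.const 2)).mono fun x _ => (f x).size_fst_le) hf

theorem snd (hf : Det σ inp f) : Det σ inp fun x => (f x).snd :=
  op .snd (PolyBounded.inp_size.mono fun x _ => (f x).size_snd_le) hf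

theorem _root_.MKCP.Val.size_ofBool_le (b : Bool) : (Val.ofBool b).size ≤ 3 := by
  cases b <;> simp [Val.ofBool, Val.size, bitLength]

theorem isNode (hf : Det σ inp f) : Det σ inp fun x => Val.ofBool (f x).isNode :=
  op .isNode ((PolyBounded.const 3).mono fun _ _ => Val.size_ofBool_le _) hf

theorem mem (k : Fin 2) (hf : Det σ inp f) :
    Det σ inp fun x => Val.ofBool ((σ.orc x).mem k (f x).toSet) :=
  op (.mem k) ((PolyBounded.const 3).mono fun _ _ => Val.size_ofBool_le _) hf

theorem value (hf : Det σ inp f)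
    (hv : PolyBounded σ f fun x => bitLength ((σ.orc x).value (f x).toSet)) :
    Det σ inp fun x => .leaf ((σ.orc x).value (f x).toSet) :=
  op .value hv hf

theorem le {a b : X → ℚ} (ha : Det σ inp fun x => .leaf (a x))
    (hb : Det σ inp fun x => .leaf (b x)) :
    Det σ inp fun x => Val.ofBool (decide (a x ≤ b x)) :=
  op .le ((PolyBounded.const 3).mono fun _ _ => Val.size_ofBool_le _) (ha.node hb)

theorem ite {c : X → Prop} [DecidablePred c] (hc : Det σ inp fun x => Val.ofBool (decide (c x)))
    (hf : Det (σ.restrict c) inp f) (hh : Det (σ.restrict fun x => ¬ c x) inp h) :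
    Det σ inp fun x => if c x then f x else h x :=
  Computes.congr (Computes.ite hc hf hh) fun x _ => by dsimp only; split_ifs <;> rfl

theorem pull (hf : Det σ inp f) (φ : Y → X) {dom : Y → Prop} (hd : ∀ y, dom y → σ.dom (φ y)) :
    Det (σ.pull φ dom) (fun y => inp (φ y)) fun y => f (φ y) :=
  Computes.pull hf φ hd

end Det

/-! ### Sizes of numbers -/

theorem Nat_size_le_self (n : ℕ) : n.size ≤ n :=
  Nat.size_le.2 Nat.lt_two_pow_self

theorem Nat_size_mul_le (m n : ℕ) : (m * n).size ≤ m.size + n.size := by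
  rw [Nat.size_le, pow_add]
  exact Nat.mul_lt_mul'' m.lt_size_self n.lt_size_self

theorem Nat_size_add_le (m n : ℕ) : (m + n).size ≤ m.size + n.size + 1 := by
  rw [Nat.size_le, pow_succ, pow_add]
  have := m.lt_size_self
  have := n.lt_size_self
  have := Nat.one_le_two_pow (n := m.size)
  have := Nat.one_le_two_pow (n := n.size)
  nlinarith

theorem bitLength_natCast_le (n : ℕ) : bitLength (n : ℚ) ≤ n + 2 := by
  have := Nat_size_le_self n
  simp [bitLength]
  omega

theorem bitLength_intCast (z : ℤ) : bitLength (z : ℚ) = z.natAbs.size + 2 := by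
  simp [bitLength]

theorem bitLength_floor_le (q : ℚ) : bitLength (⌊q⌋ : ℤ) ≤ bitLength q + 3 := by
  rw [bitLength_intCast]
  have h : ⌊q⌋.natAbs ≤ q.num.natAbs + 1 := by
    have hd : (1 : ℤ) ≤ q.den := by exact_mod_cast q.den_pos
    have : ⌊q⌋ = q.num / q.den := Rat.floor_def q
    have h1 : ⌊q⌋ * q.den ≤ q.num := by
      rw [this]; exact Int.ediv_mul_le _ (by omega)
    have h2 : q.num < (⌊q⌋ + 1) * q.den := by
      rw [this]; exact Int.lt_ediv_add_one_mul_self _ (by omega)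
    have h3 : ⌊q⌋ ≤ |q.num| := by
      by_contra! h
      have := le_abs_self q.num
      have := abs_nonneg q.num
      nlinarith
    have h4 : - (|q.num| + 1) ≤ ⌊q⌋ := by
      by_contra! h
      have := neg_abs_le q.num
      have := abs_nonneg q.num
      nlinarith
    rw [← Int.natCast_natAbs q.num] at h3 h4
    omega
  have h1 := Nat.size_le_size h
  have h2 := Nat_size_add_le q.num.natAbs 1
  have h3 : Nat.size 1 = 1 := by simp
  simp only [bitLength]
  omega

theorem bitLength_neg (q : ℚ) : bitLength (-q) = bitLength q := by
  simp [bitLength]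

theorem bitLength_mul_le (q r : ℚ) : bitLength (q * r) ≤ bitLength q + bitLength r := by
  have h1 : (q * r).num.natAbs ≤ q.num.natAbs * r.num.natAbs := by
    have h := congrArg Int.natAbs (Rat.mul_num_den' q r)
    simp only [Int.natAbs_mul, Int.natAbs_natCast] at h
    have hd := Nat.le_of_dvd (Nat.mul_pos q.den_pos r.den_pos) (Rat.mul_den_dvd q r)
    have hp := Nat.mul_pos q.den_pos r.den_pos
    refine Nat.le_of_mul_le_mul_right ?_ hp
    rw [← mul_assoc, h]
    exact Nat.mul_le_mul_left _ hd
  have h2 := Nat.le_of_dvd (Nat.mul_pos q.den_pos r.den_pos) (Rat.mul_den_dvd q r)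
  have h3 := (Nat.size_le_size h1).trans (Nat_size_mul_le _ _)
  have h4 := (Nat.size_le_size h2).trans (Nat_size_mul_le _ _)
  simp only [bitLength]
  omega

theorem bitLength_add_le (q r : ℚ) :
    bitLength (q + r) ≤ 2 * (bitLength q + bitLength r) := by
  have h1 : (q + r).num.natAbs ≤ q.num.natAbs * r.den + q.den * r.num.natAbs := by
    have h := congrArg Int.natAbs (Rat.add_num_den' q r)
    simp only [Int.natAbs_mul, Int.natAbs_natCast] at h
    have hd := Nat.le_of_dvd (Nat.mul_pos q.den_pos r.den_pos) (Rat.add_den_dvd q r)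
    have hp := Nat.mul_pos q.den_pos r.den_pos
    refine Nat.le_of_mul_le_mul_right ?_ hp
    rw [← mul_assoc, h]
    refine Nat.mul_le_mul ?_ hd
    refine (Int.natAbs_add_le _ _).trans ?_
    simp [Int.natAbs_mul, mul_comm]
  have h2 := Nat.le_of_dvd (Nat.mul_pos q.den_pos r.den_pos) (Rat.add_den_dvd q r)
  have h3 := (Nat.size_le_size h1).trans (Nat_size_add_le _ _)
  have h4 := (Nat.size_le_size h2).trans (Nat_size_mul_le _ _)
  have h5 := Nat_size_mul_le q.num.natAbs r.den
  have h6 := Nat_size_mul_le q.den r.num.natAbs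
  simp only [bitLength]
  omega

theorem Val.bitLength_num_le (v : Val) : bitLength v.num ≤ v.size + 1 := by
  cases v with
  | leaf q => simp [Val.num, Val.size]
  | node a b =>
    have := a.one_le_size
    simp [Val.num, bitLength]

@[simp] theorem Val.num_leaf (q : ℚ) : (Val.leaf q).num = q := rfl

@[simp] theorem Val.size_leaf (q : ℚ) : (Val.leaf q).size = bitLength q := rfl

theorem bitLength_zero : bitLength 0 = 2 := by simp [bitLength]

@[simp] theorem Val.label_ofNat (n : ℕ) : (Val.ofNat n).label = n := by
  simp [Val.label, Val.ofNat]

namespace Det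

variable {σ : Setting X} {inp f h : X → Val}

theorem restrict (hf : Det σ inp f) (c : X → Prop) : Det (σ.restrict c) inp f :=
  Computes.restrict hf c

theorem not {c : X → Prop} [DecidablePred c] (hc : Det σ inp fun x => Val.ofBool (decide (c x))) :
    Det σ inp fun x => Val.ofBool (decide (¬ c x)) :=
  (ite hc (const (Val.ofBool false)) (const (Val.ofBool true))).congr fun x _ => by
    by_cases h : c x <;> simp [h]

theorem and {b c : X → Prop} [DecidablePred b] [DecidablePred c]
    (hb : Det σ inp fun x => Val.ofBool (decide (b x)))
    (hc : Det (σ.restrict b) inp fun x => Val.ofBool (decide (c x))) :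
    Det σ inp fun x => Val.ofBool (decide (b x ∧ c x)) :=
  (ite hb hc (const (Val.ofBool false))).congr fun x _ => by
    by_cases h : b x <;> simp [h]

theorem eq {a b : X → ℚ} (ha : Det σ inp fun x => .leaf (a x))
    (hb : Det σ inp fun x => .leaf (b x)) : Det σ inp fun x => Val.ofBool (decide (a x = b x)) :=
  (and (le ha hb) ((le hb ha).restrict _)).congr fun x _ => by simp only [le_antisymm_iff]

theorem eqNat {a b : X → ℕ} (ha : Det σ inp fun x => .ofNat (a x))
    (hb : Det σ inp fun x => .ofNat (b x)) : Det σ inp fun x => Val.ofBool (decide (a x = b x)) :=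
  (eq ha hb).congr fun x _ => by simp

theorem sub {a b : X → ℚ} (ha : Det σ inp fun x => .leaf (a x))
    (hb : Det σ inp fun x => .leaf (b x)) : Det σ inp fun x => .leaf (a x - b x) :=
  op .sub (((PolyBounded.const 2).mul PolyBounded.inp_size).mono fun x _ => by
    have := bitLength_add_le (a x) (-b x)
    rw [bitLength_neg, ← sub_eq_add_neg] at this
    simp only [Op.eval, Val.fst_node, Val.snd_node, Val.num_leaf, Val.size_leaf, Val.size_node]
    omega) (ha.node hb)

theorem mul {a b : X → ℚ} (ha : Det σ inp fun x => .leaf (a x))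
    (hb : Det σ inp fun x => .leaf (b x)) : Det σ inp fun x => .leaf (a x * b x) :=
  op .mul (PolyBounded.inp_size.mono fun x _ => by
    have := bitLength_mul_le (a x) (b x)
    simp only [Op.eval, Val.fst_node, Val.snd_node, Val.num_leaf, Val.size_leaf, Val.size_node]
    omega) (ha.node hb)

theorem label (hf : Det σ inp f) : Det σ inp fun x => .ofNat (f x).label := by
  have hnum : Det σ inp fun x => .leaf (f x).num := by
    have := op (σ := σ) .sub (((PolyBounded.const 2).mul PolyBounded.inp_size).mono fun x _ => by
      have h1 := (f x).bitLength_num_le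
      have h2 := (f x).one_le_size
      simp only [Op.eval, Val.fst_node, Val.snd_node, Val.num_leaf, sub_zero, Val.size_leaf,
        Val.size_node, bitLength_zero]
      omega) (hf.node (const (.leaf 0)))
    exact this.congr fun x _ => by simp [Op.eval]
  have hfloor : Det σ inp fun x => .leaf (⌊(f x).num⌋ : ℤ) :=
    op .floor ((PolyBounded.inp_size.add (.const 4)).mono fun x _ => by
      have h1 := (f x).bitLength_num_le
      have h2 := bitLength_floor_le (f x).num
      simp only [Op.eval, Val.size_leaf]
      omega) hf
  refine (ite (le hnum (const (.leaf 0))) (const (.leaf 0)) (hfloor.restrict _)).congr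
    fun x _ => ?_
  split_ifs with h
  · simp [Val.ofNat, Val.label, Nat.floor_of_nonpos h]
  · have : ((⌊(f x).num⌋₊ : ℕ) : ℤ) = ⌊(f x).num⌋ := Int.natCast_floor_eq_floor (le_of_not_ge h)
    rw [← this]; rfl

end Det

/-! ### Loops over lists -/

theorem Val.length_toList_le (v : Val) : v.toList.length ≤ v.size := by
  induction v with
  | leaf q => simp [Val.toList]
  | node a b _ hb => simp only [Val.toList, List.length_cons, Val.size_node]; omega

theorem Val.size_le_of_mem_toList {v w : Val} (h : w ∈ v.toList) : w.size ≤ v.size := by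
  induction v with
  | leaf q => simp [Val.toList] at h
  | node a b _ hb =>
    rw [Val.size_node]
    rcases List.mem_cons.1 h with rfl | h
    · omega
    · have := hb h; omega

@[simp] theorem Val.toList_ofList (l : List Val) : (Val.ofList l).toList = l := by
  induction l with
  | nil => rfl
  | cons a l ih => simp [Val.ofList, Val.toList, ih]

/-- If each step is computed in polynomial time and the size of the accumulator stays polynomial,
then the fold over a list is computed in polynomial time.  `Inv x l b` is an invariant that relates
the accumulator `b` to the initial part `l` of the list that has been processed. -/
theorem Computes.foldl {α β : Type} {σ : Setting X} {inp c L : X → Val} {l : X → List α}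
    {ea : X → α → Val} {eb : X → β → Val} {step : X → β → α → CoinTree β} {b₀ : X → β} {g : X → ℕ}
    (Inv : X → List α → β → Prop) (hc : Det σ inp c) (hL : Det σ inp L)
    (hl : ∀ x, σ.dom x → (L x).toList = (l x).map (ea x)) (hb : Det σ inp fun x => eb x (b₀ x))
    (hstep : Computes (σ.pull Prod.fst fun y : X × α × β => σ.dom y.1 ∧
        ∃ l₁ l₂, l y.1 = l₁ ++ y.2.1 :: l₂ ∧ Inv y.1 l₁ y.2.2)
      (fun y => .node (c y.1) (.node (ea y.1 y.2.1) (eb y.1 y.2.2)))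
      fun y => (step y.1 y.2.2 y.2.1).map (eb y.1))
    (h₀ : ∀ x, σ.dom x → Inv x [] (b₀ x))
    (h₁ : ∀ x, σ.dom x → ∀ l₁ a l₂ b, l x = l₁ ++ a :: l₂ → Inv x l₁ b →
      ∀ b' ∈ (step x b a).leaves, Inv x (l₁ ++ [a]) b')
    (hg : PolyBounded σ inp g)
    (hsize : ∀ x, σ.dom x → ∀ l₁ l₂ b, l x = l₁ ++ l₂ → Inv x l₁ b → (eb x b).size ≤ g x) :
    Computes σ inp fun x => (CoinTree.foldl (step x) (b₀ x) (l x)).map (eb x) := by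
  refine (hc.node (hL.node hb)).seq_extra ?_
  -- One round of the loop; the states are the data `node c (node L b)`, where `L` lists the rest.
  have hbody : Computes
      (σ.pull Prod.fst fun y : X × Val × List α × List α × β =>
        σ.dom y.1 ∧ l y.1 = y.2.2.1 ++ y.2.2.2.1 ∧ y.2.1.toList = y.2.2.2.1.map (ea y.1) ∧
          Inv y.1 y.2.2.1 y.2.2.2.2)
      (fun y => .node (c y.1) (.node y.2.1 (eb y.1 y.2.2.2.2)))
      (fun y => match y.2.2.2.1 with
        | [] => .ret (.node (.leaf 0) (eb y.1 y.2.2.2.2))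
        | a :: _ => (step y.1 y.2.2.2.2 a).map fun b =>
            .node (.leaf 1) (.node (c y.1) (.node y.2.1.snd (eb y.1 b)))) := by
    have hin := Det.input (σ := σ.pull Prod.fst fun y : X × Val × List α × List α × β =>
        σ.dom y.1 ∧ l y.1 = y.2.2.1 ++ y.2.2.2.1 ∧ y.2.1.toList = y.2.2.2.1.map (ea y.1) ∧
          Inv y.1 y.2.2.1 y.2.2.2.2)
      (inp := fun y => .node (c y.1) (.node y.2.1 (eb y.1 y.2.2.2.2)))
    have hc' := hin.fst
    have hL' := hin.snd.fst
    have hb' := hin.snd.snd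
    have htest : Det _ _ fun y : X × Val × List α × List α × β =>
        Val.ofBool (decide (y.2.1.isNode = true)) :=
      hL'.isNode.congr fun y _ => by simp
    have hrun : Computes _ _ fun y : X × Val × List α × List α × β => match y.2.2.2.1 with
        | [] => CoinTree.ret (Val.leaf 0)
        | a :: _ => (step y.1 y.2.2.2.2 a).map (eb y.1) :=
      ((hc'.node (hL'.fst.node hb')).restrict fun y => y.2.1.isNode = true).seq
        (hstep.transfer id fun y hy => by
          obtain ⟨x, Lv, l₁, l₂, b⟩ := y
          obtain ⟨⟨hx, h1, h2, h3⟩, h4⟩ := hy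
          cases Lv with
          | leaf q => simp [Val.isNode] at h4
          | node v w =>
            cases l₂ with
            | nil => simp [Val.toList] at h2
            | cons a l₂ =>
              simp only [Val.toList, List.map_cons, List.cons.injEq] at h2
              refine ⟨(x, a, b), ⟨hx, l₁, l₂, h1, h3⟩, rfl, le_rfl, ?_, rfl⟩
              simp [h2.1])
    have hnext := Computes.pair_left (Det.const (.leaf 1))
      (Computes.pair_left (hc'.restrict _) (Computes.pair_left (hL'.snd.restrict _) hrun))
    refine (Computes.ite htest hnext
      (((Det.const (.leaf 0)).node hb').restrict _)).congr fun y hy => ?_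
    obtain ⟨x, Lv, l₁, l₂, b⟩ := y
    obtain ⟨hx, h1, h2, h3⟩ := hy
    cases Lv with
    | leaf q =>
      obtain rfl : l₂ = [] := by simpa [Val.toList] using h2
      simp [Val.isNode]
    | node v w =>
      cases l₂ with
      | nil => simp [Val.toList] at h2
      | cons a l₂ => simp [Val.isNode, CoinTree.map_map]
  obtain ⟨P, hP, h, ⟨p, hp⟩, H⟩ := hbody
  set R : X → ℕ := fun x => p.eval ((c x).size + ((L x).size + g x + 1) + 1 + σ.extra x) with hR
  have key : ∀ x, σ.dom x → ∀ (l₂ l₁ : List α) (Lv : Val) (b : β), l x = l₁ ++ l₂ →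
      Lv.toList = l₂.map (ea x) → Lv.size ≤ (L x).size → Inv x l₁ b →
      ∃ E, Exec (σ.orc x) (.loop P) (.node (c x) (.node Lv (eb x b))) E ∧
        E.map Prod.fst = (CoinTree.foldl (step x) b l₂).map (eb x) ∧
        ∀ y ∈ E.leaves, y.2 ≤ (l₂.length + 1) * (1 + R x) := by
    intro x hx l₂
    induction l₂ with
    | nil =>
      intro l₁ Lv b h1 h2 h3 h4
      obtain ⟨E, hE, hE', hEg⟩ := H (x, Lv, l₁, [], b) ⟨hx, h1, h2, h4⟩
      have hgR := hp (x, Lv, l₁, [], b) ⟨hx, h1, h2, h4⟩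
      have hgR : h (x, Lv, l₁, [], b) ≤ R x := hgR.trans (eval_le_eval p (by
        have := hsize x hx l₁ [] b h1 h4
        simp only [Val.size_node, Setting.pull]
        omega))
      have hEv : ∀ y ∈ E.leaves, y.1 = .node (.leaf 0) (eb x b) := fun y hy => by
        have : y.1 ∈ (E.map Prod.fst).leaves := CoinTree.mem_leaves_map.2 ⟨y, hy, rfl⟩
        simpa [hE'] using this
      refine ⟨_, .loop (K := fun _ => E) hE fun y hy hy0 => ?_, ?_, fun z hz => ?_⟩
      · exact absurd (by rw [hEv y hy]; rfl) hy0
      · rw [CoinTree.map_bind, CoinTree.bind_congr (m := fun y => .ret y.1.snd) fun y hy => by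
          rw [hEv y hy]; rfl]
        rw [← CoinTree.bind_map E Prod.fst fun v => .ret v.snd, hE']
        rfl
      · simp only [CoinTree.mem_leaves_bind] at hz
        obtain ⟨y, hy, hz⟩ := hz
        rw [if_pos (by rw [hEv y hy]; rfl)] at hz
        simp only [CoinTree.leaves_ret, List.mem_singleton] at hz
        subst hz
        have := (hEg y hy).trans hgR
        simp only [List.length_nil]
        omega
    | cons a l₂ ih =>
      intro l₁ Lv b h1 h2 h3 h4
      obtain ⟨E, hE, hE', hEg⟩ := H (x, Lv, l₁, a :: l₂, b) ⟨hx, h1, h2, h4⟩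
      have hgR := hp (x, Lv, l₁, a :: l₂, b) ⟨hx, h1, h2, h4⟩
      have hgR : h (x, Lv, l₁, a :: l₂, b) ≤ R x := hgR.trans (eval_le_eval p (by
        have := hsize x hx l₁ (a :: l₂) b h1 h4
        simp only [Val.size_node, Setting.pull]
        omega))
      have hEv : ∀ y ∈ E.leaves, ∃ b' ∈ (step x b a).leaves,
          .node (.leaf 1) (.node (c x) (.node Lv.snd (eb x b'))) = y.1 := fun y hy => by
        have : y.1 ∈ (E.map Prod.fst).leaves := CoinTree.mem_leaves_map.2 ⟨y, hy, rfl⟩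
        rw [hE'] at this
        simpa using this
      have ih' : ∀ b' ∈ (step x b a).leaves, _ := fun b' hb' =>
        ih (l₁ ++ [a]) Lv.snd b' (by simp [h1]) (by
          cases Lv with
          | leaf q => simp [Val.toList] at h2
          | node v w => simpa [Val.toList] using (List.cons.inj h2).2)
          ((Val.size_snd_le _).trans h3) (h₁ x hx l₁ a l₂ b h1 h4 b' hb')
      refine ⟨_, .loop (K := fun y => outcomes (σ.orc x) (.loop P) y.1.snd) hE
        fun y hy hy0 => ?_, ?_, fun z hz => ?_⟩
      · obtain ⟨b', hb', hby⟩ := hEv y hy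
        obtain ⟨F, hF, -⟩ := ih' b' hb'
        rw [← hby]
        exact hF.exec_outcomes
      · rw [CoinTree.map_bind, CoinTree.bind_congr (m := fun y =>
          (outcomes (σ.orc x) (.loop P) y.1.snd).map Prod.fst) fun y hy => by
            obtain ⟨b', hb', hby⟩ := hEv y hy
            rw [if_neg (by rw [← hby]; simp), map_fst_delay]]
        rw [← CoinTree.bind_map E Prod.fst fun v =>
          (outcomes (σ.orc x) (.loop P) v.snd).map Prod.fst, hE']
        simp only [CoinTree.foldl, CoinTree.map_bind, CoinTree.bind_map]
        refine CoinTree.bind_congr fun b' hb' => ?_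
        obtain ⟨F, hF, hF', -⟩ := ih' b' hb'
        rw [Val.snd_node, hF.outcomes_eq, hF']
      · simp only [CoinTree.mem_leaves_bind] at hz
        obtain ⟨y, hy, hz⟩ := hz
        obtain ⟨b', hb', hby⟩ := hEv y hy
        obtain ⟨F, hF, hF', hFg⟩ := ih' b' hb'
        rw [if_neg (by rw [← hby]; simp)] at hz
        simp only [mem_leaves_delay, ← hby, Val.snd_node] at hz
        rw [hF.outcomes_eq] at hz
        obtain ⟨w, hw, rfl⟩ := hz
        have h5 := (hEg y hy).trans hgR
        have h6 := hFg w hw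
        simp only [List.length_cons]
        nlinarith
  refine ⟨.loop P, hP, fun x => ((L x).size + 1) * (1 + R x), ?_, fun x hx => ?_⟩
  · have hR' : PolyBounded σ inp R := PolyBounded.eval
      (((hc.polyBounded.add ((hL.polyBounded.add hg).add (.const 1))).add (.const 1)).add .extra) p
    obtain ⟨r, hr⟩ := (hL.polyBounded.add (.const 1)).mul ((PolyBounded.const 1).add hR')
    exact ⟨r, fun x hx => (hr x hx).trans (eval_le_eval r (Nat.le_add_left _ _))⟩
  · obtain ⟨E, hE, hE', hEg⟩ := key x hx (l x) [] (L x) (b₀ x) rfl (hl x hx) le_rfl (h₀ x hx)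
    refine ⟨E, hE, hE', fun y hy => (hEg y hy).trans ?_⟩
    have := (L x).length_toList_le
    rw [hl x hx, List.length_map] at this
    exact Nat.mul_le_mul_right _ (by omega)

/-! ### Operations on lists -/

theorem Val.size_ofList_le {l : List Val} {n : ℕ} (h : ∀ v ∈ l, v.size ≤ n) :
    (Val.ofList l).size ≤ l.length * (n + 1) + 2 := by
  induction l with
  | nil => simp [Val.ofList, bitLength_zero]
  | cons a l ih =>
    have h1 := h a (by simp)
    have h2 := ih fun v hv => h v (by simp [hv])
    simp only [Val.ofList, Val.size_node, List.length_cons]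
    nlinarith

theorem Val.length_le_size_ofList (l : List Val) : l.length ≤ (Val.ofList l).size := by
  simpa using (Val.ofList l).length_toList_le

theorem Val.size_le_size_ofList {l : List Val} {v : Val} (h : v ∈ l) :
    v.size ≤ (Val.ofList l).size :=
  Val.size_le_of_mem_toList (by simpa using h)

/-- The circumstances for computations that concern one element of a list. -/
def Setting.elem {α : Type} (σ : Setting X) (l : X → List α) : Setting (X × α) :=
  σ.pull Prod.fst fun y => σ.dom y.1 ∧ y.2 ∈ l y.1

/-- The circumstances for one step of a fold over a list. -/
def Setting.step {α β : Type} (σ : Setting X) (l : X → List α) (f : X → β → α → β) (b₀ : X → β) :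
    Setting (X × α × β) :=
  σ.pull Prod.fst fun y => σ.dom y.1 ∧
    ∃ l₁ l₂, l y.1 = l₁ ++ y.2.1 :: l₂ ∧ y.2.2 = l₁.foldl (f y.1) (b₀ y.1)

namespace Det

variable {σ : Setting X} {inp : X → Val} {α β : Type} {l : X → List α} {L : X → Val}
  {ea : X → α → Val}

theorem foldl {eb : X → β → Val} {f : X → β → α → β} {b₀ : X → β} {g : X → ℕ}
    (hL : Det σ inp L) (hl : ∀ x, σ.dom x → (L x).toList = (l x).map (ea x))
    (hb : Det σ inp fun x => eb x (b₀ x))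
    (hstep : Det (σ.step l f b₀)
      (fun y => .node (inp y.1) (.node (ea y.1 y.2.1) (eb y.1 y.2.2)))
      fun y => eb y.1 (f y.1 y.2.2 y.2.1))
    (hg : PolyBounded σ inp g)
    (hsize : ∀ x, σ.dom x → ∀ l₁ l₂, l x = l₁ ++ l₂ → (eb x (l₁.foldl (f x) (b₀ x))).size ≤ g x) :
    Det σ inp fun x => eb x ((l x).foldl (f x) (b₀ x)) := by
  have := Computes.foldl (step := fun x b a => .ret (f x b a))
    (fun x l₁ b => b = l₁.foldl (f x) (b₀ x)) input hL hl hb hstep (fun _ _ => rfl)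
    (fun x _ l₁ a l₂ b _ hb b' hb' => by
      simp only [CoinTree.leaves_ret, List.mem_singleton] at hb'
      rw [hb', hb, List.foldl_append]
      rfl) hg (fun x hx l₁ l₂ b h hb => by rw [hb]; exact hsize x hx l₁ l₂ h)
  exact Computes.congr this fun x _ => by rw [CoinTree.foldl_ret]; rfl

theorem lift_elem {f : X → Val} {e : X × α → Val} (hf : Det σ inp f) :
    Det (σ.elem l) (fun y => .node (inp y.1) (e y)) fun y => f y.1 :=
  comp (f := fun y : X × α => inp y.1) (fst input) (hf.pull Prod.fst fun _ hy => hy.1)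

/-- A computation that concerns a list element can be used in a step of a fold. -/
theorem elem_step (eb : X → β → Val) {f : X → β → α → β} {b₀ : X → β} {h : X → α → Val}
    (hh : Det (σ.elem l) (fun y => .node (inp y.1) (ea y.1 y.2)) fun y => h y.1 y.2) :
    Det (σ.step l f b₀) (fun y => .node (inp y.1) (.node (ea y.1 y.2.1) (eb y.1 y.2.2)))
      fun y => h y.1 y.2.1 :=
  comp (f := fun y : X × α × β => .node (inp y.1) (ea y.1 y.2.1))
    ((fst input).node (fst (snd input)))
    (hh.pull (fun y : X × α × β => (y.1, y.2.1)) fun y hy => ⟨hy.1, by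
      obtain ⟨l₁, l₂, h, -⟩ := hy.2
      simp [h]⟩)

theorem polyBounded_elem {h : X → α → Val} (hL : Det σ inp L)
    (hl : ∀ x, σ.dom x → (L x).toList = (l x).map (ea x))
    (hh : Det (σ.elem l) (fun y => .node (inp y.1) (ea y.1 y.2)) fun y => h y.1 y.2) :
    ∃ g, PolyBounded σ inp g ∧ ∀ x, σ.dom x → ∀ a ∈ l x, (h x a).size ≤ g x := by
  obtain ⟨p, hp⟩ := hh.polyBounded
  refine ⟨fun x => p.eval ((inp x).size + (L x).size + 1 + σ.extra x),
    ((((PolyBounded.inp_size.add hL.polyBounded).add (.const 1)).add .extra).eval p),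
    fun x hx a ha => ?_⟩
  refine (hp (x, a) ⟨hx, ha⟩).trans (eval_le_eval p (Nat.add_le_add_right ?_ _))
  have : (ea x a).size ≤ (L x).size := Val.size_le_of_mem_toList (by
    rw [hl x hx]; exact List.mem_map_of_mem ha)
  simp only [Val.size_node]
  omega

theorem polyBounded_length (hL : Det σ inp L)
    (hl : ∀ x, σ.dom x → (L x).toList = (l x).map (ea x)) :
    PolyBounded σ inp fun x => (l x).length :=
  hL.polyBounded.mono fun x hx => by
    have := (L x).length_toList_le
    rwa [hl x hx, List.length_map] at this

theorem reverse {l : X → List Val} (h : Det σ inp fun x => .ofList (l x)) :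
    Det σ inp fun x => .ofList (l x).reverse := by
  have := foldl (ea := fun _ a => a) (l := l) (eb := fun _ b => Val.ofList b)
    (f := fun _ b a => a :: b) (b₀ := fun _ => []) (g := fun x => (Val.ofList (l x)).size *
      ((Val.ofList (l x)).size + 1) + 2) h (by simp) (const _)
    ((fst (snd input)).node (snd (snd input)))
    ((h.polyBounded.mul (h.polyBounded.add (.const 1))).add (.const 2))
    (fun x _ l₁ l₂ hx => by
      refine (Val.size_ofList_le (n := (Val.ofList (l x)).size) fun v hv => ?_).trans ?_
      · refine Val.size_le_size_ofList ?_
        have : v ∈ l₁ := by simpa using hv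
        simp [hx, this]
      · have h1 := Val.length_le_size_ofList (l x)
        rw [hx, List.length_append] at h1
        simp only [List.foldl_flip_cons_eq_append, List.append_nil, List.length_reverse,
          List.length_map]
        rw [← hx] at h1
        gcongr
        omega)
  exact this.congr fun x _ => by simp

theorem append {l m : X → List Val} (hl : Det σ inp fun x => .ofList (l x))
    (hm : Det σ inp fun x => .ofList (m x)) : Det σ inp fun x => .ofList (l x ++ m x) := by
  have hr := hl.reverse
  have := foldl (ea := fun _ a => a) (l := fun x => (l x).reverse) (eb := fun _ b => Val.ofList b)
    (f := fun _ b a => a :: b) (b₀ := m) (g := fun x =>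
      ((Val.ofList (l x).reverse).size + (Val.ofList (m x)).size) *
      (((Val.ofList (l x).reverse).size + (Val.ofList (m x)).size) + 1) + 2) hr (by simp) hm
    ((fst (snd input)).node (snd (snd input)))
    (((hr.polyBounded.add hm.polyBounded).mul ((hr.polyBounded.add hm.polyBounded).add
      (.const 1))).add (.const 2))
    (fun x _ l₁ l₂ hx => by
      refine (Val.size_ofList_le (n := (Val.ofList (l x).reverse).size + (Val.ofList (m x)).size)
        fun v hv => ?_).trans ?_
      · have : v ∈ l₁ ∨ v ∈ m x := by simpa using hv
        rcases this with h | h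
        · exact (Val.size_le_size_ofList (by simp [hx, h])).trans (Nat.le_add_right _ _)
        · exact (Val.size_le_size_ofList h).trans (Nat.le_add_left _ _)
      · have h1 := Val.length_le_size_ofList (l x).reverse
        have h2 := Val.length_le_size_ofList (m x)
        rw [hx, List.length_append] at h1
        simp only [List.foldl_flip_cons_eq_append, List.length_append, List.length_reverse,
          List.length_map]
        rw [← hx] at h1
        gcongr
        omega)
  exact this.congr fun x _ => by simp

/-- The images of those elements of a list that pass a test. -/
theorem filter_map {p : X → α → Prop} [∀ x, DecidablePred (p x)] {h : X → α → Val}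
    (hL : Det σ inp L) (hl : ∀ x, σ.dom x → (L x).toList = (l x).map (ea x))
    (hp : Det (σ.elem l) (fun y => .node (inp y.1) (ea y.1 y.2))
      fun y => Val.ofBool (decide (p y.1 y.2)))
    (hh : Det (σ.elem l) (fun y => .node (inp y.1) (ea y.1 y.2)) fun y => h y.1 y.2) :
    Det σ inp fun x => .ofList (((l x).filter (p x ·)).map (h x)) := by
  obtain ⟨g, hg, hgh⟩ := polyBounded_elem hL hl hh
  have hfold : ∀ x (l : List α), l.foldl (fun b a => if p x a then h x a :: b else b) [] =
      ((l.filter (p x ·)).map (h x)).reverse := fun x l => by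
    induction l using List.reverseRecOn with
    | nil => rfl
    | append_singleton l a ih =>
      rw [List.foldl_append, ih]
      by_cases hpa : p x a <;> simp [hpa]
  have := foldl (eb := fun _ b => Val.ofList b) (b₀ := fun _ => ([] : List Val))
    (f := fun x b a => if p x a then h x a :: b else b)
    (g := fun x => (l x).length * (g x + 1) + 2) hL hl (const _)
    ((ite (c := fun y => p y.1 y.2.1) (elem_step (fun _ b => .ofList b)
        (h := fun x a => Val.ofBool (decide (p x a))) hp)
      ((node (elem_step (fun _ b => .ofList b) (h := h) hh) (snd (snd input))).restrict _)
      ((snd (snd input)).restrict _)).congr fun y _ => by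
        by_cases h : p y.1 y.2.1
        · simp [h, Val.ofList]
        · simp [h])
    (((polyBounded_length hL hl).mul (hg.add (.const 1))).add (.const 2))
    (fun x hx l₁ l₂ hx' => by
      rw [hfold]
      refine (Val.size_ofList_le (n := g x) fun v hv => ?_).trans ?_
      · simp only [List.mem_reverse, List.mem_map, List.mem_filter] at hv
        obtain ⟨a, ha, rfl⟩ := hv
        exact hgh x hx a (by simp [hx', ha.1])
      · have := List.length_filter_le (p x ·) l₁
        simp only [List.length_reverse, List.length_map, hx', List.length_append]
        gcongr
        omega)
  exact this.reverse.congr fun x _ => by rw [hfold, List.reverse_reverse]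

theorem map {h : X → α → Val}
    (hL : Det σ inp L) (hl : ∀ x, σ.dom x → (L x).toList = (l x).map (ea x))
    (hh : Det (σ.elem l) (fun y => .node (inp y.1) (ea y.1 y.2)) fun y => h y.1 y.2) :
    Det σ inp fun x => .ofList ((l x).map (h x)) :=
  (filter_map (p := fun _ _ => True) hL hl (const (Val.ofBool true)) hh).congr fun x _ => by simp

/-- The value at an element of a list that passes a test. -/
theorem lookup {p : X → α → Prop} [∀ x, DecidablePred (p x)] {h : X → α → Val} {r : X → Val}
    (hL : Det σ inp L) (hl : ∀ x, σ.dom x → (L x).toList = (l x).map (ea x))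
    (hp : Det (σ.elem l) (fun y => .node (inp y.1) (ea y.1 y.2))
      fun y => Val.ofBool (decide (p y.1 y.2)))
    (hh : Det (σ.elem l) (fun y => .node (inp y.1) (ea y.1 y.2)) fun y => h y.1 y.2)
    (hr : ∀ x, σ.dom x → (∃ a ∈ l x, p x a) ∧ ∀ a ∈ l x, p x a → h x a = r x) :
    Det σ inp r := by
  obtain ⟨g, hg, hgh⟩ := polyBounded_elem hL hl hh
  have hfold : ∀ x, σ.dom x → ∀ l₁ l₂, l x = l₁ ++ l₂ →
      l₁.foldl (fun b a => if p x a then h x a else b) (.leaf 0) =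
        if ∃ a ∈ l₁, p x a then r x else .leaf 0 := fun x hx l₁ => by
    induction l₁ using List.reverseRecOn with
    | nil => simp
    | append_singleton l₁ a ih =>
      intro l₂ hl₂
      have hl₂' : l x = l₁ ++ (a :: l₂) := by simpa using hl₂
      rw [List.foldl_append, ih _ hl₂']
      by_cases hpa : p x a
      · simp only [List.foldl_cons, List.foldl_nil, if_pos hpa]
        rw [if_pos ⟨a, by simp, hpa⟩]
        exact (hr x hx).2 a (by simp [hl₂']) hpa
      · simp [hpa, or_and_right, exists_or]
  have := foldl (eb := fun _ b => b) (b₀ := fun _ => Val.leaf 0)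
    (f := fun x b a => if p x a then h x a else b)
    (g := fun x => g x + 2) hL hl (const _)
    (ite (elem_step (fun _ b => b)
        (h := fun x a => Val.ofBool (decide (p x a))) hp)
      ((elem_step (fun _ b => b) (h := h) hh).restrict _)
      ((snd (snd input)).restrict _))
    (hg.add (.const 2))
    (fun x hx l₁ l₂ hx' => by
      rw [hfold x hx l₁ l₂ hx']
      split_ifs with h
      · obtain ⟨⟨a, ha, hpa⟩, h'⟩ := hr x hx
        rw [← h' a ha hpa]
        exact (hgh x hx a ha).trans (Nat.le_add_right _ _)
      · simp [bitLength_zero])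
  exact this.congr fun x hx => by rw [hfold x hx _ [] (by simp), if_pos (hr x hx).1]

theorem any {p : X → α → Prop} [∀ x, DecidablePred (p x)]
    (hL : Det σ inp L) (hl : ∀ x, σ.dom x → (L x).toList = (l x).map (ea x))
    (hp : Det (σ.elem l) (fun y => .node (inp y.1) (ea y.1 y.2))
      fun y => Val.ofBool (decide (p y.1 y.2))) :
    Det σ inp fun x => Val.ofBool (decide (∃ a ∈ l x, p x a)) := by
  have hfold : ∀ x (l : List α), l.foldl (fun b a => if p x a then Val.ofBool true else b)
      (Val.ofBool false) = Val.ofBool (decide (∃ a ∈ l, p x a)) := fun x l => by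
    induction l using List.reverseRecOn with
    | nil => simp
    | append_singleton l a ih =>
      rw [List.foldl_append, ih]
      by_cases hpa : p x a <;> simp [hpa, or_and_right, exists_or]
  have := foldl (eb := fun _ b => b) (b₀ := fun _ => Val.ofBool false)
    (f := fun x b a => if p x a then Val.ofBool true else b)
    (g := fun _ => 3) hL hl (const _)
    (ite (elem_step (fun _ b => b)
        (h := fun x a => Val.ofBool (decide (p x a))) hp) (const _)
      ((snd (snd input)).restrict _)) (.const 3)
    (fun x _ l₁ l₂ _ => by rw [hfold]; exact Val.size_ofBool_le _)
  exact this.congr fun x _ => hfold x (l x)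

theorem flatMap {h : X → α → List Val}
    (hL : Det σ inp L) (hl : ∀ x, σ.dom x → (L x).toList = (l x).map (ea x))
    (hh : Det (σ.elem l) (fun y => .node (inp y.1) (ea y.1 y.2)) fun y => .ofList (h y.1 y.2)) :
    Det σ inp fun x => .ofList ((l x).flatMap (h x)) := by
  obtain ⟨g, hg, hgh⟩ := polyBounded_elem (h := fun x a => .ofList (h x a)) hL hl hh
  have hfold : ∀ x (l : List α), l.foldl (fun b a => b ++ h x a) [] = l.flatMap (h x) :=
    fun x l => by
      induction l using List.reverseRecOn with
      | nil => rfl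
      | append_singleton l a ih => simp [List.foldl_append, ih]
  have := foldl (eb := fun _ b => Val.ofList b) (b₀ := fun _ => ([] : List Val))
    (f := fun x b a => b ++ h x a)
    (g := fun x => (l x).length * g x * (g x + 1) + 2) hL hl (const _)
    (append (snd (snd input))
      (elem_step (fun _ b => .ofList b) (h := fun x a => .ofList (h x a)) hh))
    ((((polyBounded_length hL hl).mul hg).mul (hg.add (.const 1))).add (.const 2))
    (fun x hx l₁ l₂ hx' => by
      rw [hfold]
      refine (Val.size_ofList_le (n := g x) fun v hv => ?_).trans ?_
      · simp only [List.mem_flatMap] at hv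
        obtain ⟨a, ha, hv⟩ := hv
        exact (Val.size_le_size_ofList hv).trans (hgh x hx a (by simp [hx', ha]))
      · have h1 : (l₁.flatMap (h x)).length ≤ l₁.length * g x := by
          have : ∀ a ∈ l₁, (h x a).length ≤ g x := fun a ha =>
            (Val.length_le_size_ofList _).trans (hgh x hx a (by simp [hx', ha]))
          clear hx'
          induction l₁ with
          | nil => simp
          | cons a l₁ ih =>
            have h1 := ih fun a ha => this a (by simp [ha])
            have h2 := this a (by simp)
            simp only [List.flatMap_cons, List.length_append, List.length_cons]
            nlinarith
        have h2 : l₁.length ≤ (l x).length := by simp [hx']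
        gcongr
        exact h1.trans (Nat.mul_le_mul_right _ h2))
  exact this.congr fun x _ => by rw [hfold]

/-! ### Tuples of constant length -/

theorem ofFn {d : ℕ} {h : X → Fin d → Val} (hh : ∀ t, Det σ inp fun x => h x t) :
    Det σ inp fun x => .ofList (List.ofFn (h x)) := by
  induction d with
  | zero => exact (const (.leaf 0)).congr fun x _ => by simp [Val.ofList]
  | succ d ih =>
    exact ((hh 0).node (ih fun t => hh t.succ)).congr fun x _ => by
      simp [List.ofFn_succ, Val.ofList]

theorem of_ofFn {d : ℕ} {h : X → Fin d → Val} (hh : Det σ inp fun x => .ofList (List.ofFn (h x)))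
    (t : Fin d) : Det σ inp fun x => h x t := by
  induction d with
  | zero => exact t.elim0
  | succ d ih =>
    have hh' : Det σ inp fun x => .node (h x 0) (.ofList (List.ofFn fun t => h x t.succ)) :=
      hh.congr fun x _ => by simp [List.ofFn_succ, Val.ofList]
    cases t using Fin.cases with
    | zero => exact hh'.fst
    | succ t => exact ih hh'.snd t

theorem getD {f : X → Val} (hf : Det σ inp f) (t : ℕ) :
    Det σ inp fun x => (f x).toList.getD t (.leaf 0) := by
  induction t generalizing f with
  | zero => exact hf.fst.congr fun x _ => by cases f x <;> rfl
  | succ t ih => exact (ih hf.snd).congr fun x _ => by cases f x <;> simp [Val.toList, Val.snd]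

theorem forall_fin {d : ℕ} {p : X → Fin d → Prop} [∀ x, DecidablePred (p x)]
    (hp : ∀ t, Det σ inp fun x => Val.ofBool (decide (p x t))) :
    Det σ inp fun x => Val.ofBool (decide (∀ t, p x t)) := by
  induction d with
  | zero => exact (const (Val.ofBool true)).congr fun x _ => by simp
  | succ d ih =>
    exact (and (hp 0) ((ih fun t => hp t.succ).restrict _)).congr fun x _ => by
      simp only [Fin.forall_fin_succ]

end Det

/-! ### Submodular functions -/

namespace IsSubmodular

variable {I : Finset ℕ} {f : Finset ℕ → ℚ}

/-- Marginal gains of sets decrease. -/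
theorem union_sub_le (hf : IsSubmodular I f) {S T U : Finset ℕ} (hST : S ⊆ T) (hT : T ∪ U ⊆ I)
    (hTU : Disjoint T U) : f (T ∪ U) - f T ≤ f (S ∪ U) - f S := by
  induction U using Finset.induction_on with
  | empty => simp
  | insert i U hi ih =>
    simp only [Finset.union_insert, Finset.insert_subset_iff, Finset.disjoint_insert_right] at *
    have h1 := ih hT.2 hTU.2
    have h2 := hf.2 (S ∪ U) (T ∪ U) (Finset.union_subset_union_left hST) hT.2 i (by
      simp [hT.1, hTU.1, hi])
    linarith

/-- Removing one colour class of `S`, the average loss is at most the fraction `1 / n` of `f S`. -/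
theorem exists_filter_le (hf : IsSubmodular I f) {S : Finset ℕ} (hS : S ⊆ I) (c : ℕ → ℕ) {n : ℕ}
    (hn : 0 < n) : ∃ g < n, (1 - 1 / (n : ℚ)) * f S ≤ f (S.filter (c · ≠ g)) := by
  have key : ∀ n, ∑ g ∈ Finset.range n, (f S - f (S.filter (c · ≠ g))) ≤
      f S - f (S.filter (n ≤ c ·)) := fun n => by
    induction n with
    | zero => simp
    | succ n ih =>
      rw [Finset.sum_range_succ]
      have h := hf.union_sub_le (S := S.filter (n + 1 ≤ c ·)) (T := S.filter (c · ≠ n))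
        (U := S.filter (c · = n))
        (fun i => by simp only [Finset.mem_filter]; rintro ⟨h1, h2⟩; exact ⟨h1, by omega⟩)
        (by
          refine Finset.union_subset ?_ ?_ <;> exact (Finset.filter_subset _ _).trans hS)
        (by
          rw [Finset.disjoint_filter]
          exact fun i _ h1 h2 => h1 h2)
      have e1 : S.filter (c · ≠ n) ∪ S.filter (c · = n) = S := by
        ext i
        simp only [Finset.mem_union, Finset.mem_filter]
        tauto
      have e2 : S.filter (n + 1 ≤ c ·) ∪ S.filter (c · = n) = S.filter (n ≤ c ·) := by
        ext i
        simp only [Finset.mem_union, Finset.mem_filter, ← and_or_left, and_congr_right_iff]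
        omega
      rw [e1, e2] at h
      linarith
  by_contra! h
  have h1 : ∑ g ∈ Finset.range n, f S / n < ∑ g ∈ Finset.range n, (f S - f (S.filter (c · ≠ g))) :=
    Finset.sum_lt_sum_of_nonempty ⟨0, by simpa using hn⟩ fun g hg => by
      have := h g (by simpa using hg)
      have e : (1 - 1 / (n : ℚ)) * f S = f S - f S / n := by ring
      linarith
  have h2 := key n
  have h3 := hf.1 (S.filter (n ≤ c ·)) ((Finset.filter_subset _ _).trans hS)
  have h4 : (n : ℚ) ≠ 0 := by positivity
  have h5 : ∑ g ∈ Finset.range n, f S / n = f S := by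
    simp only [Finset.sum_const, Finset.card_range, nsmul_eq_mul]
    field_simp
  linarith

/-- If the `n` elements of `G` are chosen greedily from `S`, then no further element of `S` gains
more than `f G / n`. -/
theorem exists_greedy (hf : IsSubmodular I f) {S : Finset ℕ} (hS : S ⊆ I) (n : ℕ) :
    ∃ G ⊆ S, G.card ≤ n ∧ ∀ i ∈ S \ G, n * (f (insert i G) - f G) ≤ f G := by
  induction n with
  | zero => exact ⟨∅, by simp, by simp, fun i _ => by simpa using hf.1 ∅ (by simp)⟩
  | succ n ih =>
    obtain ⟨G, hGS, hG, h⟩ := ih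
    rcases (S \ G).eq_empty_or_nonempty with he | hne
    · exact ⟨G, hGS, by omega, by simp [he]⟩
    · obtain ⟨i, hi, hmax⟩ := Finset.exists_max_image (S \ G) (fun j => f (insert j G)) hne
      have hi' := Finset.mem_sdiff.1 hi
      refine ⟨insert i G, Finset.insert_subset hi'.1 hGS,
        (Finset.card_insert_le _ _).trans (by omega), fun j hj => ?_⟩
      simp only [Finset.mem_sdiff, Finset.mem_insert, not_or] at hj
      have hj' : j ∈ S \ G := Finset.mem_sdiff.2 ⟨hj.1, hj.2.2⟩
      have h1 := hf.2 G (insert i G) (Finset.subset_insert _ _)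
        ((Finset.insert_subset hi'.1 hGS).trans hS) j (by
          simp [hS hj.1, hj.2.1, hj.2.2])
      have h2 := hmax j hj'
      have h3 := h j hj'
      have h4 : (n : ℚ) * (f (insert j (insert i G)) - f (insert i G)) ≤
          n * (f (insert j G) - f G) := by gcongr
      push_cast
      linarith

end IsSubmodular

namespace FunctionType.Holds

variable {F : FunctionType} {I J : Finset ℕ} {f : Finset ℕ → ℚ}

theorem isSubmodular (h : F.Holds I f) : IsSubmodular I f := by
  cases F with
  | modular => exact h.1
  | monotone => exact h.1
  | nonMonotone => exact h

theorem mono (h : F.Holds I f) (hJ : J ⊆ I) : F.Holds J f := by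
  have hs : IsSubmodular J f := by
    have hs := h.isSubmodular
    exact ⟨fun S hS => hs.1 S (hS.trans hJ), fun S T hST hT i hi =>
      hs.2 S T hST (hT.trans hJ) i (Finset.sdiff_subset_sdiff hJ subset_rfl hi)⟩
  cases F with
  | modular => exact ⟨hs, fun S T hST hT i hi =>
      h.2 S T hST (hT.trans hJ) i (Finset.sdiff_subset_sdiff hJ subset_rfl hi)⟩
  | monotone => exact ⟨hs, fun S T hST hT => h.2 S T hST (hT.trans hJ)⟩
  | nonMonotone => exact hs

theorem contract (h : F.Holds I f) {i : ℕ} (hi : i ∈ I) (hJ : J ⊆ I) (hiJ : i ∉ J) :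
    F.Holds J fun S => f (insert i S) := by
  have hins : ∀ {S}, S ⊆ J → insert i S ⊆ I := fun hS => Finset.insert_subset hi (hS.trans hJ)
  have hmem : ∀ {T : Finset ℕ} {j}, j ∈ J \ T → j ∈ I \ insert i T := fun {T j} hj => by
    rw [Finset.mem_sdiff] at *
    refine ⟨hJ hj.1, fun hj' => ?_⟩
    rcases Finset.mem_insert.1 hj' with rfl | hj'
    · exact hiJ hj.1
    · exact hj.2 hj'
  have hs : IsSubmodular J fun S => f (insert i S) := by
    have hs := h.isSubmodular
    refine ⟨fun S hS => hs.1 _ (hins hS), fun S T hST hT j hj => ?_⟩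
    have := hs.2 (insert i S) (insert i T) (Finset.insert_subset_insert _ hST) (hins hT) j (hmem hj)
    rwa [Finset.insert_comm j i, Finset.insert_comm j i] at this
  cases F with
  | modular =>
    refine ⟨hs, fun S T hST hT j hj => ?_⟩
    have := h.2 (insert i S) (insert i T) (Finset.insert_subset_insert _ hST) (hins hT) j (hmem hj)
    rwa [Finset.insert_comm j i, Finset.insert_comm j i] at this
  | monotone =>
    exact ⟨hs, fun S T hST hT => h.2 _ _ (Finset.insert_subset_insert _ hST) (hins hT)⟩
  | nonMonotone => exact hs

end FunctionType.Holds

/-! ### The additional constraint -/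

section Oracle

variable {I J S T : Finset ℕ} {m : Finset ℕ → Bool} {i : ℕ}

theorem IsTrivialOracle.mono (h : IsTrivialOracle I m) (hJ : J ⊆ I) : IsTrivialOracle J m :=
  fun S hS => h S (hS.trans hJ)

theorem IsTrivialOracle.contract (h : IsTrivialOracle I m) (hi : i ∈ I) (hJ : J ⊆ I) :
    IsTrivialOracle J fun S => m (insert i S) :=
  fun _ hS => h _ (Finset.insert_subset hi (hS.trans hJ))

theorem IsMatroidOracle.mono (h : IsMatroidOracle I m) (hJ : J ⊆ I) : IsMatroidOracle J m := by
  obtain ⟨M, hE, hM⟩ := h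
  refine ⟨M.restrict J, rfl, fun S hS => ?_⟩
  rw [hM S (hS.trans hJ), Matroid.restrict_indep_iff]
  simp [hS]

theorem IsMatroidOracle.contract (h : IsMatroidOracle I m) (hi : i ∈ I) (hmi : m {i} = true)
    (hJ : J ⊆ I) (hiJ : i ∉ J) : IsMatroidOracle J fun S => m (insert i S) := by
  obtain ⟨M, hE, hM⟩ := h
  have hMi : M.Indep {i} := by simpa using (hM {i} (by simpa using hi)).1 hmi
  refine ⟨(M.contract {i}).restrict J, rfl, fun S hS => ?_⟩
  rw [hM _ (Finset.insert_subset hi (hS.trans hJ)), Matroid.restrict_indep_iff,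
    hMi.contract_indep_iff]
  have : i ∉ S := fun h => hiJ (hS h)
  simp [hS, this, Set.union_singleton]

theorem IsMatchingOracle.mono (h : IsMatchingOracle I m) (hJ : J ⊆ I) : IsMatchingOracle J m := by
  obtain ⟨V, G, e, he, hm⟩ := h
  refine ⟨V, SimpleGraph.fromEdgeSet (e '' J), e, ?_, fun S hS => hm S (hS.trans hJ)⟩
  rw [SimpleGraph.edgeSet_fromEdgeSet]
  rw [show e '' (J : Set ℕ) \ Sym2.diagSet = e '' J from ?_]
  · exact (he.injOn.mono (by exact_mod_cast hJ)).bijOn_image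
  · refine sdiff_eq_left.2 (Set.disjoint_left.2 ?_)
    rintro _ ⟨j, hj, rfl⟩ hd
    exact G.not_isDiag_of_mem_edgeSet (he.mapsTo (hJ hj)) (by simpa using hd)

theorem IsMatchingOracle.contract (h : IsMatchingOracle I m) (hi : i ∈ I) (hJ : J ⊆ I)
    (hJm : ∀ j ∈ J, m {i, j} = true) (hiJ : i ∉ J) :
    IsMatchingOracle J fun S => m (insert i S) := by
  obtain ⟨V, G, e, he, hm⟩ := h.mono hJ
  obtain ⟨V', G', e', he', hm'⟩ := h
  refine ⟨V, G, e, he, fun S hS => ?_⟩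
  have hdisj : ∀ j ∈ J, ∀ v, ¬ (v ∈ e' i ∧ v ∈ e' j) := fun j hj v => by
    refine (hm' {i, j} ?_).1 (hJm j hj) i (by simp) j (by simp) (fun hij => hiJ (hij ▸ hj)) v
    exact Finset.insert_subset hi (by simpa using hJ hj)
  rw [← hm S hS, hm' _ (Finset.insert_subset hi (hS.trans hJ)), hm' _ (hS.trans hJ)]
  refine ⟨fun h j hj k hk => h j (by simp [hj]) k (by simp [hk]), fun h j hj k hk hjk v hv => ?_⟩
  rcases Finset.mem_insert.1 hj with rfl | hj' <;> rcases Finset.mem_insert.1 hk with rfl | hk'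
  · exact hjk rfl
  · exact hdisj k (hS hk') v hv
  · exact hdisj j (hS hj') v hv.symm
  · exact h j hj' k hk' hjk v hv

end Oracle

namespace ConstraintType.Holds

variable {C : ConstraintType} {I J S T : Finset ℕ} {m : Fin 2 → Finset ℕ → Bool} {i : ℕ}

theorem mono (h : C.Holds I m) (hJ : J ⊆ I) : C.Holds J m := by
  cases C with
  | unconstrained => exact ⟨h.1.mono hJ, h.2.mono hJ⟩
  | matroid => exact ⟨h.1.mono hJ, h.2.mono hJ⟩
  | matroidIntersection => exact ⟨h.1.mono hJ, h.2.mono hJ⟩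
  | matching => exact ⟨h.1.mono hJ, h.2.mono hJ⟩

theorem contract (h : C.Holds I m) (hi : i ∈ I) (hmi : ∀ k, m k {i} = true) (hJ : J ⊆ I)
    (hiJ : i ∉ J) (hJm : ∀ j ∈ J, ∀ k, m k {i, j} = true) :
    C.Holds J fun k S => m k (insert i S) := by
  cases C with
  | unconstrained => exact ⟨h.1.contract hi hJ, h.2.contract hi hJ⟩
  | matroid => exact ⟨h.1.contract hi (hmi 0) hJ hiJ, h.2.contract hi hJ⟩
  | matroidIntersection =>
    exact ⟨h.1.contract hi (hmi 0) hJ hiJ, h.2.contract hi (hmi 1) hJ hiJ⟩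
  | matching =>
    exact ⟨h.1.contract hi hJ (fun j hj => hJm j hj 0) hiJ, h.2.contract hi hJ⟩

theorem mem_of_subset (h : C.Holds I m) (hST : S ⊆ T) (hT : T ⊆ I) (hm : ∀ k, m k T = true) :
    ∀ k, m k S = true := by
  have ht : ∀ {m : Finset ℕ → Bool}, IsTrivialOracle I m → m S = true :=
    fun h => h S (hST.trans hT)
  have hM : ∀ {m : Finset ℕ → Bool}, IsMatroidOracle I m → m T = true → m S = true := by
    rintro m ⟨M, -, hM⟩ hm
    rw [hM _ (hST.trans hT)]
    exact ((hM T hT).1 hm).subset (by exact_mod_cast hST)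
  have hG : ∀ {m : Finset ℕ → Bool}, IsMatchingOracle I m → m T = true → m S = true := by
    rintro m ⟨V, G, e, -, hm⟩ h
    rw [hm _ (hST.trans hT)]
    exact fun i hi j hj => (hm T hT).1 h i (hST hi) j (hST hj)
  rw [Fin.forall_fin_two] at *
  cases C with
  | unconstrained => exact ⟨ht h.1, ht h.2⟩
  | matroid => exact ⟨hM h.1 hm.1, ht h.2⟩
  | matroidIntersection => exact ⟨hM h.1 hm.1, hM h.2 hm.2⟩
  | matching => exact ⟨hG h.1 hm.1, ht h.2⟩

theorem mem_empty (h : C.Holds I m) : ∀ k, m k ∅ = true := by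
  have ht : ∀ {m : Finset ℕ → Bool}, IsTrivialOracle I m → m ∅ = true := fun h => h ∅ (by simp)
  have hM : ∀ {m : Finset ℕ → Bool}, IsMatroidOracle I m → m ∅ = true := by
    rintro m ⟨M, -, hM⟩
    rw [hM _ (by simp)]
    simp
  have hG : ∀ {m : Finset ℕ → Bool}, IsMatchingOracle I m → m ∅ = true := by
    rintro m ⟨V, G, e, -, hm⟩
    rw [hm _ (by simp)]
    simp
  rw [Fin.forall_fin_two]
  cases C with
  | unconstrained => exact ⟨ht h.1, ht h.2⟩
  | matroid => exact ⟨hM h.1, ht h.2⟩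
  | matroidIntersection => exact ⟨hM h.1, hM h.2⟩
  | matching => exact ⟨hG h.1, ht h.2⟩

end ConstraintType.Holds

/-! ### Assignments -/

namespace MKC

variable {κ : MKC} {A : ℕ → Finset ℕ} {S S' : Finset ℕ}

theorem IsFeasibleAssignment.subset (h : κ.IsFeasibleAssignment A S) {b : ℕ} (hb : b ∈ κ.bins) :
    A b ⊆ S := by
  rw [h.2]
  exact Finset.subset_biUnion_of_mem A (by simpa using hb)

theorem IsFeasibleAssignment.exists_bin (h : κ.IsFeasibleAssignment A S) {i : ℕ} (hi : i ∈ S) :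
    ∃ b ∈ κ.bins, i ∈ A b := by
  rw [h.2] at hi
  simpa using hi

theorem IsFeasibleAssignment.mono (h : κ.IsFeasibleAssignment A S)
    (hw : ∀ i ∈ S, 0 ≤ κ.weight i) (hS : S' ⊆ S) :
    κ.IsFeasibleAssignment (fun b => A b ∩ S') S' := by
  refine ⟨fun b hb => le_trans ?_ (h.1 b hb), ?_⟩
  · exact Finset.sum_le_sum_of_subset_of_nonneg Finset.inter_subset_left
      fun i hi _ => hw i (h.subset hb hi)
  · rw [← Finset.biUnion_inter, ← h.2, Finset.inter_eq_right.2 hS]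

theorem isFeasibleAssignment_empty (hc : ∀ b ∈ κ.bins, 0 ≤ κ.cap b) :
    κ.IsFeasibleAssignment (fun _ => ∅) ∅ :=
  ⟨fun b hb => by simpa using hc b hb, by ext; simp⟩

end MKC

namespace Instance

variable {d : ℕ} {T : Instance d} {F : FunctionType} {C : ConstraintType}

@[simp] theorem mem_I {i : ℕ} : i ∈ T.I ↔ i ∈ T.items := by simp [I]

theorem Valid.isSolution_empty (h : T.Valid F C) : T.IsSolution ∅ fun _ _ => ∅ :=
  ⟨by simp, h.constraint_type.mem_empty,
    fun t => MKC.isFeasibleAssignment_empty (h.cap_nonneg t)⟩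

theorem Valid.exists_isOpt (h : T.Valid F C) : ∃ v, T.IsOpt v := by
  have hfin : {x | ∃ S A, T.IsSolution S A ∧ x = T.f S}.Finite :=
    (T.I.powerset.image T.f).finite_toSet.subset fun x ⟨S, A, hS, hx⟩ => by
      simp only [Finset.coe_image, Set.mem_image, Finset.mem_coe, Finset.mem_powerset]
      exact ⟨S, hS.1, hx.symm⟩
  obtain ⟨v, hv, hmax⟩ := hfin.exists_maximalFor id _ ⟨_, ∅, _, h.isSolution_empty, rfl⟩
  exact ⟨v, hv, fun x hx => (le_total x v).elim id fun h => hmax hx h⟩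

/-! ### Placing one item -/

/-- Item `i` can be placed into the bins `bs`. -/
def CanPlace (T : Instance d) (i : ℕ) (bs : Fin d → ℕ) : Prop :=
  i ∈ T.items ∧ (∀ k, T.mem k {i} = true) ∧
    ∀ t, bs t ∈ (T.mkc t).bins ∧ (T.mkc t).weight i ≤ (T.mkc t).cap (bs t)

/-- What is left of the instance after item `i` has been placed into the bins `bs`.  Items that
cannot be selected together with `i` are dropped. -/
def contract (T : Instance d) (i : ℕ) (bs : Fin d → ℕ) : Instance d where
  items := T.items.filter fun j => j ≠ i ∧ ∀ k, T.mem k {i, j} = true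
  mkc t :=
    { weight := (T.mkc t).weight
      bins := (T.mkc t).bins
      cap := fun b => if b = bs t then (T.mkc t).cap b - (T.mkc t).weight i else (T.mkc t).cap b }
  mem k S := T.mem k (insert i S)
  f S := T.f (insert i S)

variable {i : ℕ} {bs : Fin d → ℕ}

theorem contract_I_subset : (T.contract i bs).I ⊆ T.I := fun j hj => by
  rw [mem_I] at *
  exact List.mem_of_mem_filter hj

theorem notMem_contract_I : i ∉ (T.contract i bs).I := fun hj => by
  rw [mem_I] at hj
  simpa using (List.mem_filter.1 hj).2

theorem Valid.contract (h : T.Valid F C) (hi : T.CanPlace i bs) : (T.contract i bs).Valid F C where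
  items_nodup := h.items_nodup.filter _
  bins_nodup := h.bins_nodup
  weight_nonneg t j hj := h.weight_nonneg t j (List.mem_of_mem_filter hj)
  cap_nonneg t b hb := by
    simp only [Instance.contract]
    split_ifs with hbt
    · have := (hi.2.2 t).2
      rw [hbt]
      linarith
    · exact h.cap_nonneg t b hb
  function_type := h.function_type.contract (mem_I.2 hi.1) contract_I_subset notMem_contract_I
  constraint_type := by
    refine h.constraint_type.contract (mem_I.2 hi.1) hi.2.1 contract_I_subset notMem_contract_I
      fun j hj => ?_
    rw [mem_I] at hj
    simpa using (of_decide_eq_true (List.mem_filter.1 hj).2).2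

theorem valueSize_contract_le (hi : i ∈ T.items) :
    (T.contract i bs).valueSize ≤ T.valueSize := by
  refine Finset.sup_le fun S hS => ?_
  refine Finset.le_sup (f := fun S => bitLength (T.f S)) (b := insert i S) ?_
  rw [Finset.mem_powerset] at *
  exact Finset.insert_subset (mem_I.2 hi) (hS.trans contract_I_subset)

theorem IsSolution.of_contract (hi : T.CanPlace i bs) {S : Finset ℕ}
    {A : Fin d → ℕ → Finset ℕ} (hS : (T.contract i bs).IsSolution S A) :
    T.IsSolution (insert i S) fun t b => if b = bs t then insert i (A t b) else A t b := by
  refine ⟨Finset.insert_subset (mem_I.2 hi.1) (hS.1.trans contract_I_subset), hS.2.1,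
    fun t => ⟨fun b hb => ?_, ?_⟩⟩
  · have h1 := (hS.2.2 t).1 b hb
    simp only [Instance.contract] at h1
    dsimp only
    split_ifs at h1 ⊢ with hbt
    · have hiA : i ∉ A t b := fun hiA => notMem_contract_I (hS.1 ((hS.2.2 t).subset hb hiA))
      rw [Finset.sum_insert hiA]
      linarith
    · exact h1
  · have h2 : S = (T.mkc t).bins.toFinset.biUnion (A t) := (hS.2.2 t).2
    ext j
    conv_lhs => rw [h2]
    simp only [Finset.mem_insert, Finset.mem_biUnion, List.mem_toFinset]
    constructor
    · rintro (rfl | ⟨b, hb, hj⟩)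
      · exact ⟨bs t, (hi.2.2 t).1, by simp⟩
      · exact ⟨b, hb, by split_ifs <;> simp [hj]⟩
    · rintro ⟨b, hb, hj⟩
      split_ifs at hj with hbt
      · exact (Finset.mem_insert.1 hj).imp_right fun hj => ⟨b, hb, hj⟩
      · exact .inr ⟨b, hb, hj⟩

/-- Every item of a solution can be placed in such a way that the rest solves the contraction. -/
theorem IsSolution.contract (h : T.Valid F C) {S : Finset ℕ} {A : Fin d → ℕ → Finset ℕ}
    (hS : T.IsSolution S A) (hi : i ∈ S) :
    ∃ bs A', T.CanPlace i bs ∧ (T.contract i bs).IsSolution (S.erase i) A' := by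
  choose bs hbs hbsA using fun t => (hS.2.2 t).exists_bin hi
  have hw : ∀ t, ∀ j ∈ S, 0 ≤ (T.mkc t).weight j := fun t j hj =>
    h.weight_nonneg t j (by simpa using hS.1 hj)
  have hm : ∀ {U}, U ⊆ S → ∀ k, T.mem k U = true := fun hU =>
    h.constraint_type.mem_of_subset hU hS.1 hS.2.1
  refine ⟨bs, fun t b => A t b ∩ S.erase i, ⟨by simpa using hS.1 hi, hm (by simpa using hi),
    fun t => ⟨hbs t, ?_⟩⟩, fun j hj => ?_, fun k => ?_, fun t => ⟨fun b hb => ?_, ?_⟩⟩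
  · refine le_trans ?_ ((hS.2.2 t).1 _ (hbs t))
    exact Finset.single_le_sum (fun j hj => hw t j ((hS.2.2 t).subset (hbs t) hj)) (hbsA t)
  · have hj' := Finset.mem_erase.1 hj
    rw [mem_I]
    refine List.mem_filter.2 ⟨by simpa using hS.1 hj'.2, decide_eq_true ⟨hj'.1, hm ?_⟩⟩
    exact Finset.insert_subset hi (by simpa using hj'.2)
  · simp only [Instance.contract, Finset.insert_erase hi]
    exact hS.2.1 k
  · simp only [Instance.contract]
    have h1 := (hS.2.2 t).1 b hb
    have h2 := (hS.2.2 t).subset hb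
    split_ifs with hbt
    · subst hbt
      have e : A t (bs t) ∩ S.erase i = (A t (bs t)).erase i := by
        ext j
        simp only [Finset.mem_inter, Finset.mem_erase]
        exact ⟨fun h => ⟨h.2.1, h.1⟩, fun h => ⟨h.2, h.1, h2 h.2⟩⟩
      rw [e, ← Finset.sum_erase_add _ _ (hbsA t)] at *
      linarith
    · exact ((hS.2.2 t).mono (hw t) (S.erase_subset i)).1 b hb
  · exact ((hS.2.2 t).mono (hw t) (S.erase_subset i)).2

end Instance

/-! ### Leveled partitions -/

/-- Insertion sort by decreasing capacity. -/
def sortBins (cap : ℕ → ℚ) (l : List ℕ) : List ℕ :=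
  l.foldl (fun acc b => acc.filter (cap b ≤ cap ·) ++ b :: acc.filter (¬ cap b ≤ cap ·)) []

theorem sortBins_perm (cap : ℕ → ℚ) (l : List ℕ) : (sortBins cap l).Perm l := by
  induction l using List.reverseRecOn with
  | nil => rfl
  | append_singleton l b ih =>
    rw [sortBins, List.foldl_append]
    change (List.filter _ (sortBins cap l) ++ b :: List.filter _ (sortBins cap l)).Perm _
    refine List.perm_middle.trans
      (List.Perm.trans (.cons _ ?_) (List.perm_append_singleton b l).symm)
    refine List.Perm.trans ?_ ih
    convert List.filter_append_perm (fun x => decide (cap b ≤ cap x)) (sortBins cap l) using 4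
    exact decide_not

theorem sortBins_sorted (cap : ℕ → ℚ) (l : List ℕ) :
    (sortBins cap l).Pairwise fun a b => cap b ≤ cap a := by
  induction l using List.reverseRecOn with
  | nil => exact .nil
  | append_singleton l b ih =>
    rw [sortBins, List.foldl_append]
    change (List.filter _ (sortBins cap l) ++ b :: List.filter _ (sortBins cap l)).Pairwise _
    refine List.pairwise_append.2 ⟨ih.filter _, List.pairwise_cons.2 ⟨fun c hc => ?_, ih.filter _⟩,
      fun a ha c hc => ?_⟩
    · have := of_decide_eq_true (List.mem_filter.1 hc).2
      exact le_of_not_ge this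
    · have ha := of_decide_eq_true (List.mem_filter.1 ha).2
      rcases List.mem_cons.1 hc with rfl | hc
      · exact ha
      · have hc := of_decide_eq_true (List.mem_filter.1 hc).2
        exact (le_of_not_ge hc).trans ha

/-- The state `(K, B, r, s, u)` of the division of a list of bins into blocks: the finished blocks
`K`, last one first; the current block `B`, which still lacks `r` of its `s` bins; and the number
`u` of blocks of size `s`, including the current one, that are still to be formed. -/
abbrev BlockState := List (List ℕ) × List ℕ × ℕ × ℕ × ℕ

/-- Adds one bin to the current block.  When this block is complete, the next one is started; its
size is `N` times larger if `N ^ 2` blocks of the present size have been formed. -/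
def blockStep (N : ℕ) (x : BlockState) (b : ℕ) : BlockState :=
  if x.2.2.1 ≤ 1 then
    if x.2.2.2.2 ≤ 1 then
      ((b :: x.2.1) :: x.1, [], x.2.2.2.1 * N, x.2.2.2.1 * N, N ^ 2)
    else
      ((b :: x.2.1) :: x.1, [], x.2.2.2.1, x.2.2.2.1, x.2.2.2.2 - 1)
  else
    (x.1, b :: x.2.1, x.2.2.1 - 1, x.2.2.2.1, x.2.2.2.2)

/-- The state after all bins of a list have been added. -/
def blockState (N : ℕ) (l : List ℕ) : BlockState :=
  l.foldl (blockStep N) ([], [], 1, 1, N ^ 2)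

/-- Cuts a list into blocks of sizes `N ^ (j / N ^ 2)`, `j = 0, 1, …`, and drops the remainder.
Each block is in reverse order. -/
def blocks (N : ℕ) (l : List ℕ) : List (List ℕ) := (blockState N l).1.reverse

/-- The invariant of the division of a list into blocks, after the bins in `l` have been added. -/
structure BlockState.Correct (N : ℕ) (l : List ℕ) (x : BlockState) : Prop where
  flatten : (x.1.reverse.map List.reverse).flatten ++ x.2.1.reverse = l
  length : x.1.map List.length = ((List.range x.1.length).map fun j => N ^ (j / N ^ 2)).reverse
  size : x.2.2.2.1 = N ^ (x.1.length / N ^ 2)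
  left_pos : 1 ≤ x.2.2.2.2
  left : x.2.2.2.2 + x.1.length % N ^ 2 = N ^ 2
  lack_pos : 1 ≤ x.2.2.1
  lack : x.2.1.length + x.2.2.1 = x.2.2.2.1

theorem blockState_correct {N : ℕ} (hN : 1 ≤ N) (l : List ℕ) :
    BlockState.Correct N l (blockState N l) := by
  have hM : 0 < N ^ 2 := by positivity
  induction l using List.reverseRecOn with
  | nil => constructor <;> simp [blockState, Nat.one_le_pow _ _ hN]
  | append_singleton l b ih =>
    have e : blockState N (l ++ [b]) = blockStep N (blockState N l) b := by
      simp [blockState, List.foldl_append]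
    rw [e]
    generalize blockState N l = x at *
    obtain ⟨K, B, r, s, u⟩ := x
    obtain ⟨h1, h2, h3, h4, h5, h6, h7⟩ := ih
    dsimp only at *
    have hdm := Nat.div_add_mod K.length (N ^ 2)
    have hfl : r ≤ 1 → (((b :: B) :: K).reverse.map List.reverse).flatten ++ ([] : List ℕ).reverse =
        l ++ [b] := fun _ => by simp [← h1]
    have hle : r ≤ 1 → ((b :: B) :: K).map List.length =
        ((List.range ((b :: B) :: K).length).map fun j => N ^ (j / N ^ 2)).reverse := fun hr => by
      have : B.length + 1 = s := by omega
      simp [List.range_succ, h2, this, h3]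
    unfold blockStep
    dsimp only
    split_ifs with hr hu
    · have hdiv : (K.length + 1) / N ^ 2 = K.length / N ^ 2 + 1 ∧ (K.length + 1) % N ^ 2 = 0 := by
        have : K.length + 1 = N ^ 2 * (K.length / N ^ 2 + 1) := by rw [mul_add]; omega
        rw [this]
        exact ⟨Nat.mul_div_cancel_left _ hM, Nat.mul_mod_right _ _⟩
      refine ⟨hfl hr, hle hr, ?_, hM, ?_, ?_, ?_⟩
      · rw [List.length_cons, hdiv.1, h3, ← pow_succ]
      · simp [hdiv.2]
      · simp only [h3]
        exact Nat.mul_pos (Nat.pow_pos hN) hN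
      · simp
    · have hdiv : (K.length + 1) / N ^ 2 = K.length / N ^ 2 ∧
          (K.length + 1) % N ^ 2 = K.length % N ^ 2 + 1 := by
        have : K.length + 1 = (K.length % N ^ 2 + 1) + N ^ 2 * (K.length / N ^ 2) := by omega
        have hlt : K.length % N ^ 2 + 1 < N ^ 2 := by omega
        constructor
        · conv_lhs => rw [this]
          rw [Nat.add_mul_div_left _ _ hM, Nat.div_eq_of_lt hlt, zero_add]
        · conv_lhs => rw [this]
          rw [Nat.add_mul_mod_self_left, Nat.mod_eq_of_lt hlt]
      refine ⟨hfl hr, hle hr, ?_, ?_, ?_, ?_, ?_⟩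
      · simp [hdiv.1, h3]
      · simp only; omega
      · simp only [List.length_cons, hdiv.2]; omega
      · simp only [h3]
        exact Nat.pow_pos hN
      · simp
    · refine ⟨?_, h2, h3, h4, h5, ?_, ?_⟩
      · simp [← h1]
      · simp only; omega
      · simp only [List.length_cons]; omega

/-- The blocks of size greater than `1` start late. -/
theorem pow_div_le_sum {N : ℕ} (hN : 1 ≤ N) (j : ℕ) : N ^ (j / N ^ 2) = 1 ∨
    N * N ^ (j / N ^ 2) ≤ ((List.range j).map fun i => N ^ (i / N ^ 2)).sum := by
  have hM : 0 < N ^ 2 := by positivity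
  rcases Nat.eq_zero_or_pos (j / N ^ 2) with h | h
  · exact .inl (by simp [h])
  · right
    obtain ⟨r, hr⟩ := Nat.exists_eq_succ_of_ne_zero h.ne'
    have hj : N ^ 2 * r + N ^ 2 ≤ j := by
      have := Nat.mul_div_le j (N ^ 2)
      rw [hr, Nat.mul_succ] at this
      exact this
    have hsum : ∀ (f : ℕ → ℕ) n, ((List.range n).map f).sum = ∑ i ∈ Finset.range n, f i :=
      fun f n => by induction n <;> simp_all [List.range_succ, Finset.sum_range_succ]
    rw [hr, hsum]
    calc N * N ^ (r + 1) = ∑ i ∈ Finset.Ico (N ^ 2 * r) (N ^ 2 * r + N ^ 2), N ^ r := by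
          simp; ring
      _ = ∑ i ∈ Finset.Ico (N ^ 2 * r) (N ^ 2 * r + N ^ 2), N ^ (i / N ^ 2) := by
          refine Finset.sum_congr rfl fun i hi => ?_
          rw [Finset.mem_Ico] at hi
          rw [Nat.div_eq_of_lt_le (by rw [mul_comm]; exact hi.1)
            (by rw [Nat.succ_mul, mul_comm]; exact hi.2)]
      _ ≤ _ := Finset.sum_le_sum_of_subset fun i hi => by
          simp only [Finset.mem_Ico, Finset.mem_range] at *
          omega

/-- The capacity of the last bin of the block that contains a given bin. -/
def blockCap (cap : ℕ → ℚ) : List (List ℕ) → ℕ → ℚ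
  | [], _ => 0
  | B :: K, b => if b ∈ B then cap (B.headD 0) else blockCap cap K b

theorem blockCap_eq {cap : ℕ → ℚ} {K : List (List ℕ)} (hK : K.flatten.Nodup) {B : List ℕ}
    (hB : B ∈ K) {b : ℕ} (hb : b ∈ B) : blockCap cap K b = cap (B.headD 0) := by
  induction K with
  | nil => simp at hB
  | cons B' K ih =>
    rw [List.flatten_cons, List.nodup_append] at hK
    rw [blockCap]
    rcases List.mem_cons.1 hB with rfl | hB
    · rw [if_pos hb]
    · rw [if_neg fun hb' => hK.2.2 b hb' b (List.mem_flatten.2 ⟨B, hB, hb⟩) rfl]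
      exact ih hK.2.1 hB

/-- The block that contains a given position. -/
theorem exists_block {α : Type} {K : List (List α)} {x : ℕ} (hx : x < K.flatten.length) :
    ∃ K₁ B K₂, K = K₁ ++ B :: K₂ ∧ K₁.flatten.length ≤ x ∧
      x < K₁.flatten.length + B.length := by
  induction K generalizing x with
  | nil => simp at hx
  | cons B K ih =>
    by_cases h : x < B.length
    · exact ⟨[], B, K, rfl, by simp, by simpa using h⟩
    · have : x - B.length < K.flatten.length := by
        rw [List.flatten_cons, List.length_append] at hx; omega
      obtain ⟨K₁, B', K₂, rfl, h1, h2⟩ := ih this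
      refine ⟨B :: K₁, B', K₂, rfl, ?_, ?_⟩ <;>
      · rw [List.flatten_cons, List.length_append]; omega

section Blocks

variable {N : ℕ} {l : List ℕ}

theorem length_getElem_blocks (hN : 1 ≤ N) {j : ℕ} (hj : j < (blocks N l).length) :
    ((blocks N l)[j]).length = N ^ (j / N ^ 2) := by
  have h := congrArg List.reverse (blockState_correct hN l).length
  rw [List.reverse_reverse, ← List.map_reverse] at h
  change (blocks N l).map List.length = _ at h
  have := congrArg (fun l => l[j]?) h
  have hj' : j < (blockState N l).1.length := by simpa [blocks] using hj
  simpa [hj, hj'] using this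

theorem flatten_blocks_append (hN : 1 ≤ N) :
    ((blocks N l).map List.reverse).flatten ++ (blockState N l).2.1.reverse = l :=
  (blockState_correct hN l).flatten

theorem flatten_map_reverse_perm {α : Type} (K : List (List α)) :
    (K.map List.reverse).flatten.Perm K.flatten := by
  induction K with
  | nil => rfl
  | cons B K ih =>
    simp only [List.map_cons, List.flatten_cons]
    exact (List.reverse_perm B).append ih

theorem flatten_blocks_subperm (hN : 1 ≤ N) : (blocks N l).flatten.Subperm l := by
  refine (flatten_map_reverse_perm _).symm.subperm.trans ?_
  conv_rhs => rw [← flatten_blocks_append (l := l) hN]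
  exact (List.sublist_append_left _ _).subperm

theorem nodup_flatten_blocks (hN : 1 ≤ N) (hl : l.Nodup) : (blocks N l).flatten.Nodup := by
  obtain ⟨l', h1, h2⟩ := flatten_blocks_subperm (l := l) hN
  exact h1.nodup_iff.1 (hl.sublist h2)

theorem blocks_ne_nil (hN : 1 ≤ N) (hl : l ≠ []) : blocks N l ≠ [] := by
  intro h
  have hc := blockState_correct hN l
  have h0 : (blockState N l).1 = [] := by simpa [blocks] using h
  have h1 := hc.flatten
  have h2 := hc.size
  have h3 := hc.lack
  have h4 := hc.lack_pos
  simp only [h0, List.length_nil, Nat.zero_div, pow_zero] at h2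
  have h5 : (blockState N l).2.1 = [] := List.length_eq_zero_iff.1 (by omega)
  rw [h0, h5] at h1
  exact hl (by simpa using h1.symm)

/-- Moving the contents of the `k`-th bin forwards by at least `k / N` positions, to the `x`-th bin,
gets them past the end of a block, whence the reduced capacity of the `x`-th bin suffices. -/
theorem le_blockCap (hN : 1 ≤ N) {cap : ℕ → ℚ} (hl : l.Nodup)
    (hs : l.Pairwise fun a b => cap b ≤ cap a) {x k : ℕ} (hx : x < l.length) (hk : k < l.length)
    (hxk : x + k / N ≤ k) :
    l[x] ∈ (blocks N l).flatten ∧ cap l[k] ≤ blockCap cap (blocks N l) l[x] := by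
  have hc := blockState_correct hN l
  have happ := flatten_blocks_append (l := l) hN
  -- `s` is the start of the block of `x`, which has size `z`.
  have key : ∀ z s, z = 1 ∨ N * z ≤ s → s ≤ x → x < s + z → s + z ≤ k + 1 := by
    have := Nat.zero_le (k / N)
    rintro z s (h | h) h1 h2
    · omega
    · have h3 : z ≤ k / N := by
        rw [Nat.le_div_iff_mul_le (by omega), mul_comm]
        omega
      omega
  have hsum : ∀ K₁ K₂, (blocks N l).map List.reverse = K₁ ++ K₂ → K₁.flatten.length =
      ((List.range K₁.length).map fun i => N ^ (i / N ^ 2)).sum := by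
    intro K₁ K₂ h
    rw [List.length_flatten]
    congr 1
    refine List.ext_getElem (by simp) fun j h1 h2 => ?_
    have h4 : j < K₁.length := by simpa using h1
    have h5 : j < (blocks N l).length := by
      have := congrArg List.length h
      simp only [List.length_map, List.length_append] at this
      omega
    have h3 : K₁[j] = ((blocks N l).map List.reverse)[j]'(by simpa using h5) := by
      rw [List.getElem_of_eq h, List.getElem_append_left h4]
    rw [List.getElem_map, h3, List.getElem_map, List.length_reverse, length_getElem_blocks hN,
      List.getElem_map, List.getElem_range]
  by_cases hxK : x < ((blocks N l).map List.reverse).flatten.length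
  · obtain ⟨K₁, B, K₂, hK, h1, h2⟩ := exists_block hxK
    have hB : B.length = N ^ (K₁.length / N ^ 2) := by
      have h5 : K₁.length < (blocks N l).length := by
        have := congrArg List.length hK
        simp only [List.length_map, List.length_append, List.length_cons] at this
        omega
      have h3 : B = ((blocks N l).map List.reverse)[K₁.length]'(by simpa using h5) := by
        simp [List.getElem_of_eq hK]
      rw [h3, List.getElem_map, List.length_reverse, length_getElem_blocks hN]
    have hend := key B.length K₁.flatten.length (by
      rw [hB, hsum K₁ _ hK]; exact pow_div_le_sum hN _) h1 h2
    have hBK : B.reverse ∈ blocks N l := by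
      have : B ∈ (blocks N l).map List.reverse := by rw [hK]; simp
      obtain ⟨B', hB', rfl⟩ := List.mem_map.1 this
      simpa using hB'
    have hl' : l = K₁.flatten ++ (B ++ (K₂.flatten ++ (blockState N l).2.1.reverse)) := by
      conv_lhs => rw [← happ, hK]
      simp
    have hxB : l[x] ∈ B := by
      have : l[x] = B[x - K₁.flatten.length] := by
        conv_lhs => rw [List.getElem_of_eq hl']
        rw [List.getElem_append_right h1, List.getElem_append_left]
      rw [this]
      exact List.getElem_mem _
    refine ⟨List.mem_flatten.2 ⟨_, hBK, by simpa using hxB⟩, ?_⟩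
    rw [blockCap_eq (nodup_flatten_blocks hN hl) hBK (by simpa using hxB)]
    have hlast : ∃ h : K₁.flatten.length + B.length - 1 < l.length,
        B.reverse.headD 0 = l[K₁.flatten.length + B.length - 1] := by
      refine ⟨by omega, ?_⟩
      conv_rhs => rw [List.getElem_of_eq hl']
      rw [List.getElem_append_right (by omega), List.getElem_append_left (by omega)]
      rw [List.headD_eq_head?_getD, List.head?_reverse, List.getLast?_eq_getElem?,
        List.getElem?_eq_getElem (by omega), Option.getD_some]
      congr 1
      omega
    obtain ⟨h, e⟩ := hlast
    rw [e]
    rcases Nat.lt_or_ge (K₁.flatten.length + B.length - 1) k with hlt | hge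
    · exact List.pairwise_iff_getElem.1 hs _ _ h hk hlt
    · have : K₁.flatten.length + B.length - 1 = k := by omega
      subst this
      exact le_rfl
  · exfalso
    have h1 := congrArg List.length happ
    rw [List.length_append, List.length_reverse] at h1
    have h2 := hsum ((blocks N l).map List.reverse) [] (by simp)
    have h3 : ((blocks N l).map List.reverse).length = (blockState N l).1.length := by
      simp [blocks]
    rw [h3] at h2
    have h4 := pow_div_le_sum hN (blockState N l).1.length
    rw [← h2, ← hc.size] at h4
    have h5 := hc.lack
    have h6 := hc.lack_pos
    have := key _ _ h4 (by omega) (by omega)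
    omega

end Blocks

/-- The reduction of a multiple knapsack constraint to one with a leveled partition, in the order
of decreasing capacities. -/
def MKC.level (N : ℕ) (κ : MKC) : MKC where
  weight := κ.weight
  bins := (blocks N (sortBins κ.cap κ.bins)).flatten
  cap := blockCap κ.cap (blocks N (sortBins κ.cap κ.bins))

/-- The structural lemma: by a shift of the contents of the bins, a fraction `1 - 1 / N` of the
value of a set is retained in the leveled constraint.  In the order of decreasing capacities, the
positions `k` of the bins are split into `N` residue classes; the cheapest class is emptied, and the
contents of the other bins move forwards to fill the gaps, hence by at least `k / N` positions. -/
theorem exists_subset_level {N : ℕ} (hN : 1 ≤ N) {κ : MKC} (hb : κ.bins.Nodup)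
    (hc : ∀ b ∈ (κ.level N).bins, 0 ≤ (κ.level N).cap b) {I : Finset ℕ} {f : Finset ℕ → ℚ}
    (hf : IsSubmodular I f) {S : Finset ℕ} (hS : S ⊆ I) (hw : ∀ i ∈ S, 0 ≤ κ.weight i)
    {A : ℕ → Finset ℕ} (hA : κ.IsFeasibleAssignment A S) :
    ∃ S' ⊆ S, (1 - 1 / (N : ℚ)) * f S ≤ f S' ∧ ∃ A', (κ.level N).IsFeasibleAssignment A' S' := by
  classical
  set l := sortBins κ.cap κ.bins with hl
  have hperm : l.Perm κ.bins := sortBins_perm _ _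
  have hnd : l.Nodup := hperm.nodup_iff.2 hb
  have hpos : ∀ i, ∃ k, i ∈ S → ∃ h : k < l.length, i ∈ A l[k] := fun i => by
    by_cases hi : i ∈ S
    · obtain ⟨b, hb, hib⟩ := hA.exists_bin hi
      obtain ⟨k, hk, rfl⟩ := List.getElem_of_mem (hperm.mem_iff.2 hb)
      exact ⟨k, fun _ => ⟨hk, hib⟩⟩
    · exact ⟨0, fun h => absurd h hi⟩
  choose a ha using hpos
  obtain ⟨g, hg, hfg⟩ := hf.exists_filter_le hS (fun i => a i % N) hN
  -- The contents of the bins in the residue class of `g` are removed, and the others move up.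
  set φ := Nat.count fun k => k % N ≠ g with hφ
  have hφk : ∀ k, φ k + k / N ≤ k := fun k => by
    have h1 := Nat.count_modEq_card (r := N) k (by omega) g
    have h2 : Nat.count (fun k => k % N ≠ g) k + Nat.count (· ≡ g [MOD N]) k = k := by
      clear h1
      induction k with
      | zero => simp
      | succ k ih =>
        rw [Nat.count_succ, Nat.count_succ]
        by_cases h : k % N = g
        · simp only [Nat.ModEq, Nat.mod_eq_of_lt hg, h, ne_eq, not_true_eq_false, if_true,
            if_false] at ih ⊢
          omega
        · simp only [Nat.ModEq, Nat.mod_eq_of_lt hg, h, ne_eq, not_false_eq_true, if_true,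
            if_false] at ih ⊢
          omega
    have : φ k = Nat.count (fun k => k % N ≠ g) k := rfl
    split_ifs at h1 <;> omega
  have hbin : ∀ i ∈ S, ∃ h : φ (a i) < l.length, l[φ (a i)] ∈ (κ.level N).bins ∧
      ∃ h' : a i < l.length, κ.cap l[a i] ≤ (κ.level N).cap l[φ (a i)] := fun i hi => by
    obtain ⟨h1, h2⟩ := ha i hi
    have h3 := hφk (a i)
    have h4 : φ (a i) < l.length := by
      have := Nat.zero_le (a i / N)
      omega
    have h5 := le_blockCap hN hnd (sortBins_sorted κ.cap κ.bins) h4 h1 h3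
    exact ⟨h4, h5.1, h1, h5.2⟩
  set S' := S.filter fun i => a i % N ≠ g with hS'
  refine ⟨S', Finset.filter_subset _ _, hfg,
    fun b => S'.filter fun i => l[φ (a i)]? = some b, fun b hb => ?_, ?_⟩
  · rcases (S'.filter fun i => l[φ (a i)]? = some b).eq_empty_or_nonempty with he | ⟨j, hj⟩
    · dsimp only
      rw [he]
      simpa using hc b hb
    · rw [Finset.mem_filter] at hj
      obtain ⟨hjS', hjb⟩ := hj
      have hjS := (Finset.mem_filter.1 hjS').1
      obtain ⟨h1, h2, h3, h4⟩ := hbin j hjS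
      obtain rfl : l[φ (a j)] = b := by simpa [h1] using hjb
      refine le_trans ?_ h4
      refine le_trans ?_ (hA.1 _ (hperm.mem_iff.1 (List.getElem_mem h3)))
      refine Finset.sum_le_sum_of_subset_of_nonneg (fun i hi => ?_) fun i hi _ =>
        hw i (hA.subset (hperm.mem_iff.1 (List.getElem_mem h3)) hi)
      obtain ⟨hiS', hib⟩ := Finset.mem_filter.1 hi
      obtain ⟨hiS, hig⟩ := Finset.mem_filter.1 hiS'
      obtain ⟨h5, h6, h7, h8⟩ := hbin i hiS
      have h9 : l[φ (a i)] = l[φ (a j)] := by simpa [h5] using hib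
      have h10 : φ (a i) = φ (a j) := hnd.getElem_inj_iff.1 h9
      have h11 : a i = a j := Nat.count_injective hig (Finset.mem_filter.1 hjS').2 h10
      obtain ⟨h12, h13⟩ := ha i hiS
      simpa [h11] using h13
  · ext i
    simp only [Finset.mem_biUnion, List.mem_toFinset, Finset.mem_filter]
    constructor
    · intro hi
      obtain ⟨h1, h2, -⟩ := hbin i (Finset.mem_filter.1 hi).1
      exact ⟨_, h2, hi, by simp [h1]⟩
    · rintro ⟨b, -, hi, -⟩
      exact hi

section Blocks

variable {N : ℕ} {l : List ℕ}

theorem sublist_of_mem_blocks (hN : 1 ≤ N) {B : List ℕ} (hB : B ∈ blocks N l) :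
    B.reverse.Sublist l := by
  conv_rhs => rw [← flatten_blocks_append (l := l) hN]
  exact (List.sublist_flatten_of_mem (List.mem_map_of_mem hB)).trans
    (List.sublist_append_left _ _)

theorem headD_mem_of_mem {B : List ℕ} {b : ℕ} (hb : b ∈ B) : B.headD 0 ∈ B := by
  cases B with
  | nil => simp at hb
  | cons a B => simp

theorem blockCap_le (hN : 1 ≤ N) {cap : ℕ → ℚ} (hl : l.Nodup)
    (hs : l.Pairwise fun a b => cap b ≤ cap a) {b : ℕ} (hb : b ∈ (blocks N l).flatten) :
    blockCap cap (blocks N l) b ≤ cap b := by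
  obtain ⟨B, hB, hbB⟩ := List.mem_flatten.1 hb
  rw [blockCap_eq (nodup_flatten_blocks hN hl) hB hbB]
  have h := List.pairwise_reverse.1 (hs.sublist (sublist_of_mem_blocks hN hB))
  cases B with
  | nil => simp at hbB
  | cons a B =>
    rcases List.mem_cons.1 hbB with rfl | hbB
    · exact le_rfl
    · exact (List.pairwise_cons.1 h).1 b hbB

theorem blockCap_nonneg (hN : 1 ≤ N) {cap : ℕ → ℚ} (hl : l.Nodup) (hc : ∀ b ∈ l, 0 ≤ cap b)
    {b : ℕ} (hb : b ∈ (blocks N l).flatten) : 0 ≤ blockCap cap (blocks N l) b := by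
  obtain ⟨B, hB, hbB⟩ := List.mem_flatten.1 hb
  rw [blockCap_eq (nodup_flatten_blocks hN hl) hB hbB]
  exact hc _ ((sublist_of_mem_blocks hN hB).subset
    (List.mem_reverse.2 (headD_mem_of_mem hbB)))

end Blocks

namespace MKC

variable {N : ℕ} {κ : MKC} {A : ℕ → Finset ℕ} {S : Finset ℕ}

theorem mem_of_mem_level_bins (hN : 1 ≤ N) {b : ℕ} (hb : b ∈ (κ.level N).bins) : b ∈ κ.bins :=
  (sortBins_perm κ.cap κ.bins).subset ((flatten_blocks_subperm hN).subset hb)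

theorem level_bins_nodup (hN : 1 ≤ N) (h : κ.bins.Nodup) : (κ.level N).bins.Nodup :=
  nodup_flatten_blocks hN ((sortBins_perm κ.cap κ.bins).nodup_iff.2 h)

theorem level_cap_nonneg (hN : 1 ≤ N) (h : κ.bins.Nodup) (hc : ∀ b ∈ κ.bins, 0 ≤ κ.cap b) :
    ∀ b ∈ (κ.level N).bins, 0 ≤ (κ.level N).cap b := fun _ hb =>
  blockCap_nonneg hN ((sortBins_perm κ.cap κ.bins).nodup_iff.2 h)
    (fun b hb => hc b ((sortBins_perm κ.cap κ.bins).subset hb)) hb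

theorem IsFeasibleAssignment.of_level (hN : 1 ≤ N) (h : κ.bins.Nodup)
    (hc : ∀ b ∈ κ.bins, 0 ≤ κ.cap b) (hA : (κ.level N).IsFeasibleAssignment A S) :
    κ.IsFeasibleAssignment (fun b => if b ∈ (κ.level N).bins then A b else ∅) S := by
  refine ⟨fun b hb => ?_, ?_⟩
  · dsimp only
    split_ifs with hb'
    · exact (hA.1 b hb').trans (blockCap_le hN ((sortBins_perm κ.cap κ.bins).nodup_iff.2 h)
        (sortBins_sorted κ.cap κ.bins) hb')
    · simpa using hc b hb
  · rw [hA.2]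
    ext i
    simp only [Finset.mem_biUnion, List.mem_toFinset]
    constructor
    · rintro ⟨b, hb, hi⟩
      exact ⟨b, mem_of_mem_level_bins hN hb, by rwa [if_pos hb]⟩
    · rintro ⟨b, -, hi⟩
      split_ifs at hi with hb
      · exact ⟨b, hb, hi⟩
      · simp at hi

end MKC

namespace Instance

variable {d N ξ : ℕ} {T : Instance d} {F : FunctionType} {C : ConstraintType}

/-- The restricted instance: only items of small value are left, and each constraint is replaced by
a leveled one. -/
def level (N ξ : ℕ) (T : Instance d) : Instance d where
  items := T.items.filter fun i => (ξ : ℚ) * (T.f {i} - T.f ∅) ≤ T.f ∅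
  mkc t := (T.mkc t).level N
  mem := T.mem
  f := T.f

/-- The leveled partition of the bins of the restricted instance. -/
def levelPartition (N : ℕ) (T : Instance d) (t : Fin d) : List (List ℕ) :=
  blocks N (sortBins (T.mkc t).cap (T.mkc t).bins)

theorem level_I_subset : (T.level N ξ).I ⊆ T.I := fun j hj => by
  rw [mem_I] at *
  exact List.mem_of_mem_filter hj

theorem valueSize_level_le : (T.level N ξ).valueSize ≤ T.valueSize :=
  Finset.sup_mono (Finset.powerset_mono.2 level_I_subset)

theorem Valid.level (h : T.Valid F C) (hN : 1 ≤ N) : (T.level N ξ).Valid F C where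
  items_nodup := h.items_nodup.filter _
  bins_nodup t := MKC.level_bins_nodup hN (h.bins_nodup t)
  weight_nonneg t j hj := h.weight_nonneg t j (List.mem_of_mem_filter hj)
  cap_nonneg t := MKC.level_cap_nonneg hN (h.bins_nodup t) (h.cap_nonneg t)
  function_type := h.function_type.mono level_I_subset
  constraint_type := h.constraint_type.mono level_I_subset

theorem Valid.isLeveled (h : T.Valid F C) (hN : 1 ≤ N) (hb : ∀ t, (T.mkc t).bins ≠ []) :
    (T.level N ξ).IsLeveled N (T.levelPartition N) := fun t => by
  have hl : sortBins (T.mkc t).cap (T.mkc t).bins ≠ [] := fun h0 => by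
    have := sortBins_perm (T.mkc t).cap (T.mkc t).bins
    rw [h0] at this
    exact hb t this.nil_eq.symm
  have hnd := nodup_flatten_blocks hN
    ((sortBins_perm (T.mkc t).cap (T.mkc t).bins).nodup_iff.2 (h.bins_nodup t))
  refine ⟨blocks_ne_nil hN hl, .rfl, fun j hj => length_getElem_blocks hN hj,
    fun B hB b hb b' hb' => ?_⟩
  change blockCap _ _ b = blockCap _ _ b'
  rw [blockCap_eq hnd hB hb, blockCap_eq hnd hB hb']

theorem Valid.f_empty_nonneg (h : T.Valid F C) : 0 ≤ T.f ∅ :=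
  h.function_type.isSubmodular.1 ∅ (by simp)

/-- The remaining items gain at most `f ∅ / ξ`, and `f ∅` is the value of a solution. -/
theorem Valid.hasSmallItems (h : T.Valid F C) (hN : 1 ≤ N) (hξ : 1 ≤ ξ) :
    (T.level N ξ).HasSmallItems ξ := by
  have h' := h.level (ξ := ξ) hN
  obtain ⟨v, hv⟩ := h'.exists_isOpt
  refine ⟨v, hv, fun i hi => ?_⟩
  have h1 : (T.level N ξ).f ∅ ≤ v := hv.2 ⟨∅, _, h'.isSolution_empty, rfl⟩
  have h2 := of_decide_eq_true (List.mem_filter.1 (mem_I.1 hi)).2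
  have h3 : (0 : ℚ) < ξ := by exact_mod_cast hξ
  rw [le_div_iff₀ h3, mul_comm]
  exact h2.trans h1

theorem Valid.weight_nonneg_of_subset (h : T.Valid F C) {S : Finset ℕ} (hS : S ⊆ T.I)
    (t : Fin d) : ∀ i ∈ S, 0 ≤ (T.mkc t).weight i :=
  fun i hi => h.weight_nonneg t i (mem_I.1 (hS hi))

/-- A solution without items of large value loses at most the factor `1 - 1 / N` per constraint. -/
theorem Valid.exists_isSolution_level (h : T.Valid F C) (hN : 1 ≤ N) {S : Finset ℕ}
    {A : Fin d → ℕ → Finset ℕ} (hS : T.IsSolution S A)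
    (hsmall : ∀ i ∈ S, (ξ : ℚ) * (T.f {i} - T.f ∅) ≤ T.f ∅) :
    ∃ S' A', (T.level N ξ).IsSolution S' A' ∧ (1 - 1 / (N : ℚ)) ^ d * T.f S ≤ T.f S' := by
  have hN' : (0 : ℚ) ≤ 1 - 1 / (N : ℚ) := by
    have : (1 : ℚ) ≤ N := by exact_mod_cast hN
    rw [sub_nonneg, div_le_one (by linarith)]
    exact this
  -- The constraints are replaced by leveled ones, one after another.
  have key : ∀ U : Finset (Fin d), ∃ S' ⊆ S, (1 - 1 / (N : ℚ)) ^ U.card * T.f S ≤ T.f S' ∧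
      ∀ t ∈ U, ∃ A', ((T.mkc t).level N).IsFeasibleAssignment A' S' := by
    intro U
    induction U using Finset.induction_on with
    | empty => exact ⟨S, subset_rfl, by simp, by simp⟩
    | insert t U ht ih =>
      obtain ⟨S', hS', hf, hU⟩ := ih
      have hw := h.weight_nonneg_of_subset hS.1
      have hS'I := hS'.trans hS.1
      obtain ⟨S'', hS'', hf', A', hA'⟩ := exists_subset_level hN (h.bins_nodup t)
        (MKC.level_cap_nonneg hN (h.bins_nodup t) (h.cap_nonneg t))
        h.function_type.isSubmodular hS'I (h.weight_nonneg_of_subset hS'I t)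
        ((hS.2.2 t).mono (hw t) hS')
      refine ⟨S'', hS''.trans hS', ?_, fun t' ht' => ?_⟩
      · rw [Finset.card_insert_of_notMem ht, pow_succ']
        calc _ = (1 - 1 / (N : ℚ)) * ((1 - 1 / (N : ℚ)) ^ U.card * T.f S) := by ring
          _ ≤ (1 - 1 / (N : ℚ)) * T.f S' := mul_le_mul_of_nonneg_left hf hN'
          _ ≤ _ := hf'
      · rcases Finset.mem_insert.1 ht' with rfl | ht'
        · exact ⟨A', hA'⟩
        · obtain ⟨A'', hA''⟩ := hU t' ht'
          exact ⟨_, hA''.mono (h.weight_nonneg_of_subset hS'I t') hS''⟩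
  obtain ⟨S', hS', hf, hA⟩ := key Finset.univ
  choose A' hA' using fun t => hA t (Finset.mem_univ t)
  refine ⟨S', A', ⟨fun i hi => ?_, ?_, hA'⟩, by simpa using hf⟩
  · exact mem_I.2 (List.mem_filter.2 ⟨mem_I.1 (hS.1 (hS' hi)), decide_eq_true (hsmall i (hS' hi))⟩)
  · exact h.constraint_type.mem_of_subset hS' hS.1 hS.2.1

/-! ### Outputs -/

theorem isSolution_congr {S : Finset ℕ} {A A' : Fin d → ℕ → Finset ℕ} (h : T.IsSolution S A)
    (hA : ∀ t b, A' t b = A t b) : T.IsSolution S A' := by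
  have : A' = A := funext fun t => funext fun b => hA t b
  rwa [this]

theorem outAssignment_ofFn (s : Val) (v : Fin d → Val) (t : Fin d) :
    outAssignment (.node s (.ofList (List.ofFn v))) t = (v t).toAssignment := by
  simp [outAssignment]

/-- The output with no items. -/
def emptyOutput : Val := .node (.leaf 0) (.leaf 0)

theorem Valid.isSolution_emptyOutput (h : T.Valid F C) :
    T.IsSolution (outSet emptyOutput) (outAssignment emptyOutput) :=
  isSolution_congr h.isSolution_empty fun t b => by
    simp [emptyOutput, outAssignment, Val.toList, Val.toAssignment]

@[simp] theorem outSet_emptyOutput : outSet emptyOutput = ∅ := rfl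

/-- Restricts all assignments of an output to the bins of the leveled instance.  The contents of
other bins do not matter for the leveled instance, but they might exceed the capacities in `T`. -/
def restrictOutput (N : ℕ) (T : Instance d) (x : Val) : Val :=
  .node x.fst (.ofList (List.ofFn fun t : Fin d => .ofList
    ((x.snd.toList.getD t (.leaf 0)).toList.filter fun p =>
      p.fst.label ∈ ((T.mkc t).level N).bins)))

theorem Valid.isSolution_restrictOutput (h : T.Valid F C) (hN : 1 ≤ N) {x : Val}
    (hx : (T.level N ξ).IsSolution (outSet x) (outAssignment x)) :
    T.IsSolution (outSet (restrictOutput N T x)) (outAssignment (restrictOutput N T x)) := by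
  have h1 : T.IsSolution (outSet x) fun t b =>
      if b ∈ ((T.mkc t).level N).bins then outAssignment x t b else ∅ :=
    ⟨hx.1.trans level_I_subset, hx.2.1, fun t =>
      (hx.2.2 t).of_level hN (h.bins_nodup t) (h.cap_nonneg t)⟩
  refine isSolution_congr h1 fun t b => ?_
  rw [restrictOutput, outAssignment_ofFn]
  simp only [Val.toAssignment, Val.toList_ofList, List.filter_filter, outAssignment]
  split_ifs with hb
  · congr 2
    refine List.filter_congr fun p _ => ?_
    by_cases hp : p.fst.label = b
    · simp [hp, hb]
    · simp [hp]
  · rw [List.filter_eq_nil_iff.2]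
    · simp
    · intro p _ hp
      simp only [Bool.and_eq_true, decide_eq_true_eq] at hp
      exact hb (hp.1 ▸ hp.2)

/-- Adds item `i` to an output and puts it into the bins `bs`. -/
def extendOutput (i : ℕ) (bs : Fin d → ℕ) (x : Val) : Val :=
  .node (.node (.ofNat i) x.fst) (.ofList (List.ofFn fun t : Fin d =>
    .node (.node (.ofNat (bs t)) (.ofNat i)) (x.snd.toList.getD t (.leaf 0))))

theorem outSet_extendOutput (i : ℕ) (bs : Fin d → ℕ) (x : Val) :
    outSet (extendOutput i bs x) = insert i (outSet x) := by
  simp [outSet, extendOutput, Val.toSet_node]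

theorem isSolution_extendOutput {i : ℕ} {bs : Fin d → ℕ} (hi : T.CanPlace i bs) {x : Val}
    (hx : (T.contract i bs).IsSolution (outSet x) (outAssignment x)) :
    T.IsSolution (outSet (extendOutput i bs x)) (outAssignment (extendOutput i bs x)) := by
  rw [outSet_extendOutput]
  refine isSolution_congr (hx.of_contract hi) fun t b => ?_
  rw [extendOutput, outAssignment_ofFn]
  simp only [Val.toAssignment, Val.toList, outAssignment]
  by_cases hb : b = bs t
  · simp [hb]
  · have hb' : ¬ bs t = b := fun h => hb h.symm
    rw [if_neg hb]
    simp [hb']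

end Instance

/-! ### Reading an instance -/

/-- The code of the instance `T x` can be computed, its oracles are available, and the bit length of
the values of its objective function is admitted in time bounds. -/
structure Reads {d : ℕ} (σ : Setting X) (inp : X → Val) (T : X → Instance d) : Prop where
  code : Det σ inp fun x => (T x).code
  orc : ∀ x, σ.dom x → σ.orc x = (T x).oracles
  extra : ∀ x, σ.dom x → (T x).valueSize ≤ σ.extra x

/-- The code of a bin with its capacity. -/
def binPair (cap : ℕ → ℚ) (b : ℕ) : Val := .node (.ofNat b) (.leaf (cap b))

theorem Det.ofNatList_map {σ : Setting X} {inp : X → Val} {α : Type} {l : X → List α} {L : X → Val}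
    {ea : X → α → Val} {h : X → α → ℕ}
    (hL : Det σ inp L) (hl : ∀ x, σ.dom x → (L x).toList = (l x).map (ea x))
    (hh : Det (σ.elem l) (fun y => .node (inp y.1) (ea y.1 y.2)) fun y => .ofNat (h y.1 y.2)) :
    Det σ inp fun x => .ofNatList ((l x).map (h x)) :=
  (Det.map (h := fun x a => .ofNat (h x a)) hL hl hh).congr fun x _ => by
    simp [Val.ofNatList, Function.comp_def]

theorem Val.toList_ofNatList (l : List ℕ) : (Val.ofNatList l).toList = l.map Val.ofNat := by
  simp [Val.ofNatList]

namespace Reads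

variable {d N ξ : ℕ} {σ : Setting X} {inp : X → Val} {T : X → Instance d}

theorem pull (h : Reads σ inp T) (φ : Y → X) {dom : Y → Prop} {inp' : Y → Val}
    (hd : ∀ y, dom y → σ.dom (φ y)) (hi : Det (σ.pull φ dom) inp' fun y => inp (φ y)) :
    Reads (σ.pull φ dom) inp' fun y => T (φ y) :=
  ⟨hi.comp (h.code.pull φ hd), fun y hy => h.orc _ (hd y hy), fun y hy => h.extra _ (hd y hy)⟩

theorem restrict (h : Reads σ inp T) (c : X → Prop) : Reads (σ.restrict c) inp T :=
  h.pull id (fun _ hx => hx.1) Det.input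

theorem elem (h : Reads σ inp T) {α : Type} {l : X → List α} {e : X × α → Val} :
    Reads (σ.elem l) (fun y => .node (inp y.1) (e y)) fun y => T y.1 :=
  h.pull Prod.fst (fun _ hy => hy.1) (Det.fst Det.input)

theorem items (h : Reads σ inp T) : Det σ inp fun x => .ofNatList (T x).items :=
  (Det.fst h.code).congr fun _ _ => rfl

theorem weights (h : Reads σ inp T) (t : Fin d) : Det σ inp fun x =>
    .ofList ((T x).items.map fun i => .node (.ofNat i) (.leaf (((T x).mkc t).weight i))) :=
  (Det.fst (Det.of_ofFn (h := fun x t => .node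
    (.ofList ((T x).items.map fun i => .node (.ofNat i) (.leaf (((T x).mkc t).weight i))))
    (.ofList (((T x).mkc t).bins.map (binPair ((T x).mkc t).cap))))
    ((Det.snd h.code).congr fun _ _ => rfl) t)).congr fun _ _ => rfl

theorem bins (h : Reads σ inp T) (t : Fin d) : Det σ inp fun x =>
    .ofList (((T x).mkc t).bins.map (binPair ((T x).mkc t).cap)) :=
  (Det.snd (Det.of_ofFn (h := fun x t => .node
    (.ofList ((T x).items.map fun i => .node (.ofNat i) (.leaf (((T x).mkc t).weight i))))
    (.ofList (((T x).mkc t).bins.map (binPair ((T x).mkc t).cap))))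
    ((Det.snd h.code).congr fun _ _ => rfl) t)).congr fun _ _ => rfl

theorem binNames (h : Reads σ inp T) (t : Fin d) :
    Det σ inp fun x => .ofNatList ((T x).mkc t).bins :=
  (Det.ofNatList_map (h := fun _ b => b) (h.bins t) (fun _ _ => Val.toList_ofList _)
    (Det.fst (Det.snd Det.input))).congr fun _ _ => by simp

theorem weight (h : Reads σ inp T) (t : Fin d) {i : X → ℕ} (hi : Det σ inp fun x => .ofNat (i x))
    (hmem : ∀ x, σ.dom x → i x ∈ (T x).items) :
    Det σ inp fun x => .leaf (((T x).mkc t).weight (i x)) :=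
  Det.lookup (p := fun x j => j = i x) (h := fun x j => .leaf (((T x).mkc t).weight j))
    (h.weights t) (fun _ _ => Val.toList_ofList _)
    (Det.eqNat (Det.fst (Det.snd Det.input)) (Det.lift_elem hi)) (Det.snd (Det.snd Det.input))
    fun x hx => ⟨⟨_, hmem x hx, rfl⟩, fun j _ hj => by rw [hj]⟩

theorem cap (h : Reads σ inp T) (t : Fin d) {b : X → ℕ} (hb : Det σ inp fun x => .ofNat (b x))
    (hmem : ∀ x, σ.dom x → b x ∈ ((T x).mkc t).bins) :
    Det σ inp fun x => .leaf (((T x).mkc t).cap (b x)) :=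
  Det.lookup (p := fun x j => j = b x) (h := fun x j => .leaf (((T x).mkc t).cap j))
    (h.bins t) (fun _ _ => Val.toList_ofList _)
    (Det.eqNat (Det.fst (Det.snd Det.input)) (Det.lift_elem hb)) (Det.snd (Det.snd Det.input))
    fun x hx => ⟨⟨_, hmem x hx, rfl⟩, fun j _ hj => by rw [hj]⟩

theorem value (h : Reads σ inp T) {s : X → Val} (hs : Det σ inp s)
    (hsub : ∀ x, σ.dom x → (s x).toSet ⊆ (T x).I) :
    Det σ inp fun x => .leaf ((T x).f (s x).toSet) :=
  (Det.value hs (PolyBounded.extra.mono fun x hx => by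
    rw [h.orc x hx]
    exact (Finset.le_sup (f := fun S => bitLength ((T x).f S))
      (Finset.mem_powerset.2 (hsub x hx))).trans (h.extra x hx))).congr fun x hx => by
    rw [h.orc x hx]; rfl

theorem mem (h : Reads σ inp T) (k : Fin 2) {s : X → Val} (hs : Det σ inp s) :
    Det σ inp fun x => Val.ofBool ((T x).mem k (s x).toSet) :=
  (Det.mem k hs).congr fun x hx => by rw [h.orc x hx]; rfl

/-- The code of an instance whose items and bins have been computed, with the weights of a known
instance. -/
theorem code_of (h : Reads σ inp T) {T' : X → Instance d}
    (hi : Det σ inp fun x => .ofNatList (T' x).items)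
    (hb : ∀ t, Det σ inp fun x => .ofList (((T' x).mkc t).bins.map (binPair ((T' x).mkc t).cap)))
    (hsub : ∀ x, σ.dom x → ∀ i ∈ (T' x).items, i ∈ (T x).items)
    (hw : ∀ x t, ((T' x).mkc t).weight = ((T x).mkc t).weight) :
    Det σ inp fun x => (T' x).code := by
  refine Det.node hi (Det.ofFn (h := fun x t => .node (.ofList ((T' x).items.map fun i =>
    .node (.ofNat i) (.leaf (((T' x).mkc t).weight i))))
    (.ofList (((T' x).mkc t).bins.map (binPair ((T' x).mkc t).cap)))) fun t => Det.node ?_ (hb t))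
  refine Det.map (h := fun x i => .node (.ofNat i) (.leaf (((T' x).mkc t).weight i))) hi
    (fun x _ => Val.toList_ofNatList _) ((Det.snd Det.input).node ?_)
  refine Det.congr (f := fun y => .leaf (((T y.1).mkc t).weight y.2)) ?_ fun y _ => by rw [hw]
  exact h.elem.weight t (Det.snd Det.input) fun y hy => hsub _ hy.1 _ hy.2

/-! ### Computing the rest of an instance -/

theorem forall_mem (h : Reads σ inp T) {s : X → Val} (hs : Det σ inp s) :
    Det σ inp fun x => Val.ofBool (decide (∀ k, (T x).mem k (s x).toSet = true)) :=
  Det.forall_fin (p := fun x k => (T x).mem k (s x).toSet = true) fun k =>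
    (h.mem k hs).congr fun x _ => by simp

theorem contract_code (h : Reads σ inp T) {i : X → ℕ} {bs : X → Fin d → ℕ}
    (hi : Det σ inp fun x => .ofNat (i x)) (hbs : ∀ t, Det σ inp fun x => .ofNat (bs x t))
    (hmem : ∀ x, σ.dom x → i x ∈ (T x).items) :
    Det σ inp fun x => ((T x).contract (i x) (bs x)).code := by
  refine h.code_of ?_ (fun t => ?_) (fun x _ j hj => List.mem_of_mem_filter hj) fun _ _ => rfl
  · refine (Det.filter_map (p := fun x j => j ≠ i x ∧ ∀ k, (T x).mem k {i x, j} = true)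
      (h := fun _ j => .ofNat j) h.items (fun x _ => Val.toList_ofNatList _) ?_
      (Det.snd Det.input)).congr fun _ _ => rfl
    refine Det.and (Det.not (Det.eqNat (Det.snd Det.input) (Det.lift_elem hi)))
      (Det.restrict (Det.congr (h.elem.forall_mem
        (s := fun y => .node (.ofNat (i y.1)) (.node (.ofNat y.2) (.leaf 0)))
        ((Det.lift_elem hi).node ((Det.snd Det.input).node (Det.const _)))) fun y _ => ?_) _)
    simp [Val.toSet, Val.toList]
  · refine Det.map (h := fun x => binPair (((T x).contract (i x) (bs x)).mkc t).cap) (h.bins t)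
      (fun x _ => Val.toList_ofList _) ((Det.fst (Det.snd Det.input)).node ?_)
    refine (Det.ite (c := fun y => y.2 = bs y.1 t)
      (f := fun y => .leaf (((T y.1).mkc t).cap y.2 - ((T y.1).mkc t).weight (i y.1)))
      (h := fun y => .leaf (((T y.1).mkc t).cap y.2))
      (Det.eqNat (a := fun y : X × ℕ => y.2) (Det.fst (Det.snd Det.input))
        (Det.lift_elem (hbs t)))
      (Det.restrict (Det.sub (a := fun y : X × ℕ => ((T y.1).mkc t).cap y.2)
        (b := fun y : X × ℕ => ((T y.1).mkc t).weight (i y.1)) (Det.snd (Det.snd Det.input))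
        (Det.lift_elem (h.weight t hi hmem))) _)
      (Det.restrict (Det.snd (Det.snd Det.input)) _)).congr fun y _ => ?_
    simp only [Instance.contract]
    split_ifs <;> rfl

end Reads

/-! ### Computing the leveled instance -/

section

variable {N : ℕ} {σ : Setting X} {inp : X → Val} {cap : X → ℕ → ℚ} {l : X → List ℕ}

theorem Det.sortBins (hl : Det σ inp fun x => .ofList ((l x).map (binPair (cap x)))) :
    Det σ inp fun x => .ofList ((sortBins (cap x) (l x)).map (binPair (cap x))) := by
  refine Det.foldl (l := l) (ea := fun x => binPair (cap x))
    (eb := fun x acc => .ofList (acc.map (binPair (cap x))))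
    (f := fun x acc b => acc.filter (cap x b ≤ cap x ·) ++ b :: acc.filter (¬ cap x b ≤ cap x ·))
    (b₀ := fun _ => [])
    (g := fun x => (Val.ofList ((l x).map (binPair (cap x)))).size *
      ((Val.ofList ((l x).map (binPair (cap x)))).size + 1) + 2) hl
    (fun _ _ => Val.toList_ofList _) (Det.const (.ofList [])) ?_
    ((hl.polyBounded.mul (hl.polyBounded.add (.const 1))).add (.const 2)) fun x _ l₁ l₂ hx => ?_
  · have hle : Det ((σ.step l (fun x acc b => acc.filter (cap x b ≤ cap x ·) ++
          b :: acc.filter (¬ cap x b ≤ cap x ·)) fun _ => []).elem fun y => y.2.2)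
        (fun z => .node (.node (inp z.1.1) (.node (binPair (cap z.1.1) z.1.2.1)
          (.ofList (z.1.2.2.map (binPair (cap z.1.1)))))) (binPair (cap z.1.1) z.2))
        fun z => Val.ofBool (decide (cap z.1.1 z.1.2.1 ≤ cap z.1.1 z.2)) :=
      Det.le (Det.snd (Det.fst (Det.snd (Det.fst Det.input)))) (Det.snd (Det.snd Det.input))
    refine (Det.append
      (Det.filter_map (l := fun y : X × ℕ × List ℕ => y.2.2)
        (L := fun y : X × ℕ × List ℕ => .ofList (y.2.2.map (binPair (cap y.1))))
        (ea := fun y => binPair (cap y.1))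
        (p := fun y a => cap y.1 y.2.1 ≤ cap y.1 a) (h := fun y => binPair (cap y.1))
        (Det.snd (Det.snd Det.input)) (fun _ _ => Val.toList_ofList _) hle (Det.snd Det.input))
      (m := fun y : X × ℕ × List ℕ => binPair (cap y.1) y.2.1 ::
        (y.2.2.filter (¬ cap y.1 y.2.1 ≤ cap y.1 ·)).map (binPair (cap y.1)))
      (Det.node (Det.fst (Det.snd Det.input))
        (Det.filter_map (l := fun y : X × ℕ × List ℕ => y.2.2)
        (L := fun y : X × ℕ × List ℕ => .ofList (y.2.2.map (binPair (cap y.1))))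
        (ea := fun y => binPair (cap y.1))
          (p := fun y a => ¬ cap y.1 y.2.1 ≤ cap y.1 a) (h := fun y => binPair (cap y.1))
          (Det.snd (Det.snd Det.input)) (fun _ _ => Val.toList_ofList _) hle.not
          (Det.snd Det.input)))).congr fun y _ => by simp
  · have hp := sortBins_perm (cap x) l₁
    have hp' := (hp.map (binPair (cap x)))
    refine (Val.size_ofList_le (n := (Val.ofList ((l x).map (binPair (cap x)))).size)
      fun v hv => ?_).trans ?_
    · refine Val.size_le_size_ofList ?_
      rw [hx, List.map_append]
      exact List.mem_append_left _ (hp'.subset hv)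
    · have h1 := hp'.length_eq
      have h2 := Val.length_le_size_ofList ((l x).map (binPair (cap x)))
      have h3 : (l₁.map (binPair (cap x))).length ≤ ((l x).map (binPair (cap x))).length := by
        simp [hx]
      refine Nat.add_le_add_right (Nat.mul_le_mul_right _ ?_) _
      exact h1.le.trans (h3.trans h2)

/-- The code of a block of bins with their capacities. -/
def blockCode (cap : ℕ → ℚ) (B : List ℕ) : Val := .ofList (B.map (binPair cap))

/-- The code of a state of the division into blocks, where every bin comes with its capacity. -/
def BlockState.code (cap : ℕ → ℚ) (x : BlockState) : Val :=
  .node (.ofList (x.1.map (blockCode cap))) (.node (blockCode cap x.2.1)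
    (.node (.ofNat x.2.2.1) (.node (.ofNat x.2.2.2.1) (.ofNat x.2.2.2.2))))

theorem BlockState.Correct.size_code_le {x : BlockState} {l : List ℕ} (hN : 1 ≤ N)
    (h : x.Correct N l) {cap : ℕ → ℚ} {n : ℕ} (hn : ∀ b ∈ l, (binPair cap b).size ≤ n)
    (hl : l.length ≤ n) :
    (x.code cap).size ≤ n * (n * (n + 1) + 3) + n * (n + 1) + 2 * n + N ^ 2 + 18 := by
  obtain ⟨K, B, r, s, u⟩ := x
  obtain ⟨h1, h2, h3, h4, h5, h6, h7⟩ := h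
  dsimp only at *
  have hnat : ∀ m, (Val.ofNat m).size ≤ m + 2 := bitLength_natCast_le
  have hB' : ∀ B : List ℕ, B.length ≤ n → (∀ b ∈ B, b ∈ l) →
      (blockCode cap B).size ≤ n * (n + 1) + 2 := fun B hB hBl => by
    refine (Val.size_ofList_le (n := n) fun v hv => ?_).trans ?_
    · obtain ⟨b, hb, rfl⟩ := List.mem_map.1 hv
      exact hn b (hBl b hb)
    · rw [List.length_map]
      exact Nat.add_le_add_right (Nat.mul_le_mul_right _ hB) _
  have hlen : ((K.reverse.map List.reverse).flatten).length + B.length = l.length := by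
    rw [← h1]; simp
  have hBlen : B.length ≤ n := by omega
  have hBl : ∀ b ∈ B, b ∈ l := fun b hb => by rw [← h1]; simp [hb]
  have hKB : ∀ B ∈ K, B.length ≤ n ∧ ∀ b ∈ B, b ∈ l := fun B' hB' => by
    have hsub : B'.reverse.Sublist (K.reverse.map List.reverse).flatten :=
      List.sublist_flatten_of_mem (List.mem_map_of_mem (by simpa using hB'))
    refine ⟨?_, fun b hb => ?_⟩
    · have := hsub.length_le
      rw [List.length_reverse] at this
      omega
    · rw [← h1]
      exact List.mem_append_left _ (hsub.subset (by simpa using hb))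
  have hKlen : (K.map List.length).sum = ((K.reverse.map List.reverse).flatten).length := by
    simp [List.length_flatten, Function.comp_def, List.sum_reverse]
  have hKsum : ((List.range K.length).map fun j => N ^ (j / N ^ 2)).sum =
      (K.map List.length).sum := by
    rw [h2, List.sum_reverse]
  have hKn : K.length ≤ (K.map List.length).sum := by
    rw [← hKsum]
    have := List.card_nsmul_le_sum ((List.range K.length).map fun j => N ^ (j / N ^ 2)) 1
      fun m hm => by
        obtain ⟨j, -, rfl⟩ := List.mem_map.1 hm
        exact Nat.pow_pos hN
    simpa using this
  have hs : s ≤ n + 1 := by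
    have := pow_div_le_sum hN K.length
    rw [hKsum, hKlen, ← h3] at this
    rcases this with h | h
    · omega
    · have : s ≤ N * s := Nat.le_mul_of_pos_left _ hN
      omega
  have hu : u ≤ N ^ 2 := h5 ▸ Nat.le_add_right _ _
  have hK : (Val.ofList (K.map (blockCode cap))).size ≤ n * (n * (n + 1) + 3) + 2 := by
    refine (Val.size_ofList_le (n := n * (n + 1) + 2) fun v hv => ?_).trans ?_
    · obtain ⟨B, hB, rfl⟩ := List.mem_map.1 hv
      exact hB' B (hKB B hB).1 (hKB B hB).2
    · rw [List.length_map]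
      exact Nat.add_le_add_right (Nat.mul_le_mul_right _ (by omega)) _
  have h8 := hB' B hBlen hBl
  have h9 := hnat r
  have h10 := hnat s
  have h11 := hnat u
  simp only [BlockState.code, Val.size_node]
  omega

theorem Det.blockState (hN : 1 ≤ N)
    (hl : Det σ inp fun x => .ofList ((l x).map (binPair (cap x)))) :
    Det σ inp fun x => (blockState N (l x)).code (cap x) := by
  have hg := hl.polyBounded
  refine Det.foldl (l := l) (ea := fun x => binPair (cap x))
    (eb := fun x => BlockState.code (cap x)) (f := fun _ => blockStep N)
    (b₀ := fun _ => ([], [], 1, 1, N ^ 2)) (g := fun x => _) hl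
    (fun _ _ => Val.toList_ofList _)
    ((Det.const (BlockState.code (fun _ => 0) ([], [], 1, 1, N ^ 2))).congr fun _ _ => rfl) ?_
    (((((hg.mul ((hg.mul (hg.add (.const 1))).add (.const 3))).add
      (hg.mul (hg.add (.const 1)))).add ((PolyBounded.const 2).mul hg)).add (.const (N ^ 2))).add
      (.const 18)) fun x _ l₁ l₂ hx => ?_
  · set τ := σ.step l (fun _ => blockStep N) fun _ => ([], [], 1, 1, N ^ 2)
    set inp' : X × ℕ × BlockState → Val := fun y => .node (inp y.1)
      (.node (binPair (cap y.1) y.2.1) (BlockState.code (cap y.1) y.2.2))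
    have hin : Det τ inp' fun y => .node (binPair (cap y.1) y.2.1) (y.2.2.code (cap y.1)) :=
      Det.snd Det.input
    have hb : Det τ inp' fun y => binPair (cap y.1) y.2.1 := hin.fst
    have hK : Det τ inp' fun y => .ofList (y.2.2.1.map (blockCode (cap y.1))) := hin.snd.fst
    have hB : Det τ inp' fun y => blockCode (cap y.1) y.2.2.2.1 := hin.snd.snd.fst
    have hr : Det τ inp' fun y => .ofNat y.2.2.2.2.1 := hin.snd.snd.snd.fst
    have hs : Det τ inp' fun y => .ofNat y.2.2.2.2.2.1 := hin.snd.snd.snd.snd.fst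
    have hu : Det τ inp' fun y => .ofNat y.2.2.2.2.2.2 := hin.snd.snd.snd.snd.snd
    have hbB := hb.node hB
    have hKB := hbB.node hK
    have hle1 : ∀ {Z : Type} {τ : Setting Z} {inp' : Z → Val} (a : Z → ℕ),
        Det τ inp' (fun z => .ofNat (a z)) →
        Det τ inp' fun z => Val.ofBool (decide (a z ≤ 1)) := fun {_ _ _} a h =>
      (Det.le (a := fun z => (a z : ℚ)) (b := fun _ => 1) h (Det.const _)).congr fun z _ => by
        simp
    have hsub1 : ∀ {Z : Type} {τ : Setting Z} {inp' : Z → Val} (a : Z → ℕ),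
        Det (τ.restrict fun z => ¬ a z ≤ 1) inp' (fun z => .ofNat (a z)) →
        Det (τ.restrict fun z => ¬ a z ≤ 1) inp' fun z => .ofNat (a z - 1) := fun {_ _ _} a h =>
      (Det.sub (a := fun z => (a z : ℚ)) (b := fun _ => 1) h (Det.const _)).congr fun z hz => by
        have := hz.2
        rw [Val.ofNat, Nat.cast_sub (by omega), Nat.cast_one]
    have hsN := Det.mul (a := fun y : X × ℕ × BlockState => (y.2.2.2.2.2.1 : ℚ))
      (b := fun _ => (N : ℚ)) hs (Det.const _)
    have hr1 := hle1 (fun y : X × ℕ × BlockState => y.2.2.2.2.1) hr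
    have hu1 := hle1 (fun y : X × ℕ × BlockState => y.2.2.2.2.2.2) hu
    have hr' := hsub1 (fun y : X × ℕ × BlockState => y.2.2.2.2.1) (hr.restrict _)
    have hu' := hsub1 (fun y : X × ℕ × BlockState => y.2.2.2.2.2.2)
      ((hu.restrict fun y => y.2.2.2.2.1 ≤ 1).restrict _)
    refine (Det.ite (c := fun y => y.2.2.2.2.1 ≤ 1) hr1
      (Det.ite (c := fun y => y.2.2.2.2.2.2 ≤ 1) (hu1.restrict _)
        (((hKB.node ((Det.const (.ofList [])).node (hsN.node (hsN.node
          (Det.const (.ofNat (N ^ 2))))))).restrict _).restrict _)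
        (Det.node ((hKB.restrict _).restrict _) (Det.node (Det.const (.ofList []))
          (Det.node ((hs.restrict _).restrict _)
            (Det.node ((hs.restrict _).restrict _) hu')))))
      (Det.node (hK.restrict _) (Det.node (hbB.restrict _)
        (Det.node hr' ((hs.node hu).restrict _))))).congr fun y _ => ?_
    obtain ⟨x, b, K, B, r, s, u⟩ := y
    simp only [blockStep]
    split_ifs <;> simp [BlockState.code, blockCode, Val.ofList, Val.ofNat]
  · have hmem : ∀ b ∈ l₁, (binPair (cap x) b).size ≤
        (Val.ofList ((l x).map (binPair (cap x)))).size := fun b hb =>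
      Val.size_le_size_ofList (List.mem_map_of_mem (by simp [hx, hb]))
    refine (blockState_correct hN l₁).size_code_le hN hmem ?_
    have := Val.length_le_size_ofList ((l x).map (binPair (cap x)))
    have h3 : l₁.length ≤ ((l x).map (binPair (cap x))).length := by simp [hx]
    omega

theorem Det.blocks (hN : 1 ≤ N) (hl : Det σ inp fun x => .ofList ((l x).map (binPair (cap x)))) :
    Det σ inp fun x => .ofList ((blocks N (l x)).map (blockCode (cap x))) :=
  (Det.reverse (l := fun x => (MKCP.blockState N (l x)).1.map (blockCode (cap x)))
    (Det.fst (Det.blockState hN hl))).congr fun x _ => by rw [MKCP.blocks, List.map_reverse]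

end

namespace Reads

variable {d N ξ : ℕ} {σ : Setting X} {inp : X → Val} {T : X → Instance d}

theorem levelPartition (h : Reads σ inp T) (hN : 1 ≤ N) (t : Fin d) : Det σ inp fun x =>
    .ofList (((T x).levelPartition N t).map (blockCode ((T x).mkc t).cap)) :=
  Det.blocks hN (Det.sortBins (h.bins t))

theorem partitionCode (h : Reads σ inp T) (hN : 1 ≤ N) :
    Det σ inp fun x => Instance.partitionCode ((T x).levelPartition N) :=
  Det.ofFn (h := fun x t => .ofList (((T x).levelPartition N t).map Val.ofNatList)) fun t =>
    Det.map (h := fun _ B => Val.ofNatList B) (h.levelPartition hN t)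
      (fun _ _ => Val.toList_ofList _)
      ((Det.ofNatList_map (l := fun y : X × List ℕ => y.2)
        (L := fun y => blockCode ((T y.1).mkc t).cap y.2) (h := fun _ b => b) (Det.snd Det.input)
        (fun _ _ => Val.toList_ofList _) (Det.fst (Det.snd Det.input))).congr fun _ _ => by simp)

theorem level_bins (h : Reads σ inp T) (hN : 1 ≤ N) (t : Fin d)
    (hnd : ∀ x, σ.dom x → ((T x).mkc t).bins.Nodup) : Det σ inp fun x =>
      .ofList ((((T x).level N ξ).mkc t).bins.map (binPair (((T x).level N ξ).mkc t).cap)) := by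
  refine (Det.flatMap (h := fun x B => B.map fun b =>
    .node (.ofNat b) (.leaf (((T x).mkc t).cap (B.headD 0)))) (h.levelPartition hN t)
    (fun _ _ => Val.toList_ofList _)
    (Det.map (l := fun y : X × List ℕ => y.2)
      (L := fun y => blockCode ((T y.1).mkc t).cap y.2) (h := fun y b =>
      .node (.ofNat b) (.leaf (((T y.1).mkc t).cap (y.2.headD 0)))) (Det.snd Det.input)
      (fun _ _ => Val.toList_ofList _)
      ((Det.fst (Det.snd Det.input)).node ((Det.snd (Det.fst (Det.snd
        (Det.fst Det.input)))).congr fun y hy => ?_)))).congr fun x hx => ?_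
  · obtain ⟨⟨x, B⟩, b⟩ := y
    cases B with
    | nil => exact absurd hy.2 (by simp)
    | cons a B => rfl
  · rw [List.flatMap_def]
    change _ = Val.ofList (((blocks N (sortBins _ _)).flatten).map _)
    rw [List.map_flatten]
    congr 2
    refine List.map_congr_left fun B hB => List.map_congr_left fun b hb => ?_
    have hnd := nodup_flatten_blocks hN
      ((sortBins_perm ((T x).mkc t).cap ((T x).mkc t).bins).nodup_iff.2 (hnd x hx))
    change _ = Val.node _ (.leaf (blockCap _ _ _))
    rw [blockCap_eq hnd hB hb]

theorem level_code (h : Reads σ inp T) (hN : 1 ≤ N)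
    (hnd : ∀ x, σ.dom x → ∀ t, ((T x).mkc t).bins.Nodup) :
    Det σ inp fun x => ((T x).level N ξ).code := by
  refine h.code_of ?_ (fun t => h.level_bins hN t fun x hx => hnd x hx t)
    (fun x _ j hj => List.mem_of_mem_filter hj) fun _ _ => rfl
  refine (Det.filter_map (p := fun x i => (ξ : ℚ) * ((T x).f {i} - (T x).f ∅) ≤ (T x).f ∅)
    (h := fun _ j => .ofNat j) h.items (fun x _ => Val.toList_ofNatList _) ?_
    (Det.snd Det.input)).congr fun _ _ => rfl
  have h0 : Det (σ.elem fun x => (T x).items) (fun y => .node (inp y.1) (.ofNat y.2))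
      fun y => .leaf ((T y.1).f ∅) :=
    h.elem.value (s := fun _ => .leaf 0) (Det.const _) fun _ _ => Finset.empty_subset _
  have h1 : Det (σ.elem fun x => (T x).items) (fun y => .node (inp y.1) (.ofNat y.2))
      fun y => .leaf ((T y.1).f {y.2}) :=
    (h.elem.value (s := fun y => .node (.ofNat y.2) (.leaf 0))
      ((Det.snd Det.input).node (Det.const _)) fun y hy => by
        simpa [Val.toSet, Val.toList] using hy.2).congr fun y _ => by simp [Val.toSet, Val.toList]
  exact Det.le (Det.mul (a := fun _ => (ξ : ℚ)) (Det.const _) (h1.sub h0)) h0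

/-! ### Computing outputs -/

theorem restrictOutput (h : Reads σ inp T) (hN : 1 ≤ N)
    (hnd : ∀ x, σ.dom x → ∀ t, ((T x).mkc t).bins.Nodup) {v : X → Val} (hv : Det σ inp v) :
    Det σ inp fun x => Instance.restrictOutput N (T x) (v x) := by
  refine hv.fst.node (Det.ofFn (h := fun x (t : Fin d) => .ofList
    (((v x).snd.toList.getD t (.leaf 0)).toList.filter fun p =>
      p.fst.label ∈ (((T x).mkc t).level N).bins)) fun t => ?_)
  refine (Det.filter_map (l := fun x => ((v x).snd.toList.getD t (.leaf 0)).toList)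
    (L := fun x => (v x).snd.toList.getD t (.leaf 0))
    (ea := fun _ p => p) (h := fun _ p => p)
    (p := fun x p => ∃ b ∈ (((T x).mkc t).level N).bins, b = p.fst.label)
    (hv.snd.getD t) (fun _ _ => by simp) ?_ (Det.snd Det.input)).congr fun x _ => by simp
  have hbins : Det σ inp fun x => .ofList ((((T x).mkc t).level N).bins.map
      (binPair (((T x).mkc t).level N).cap)) :=
    h.level_bins (ξ := 0) hN t fun x hx => hnd x hx t
  exact Det.any (l := fun y : X × Val => (((T y.1).mkc t).level N).bins)
    (L := fun y => .ofList ((((T y.1).mkc t).level N).bins.map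
      (binPair (((T y.1).mkc t).level N).cap)))
    (ea := fun y => binPair (((T y.1).mkc t).level N).cap)
    (p := fun y b => b = y.2.fst.label) (Det.lift_elem hbins)
    (fun _ _ => Val.toList_ofList _)
    (Det.eqNat (a := fun z : (X × Val) × ℕ => z.2) (Det.fst (Det.snd Det.input))
      (Det.label (Det.fst (Det.snd (Det.fst Det.input)))))

end Reads

theorem Det.extendOutput {d : ℕ} {σ : Setting X} {inp : X → Val} {i : X → ℕ} {bs : X → Fin d → ℕ}
    {v : X → Val} (hi : Det σ inp fun x => .ofNat (i x))
    (hbs : ∀ t, Det σ inp fun x => .ofNat (bs x t)) (hv : Det σ inp v) :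
    Det σ inp fun x => Instance.extendOutput (i x) (bs x) (v x) :=
  (hi.node hv.fst).node (Det.ofFn (h := fun x (t : Fin d) => .node
    (.node (.ofNat (bs x t)) (.ofNat (i x))) ((v x).snd.toList.getD t (.leaf 0)))
    fun t => ((hbs t).node hi).node (hv.snd.getD t))

/-! ### Enumerating the placements of one item -/

/-- All tuples whose entries are elements of the given lists. -/
def tuples : {n : ℕ} → (Fin n → List ℕ) → List (Fin n → ℕ)
  | 0, _ => [Fin.elim0]
  | _ + 1, L => (L 0).flatMap fun a => (tuples (Fin.tail L)).map (Fin.cons a)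

theorem mem_tuples {n : ℕ} {L : Fin n → List ℕ} {e : Fin n → ℕ} :
    e ∈ tuples L ↔ ∀ t, e t ∈ L t := by
  induction n with
  | zero => simp [tuples, eq_iff_true_of_subsingleton]
  | succ n ih =>
    simp only [tuples, List.mem_flatMap, List.mem_map, ih, Fin.forall_fin_succ]
    constructor
    · rintro ⟨a, ha, e, he, rfl⟩
      exact ⟨ha, he⟩
    · rintro ⟨h0, h1⟩
      exact ⟨e 0, h0, Fin.tail e, h1, Fin.cons_self_tail e⟩

/-- The code of a tuple: the list of its entries. -/
def tupleCode {n : ℕ} (e : Fin n → ℕ) : Val := .ofList (List.ofFn fun t => .ofNat (e t))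

theorem Det.tuples {n : ℕ} {σ : Setting X} {inp : X → Val} {L : X → Fin n → List ℕ}
    (hL : ∀ t, Det σ inp fun x => .ofNatList (L x t)) :
    Det σ inp fun x => .ofList ((tuples (L x)).map tupleCode) := by
  induction n with
  | zero =>
    refine (Det.const (.ofList [.ofList []])).congr fun x _ => ?_
    simp [MKCP.tuples, tupleCode]
  | succ n ih =>
    have h := ih (L := fun x => Fin.tail (L x)) fun t => hL t.succ
    refine (Det.flatMap (h := fun x a => (MKCP.tuples (Fin.tail (L x))).map fun e =>
      .node (.ofNat a) (tupleCode e)) (hL 0) (fun _ _ => Val.toList_ofNatList _)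
      (Det.map (l := fun y => MKCP.tuples (Fin.tail (L y.1))) (ea := fun _ e => tupleCode e)
        (h := fun y e => .node (.ofNat y.2) (tupleCode e)) (Det.lift_elem h)
        (fun _ _ => Val.toList_ofList _)
        ((Det.snd (Det.fst Det.input)).node (Det.snd Det.input)))).congr fun x _ => ?_
    simp [MKCP.tuples, List.map_flatMap, Function.comp_def, tupleCode, List.ofFn_succ, Val.ofList]

/-! ### Computations with contracted oracles -/

/-- A computation with contracted oracles is simulated with the given oracles, when the contracted
item comes with the input. -/
theorem Computes.contract {σ : Setting X} {inp : X → Val} {out : X → CoinTree Val}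
    (h : Computes σ inp out) {τ : Setting Y} (φ : Y → X) (i : Y → Val) (hc : σ.coins → τ.coins)
    (H : ∀ y, τ.dom y → σ.dom (φ y) ∧ σ.orc (φ y) = (τ.orc y).contract (i y).label ∧
      σ.extra (φ y) ≤ τ.extra y) :
    Computes τ (fun y => .node (i y) (inp (φ y))) fun y => out (φ y) := by
  obtain ⟨P, hP, g, ⟨p, hp⟩, H'⟩ := h
  obtain ⟨K, hK⟩ := exec_contract P
  refine ⟨P.contract, hP.imp hc Prog.Deterministic.contract,
    fun y => K * ((i y).size + 1) * p.eval ((inp (φ y)).size + τ.extra y), ?_, fun y hy => ?_⟩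
  · refine PolyBounded.mul (.mul (.const K) (.add ?_ (.const 1))) (.eval (.add ?_ .extra) p) <;>
    · refine PolyBounded.inp_size.mono fun y _ => ?_
      rw [Val.size_node]
      omega
  · obtain ⟨hy', ho, he⟩ := H y hy
    obtain ⟨E, hE, hE', hEg⟩ := H' _ hy'
    rw [ho] at hE
    obtain ⟨D, hD, hED⟩ := hK _ _ _ _ hE
    refine ⟨D, hD, (hED.map_eq fun a b hab => hab.1).symm.trans hE', fun z hz => ?_⟩
    obtain ⟨x, hx, hxz⟩ := hED.exists_left hz
    exact hxz.2.trans (Nat.mul_le_mul_left _ ((hEg x hx).trans ((hp _ hy').trans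
      (eval_le_eval p (Nat.add_le_add_left he _)))))

/-- The result of a computation is processed together with the initial input. -/
theorem Computes.map_input {σ : Setting X} {inp : X → Val} {out : X → CoinTree Val}
    {f : X → Val → Val} (h₁ : Computes σ inp out)
    (h₂ : Det (σ.pull Prod.fst fun y : X × Val => σ.dom y.1 ∧ y.2 ∈ (out y.1).leaves)
      (fun y => .node (inp y.1) y.2) fun y => f y.1 y.2) :
    Computes σ inp fun x => (out x).map (f x) :=
  Computes.bind (enc := fun x v => .node (inp x) v) (Computes.pair_left Det.input h₁) h₂

namespace Instance

variable {d N ξ : ℕ} {T : Instance d} {F : FunctionType} {C : ConstraintType} {r : Prop} {c : ℝ}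

/-- The circumstances of algorithms that get an instance as input. -/
def setting (d : ℕ) (r : Prop) (F : FunctionType) (C : ConstraintType) : Setting (Instance d) :=
  ⟨r, Valid F C, oracles, valueSize⟩

theorem reads : Reads (setting d r F C) code fun T => T :=
  ⟨Det.input, fun _ _ => rfl, fun _ _ => le_rfl⟩

/-- The tree `out T` of outputs is computed in polynomial time, all of its leaves are solutions, and
its expected value compares to that of any solution all of whose items, after a guess `G` of at
most `k` of them, gain little. -/
structure Approximates (r : Prop) (F : FunctionType) (C : ConstraintType) (N ξ : ℕ) (c : ℝ) (k : ℕ)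
    (out : Instance d → CoinTree Val) : Prop where
  computes : Computes (setting d r F C) code out
  isSolution : ∀ T : Instance d, T.Valid F C → ∀ x ∈ (out T).leaves,
    T.IsSolution (outSet x) (outAssignment x)
  le_expect : ∀ T : Instance d, T.Valid F C → ∀ S A, T.IsSolution S A → ∀ G ⊆ S, G.card ≤ k →
    (∀ i ∈ S \ G, (ξ : ℚ) * (T.f (insert i G) - T.f G) ≤ T.f G) →
    c * (1 - 1 / (N : ℝ)) ^ d * (T.f S : ℝ) ≤ ((out T).expect fun x => T.f (outSet x) : ℚ)

/-! ### The reduction without guessing -/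

/-- The algorithm for restricted instances is applied to the leveled instance.  If some constraint
has no bins, then there is no leveled partition, but the empty set is the only solution. -/
theorem exists_approximates_zero (hN : 1 ≤ N) (hξ : 1 ≤ ξ) (hc₀ : 0 ≤ c) (hc₁ : c ≤ 1)
    {A : Prog} (hr : r ∨ A.Deterministic) (hA : IsRestrictedApprox F C N ξ d c A) :
    ∃ out : Instance d → CoinTree Val, Approximates r F C N ξ c 0 out := by
  obtain ⟨p, hp⟩ := hA
  set inpA : Instance d → Val := fun T =>
    .node (T.level N ξ).code (partitionCode (T.levelPartition N)) with hinpA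
  have hsolved : ∀ T : Instance d, T.Valid F C → (∀ t, (T.mkc t).bins ≠ []) →
      (T.level N ξ).SolvedBy A (inpA T) (p.eval ((inpA T).size + (T.level N ξ).valueSize)) c :=
    fun T hT hb => hp _ _ (hT.level hN) (hT.isLeveled hN hb) (hT.hasSmallItems hN hξ)
  refine ⟨fun T => if ∀ t, (T.mkc t).bins ≠ [] then
    ((outcomes T.oracles A (inpA T)).map Prod.fst).map (restrictOutput N T)
    else .ret emptyOutput, ?_, fun T hT x hx => ?_, fun T hT S B hS G hG hG0 hsmall => ?_⟩
  · refine Computes.ite (Det.forall_fin (p := fun (T : Instance d) t => (T.mkc t).bins ≠ [])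
      fun t => (Det.isNode (reads.bins t)).congr fun T _ => ?_) (Computes.map_input ?_ ?_)
      (Det.const emptyOutput)
    · cases (T.mkc t).bins <;> simp [Val.ofList, Val.isNode]
    · refine Computes.seq (mid := inpA) (((reads.level_code hN fun T hT => hT.bins_nodup).node
        (reads.partitionCode hN)).restrict _) ?_
      refine Computes.transfer (X := Instance d × (Fin d → List (List ℕ)))
        (σ := ⟨r, fun y => y.1.Valid F C ∧ y.1.IsLeveled N y.2 ∧ y.1.HasSmallItems ξ,
          fun y => y.1.oracles, fun y => y.1.valueSize⟩)
        (inp := fun y => .node y.1.code (partitionCode y.2))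
        (out := fun y => (outcomes y.1.oracles A (.node y.1.code (partitionCode y.2))).map Prod.fst)
        ⟨A, hr, _, ⟨p, fun _ _ => le_rfl⟩, fun y hy => ?_⟩ id fun T hT =>
          ⟨(T.level N ξ, T.levelPartition N), ⟨hT.1.level hN, hT.1.isLeveled hN hT.2,
            hT.1.hasSmallItems hN hξ⟩, rfl,
            show (T.level N ξ).valueSize ≤ T.valueSize from valueSize_level_le, rfl, rfl⟩
      obtain ⟨D, hD, hD', -⟩ := hp y.1 y.2 hy.1 hy.2.1 hy.2.2
      exact ⟨D, hD, (congrArg (CoinTree.map Prod.fst) hD.outcomes_eq).symm,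
        fun z hz => (hD' z hz).1⟩
    · exact (((reads.restrict _).pull Prod.fst (fun _ hy => hy.1)
        (Det.fst Det.input)).restrictOutput hN (fun y hy => hy.1.1.bins_nodup)
        (Det.snd Det.input)).congr fun _ _ => rfl
  · split_ifs at hx with hb
    · obtain ⟨D, hD, hD', -⟩ := hsolved T hT hb
      have hD : Exec T.oracles A (inpA T) D := hD
      rw [hD.outcomes_eq] at hx
      simp only [CoinTree.mem_leaves_map] at hx
      obtain ⟨_, ⟨y, hy, rfl⟩, rfl⟩ := hx
      exact hT.isSolution_restrictOutput hN (hD' y hy).2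
    · simp only [CoinTree.leaves_ret, List.mem_singleton] at hx
      subst hx
      exact hT.isSolution_emptyOutput
  · obtain rfl : G = ∅ := by simpa using hG0
    have hN' : (0 : ℝ) ≤ 1 - 1 / (N : ℝ) ∧ 1 - 1 / (N : ℝ) ≤ 1 := by
      have : (1 : ℝ) ≤ N := by exact_mod_cast hN
      refine ⟨?_, ?_⟩
      · rw [sub_nonneg, div_le_one (by linarith)]
        exact this
      · rw [sub_le_self_iff]
        positivity
    split_ifs with hb
    · obtain ⟨D, hD, -, hD'⟩ := hsolved T hT hb
      have hD : Exec T.oracles A (inpA T) D := hD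
      obtain ⟨v, hv⟩ := (hT.level (ξ := ξ) hN).exists_isOpt
      obtain ⟨S', B', hS', hf⟩ := hT.exists_isSolution_level (ξ := ξ) hN hS (by simpa using hsmall)
      have h1 : T.f S' ≤ v := hv.2 ⟨S', B', hS', rfl⟩
      have h2 : (((1 - 1 / (N : ℚ)) ^ d * T.f S : ℚ) : ℝ) ≤ v := by exact_mod_cast hf.trans h1
      push_cast at h2
      rw [hD.outcomes_eq, CoinTree.expect_map, CoinTree.expect_map]
      refine le_trans ?_ (hD' v hv)
      rw [mul_assoc]
      exact mul_le_mul_of_nonneg_left h2 hc₀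
    · have hS0 : S = ∅ := by
        push Not at hb
        obtain ⟨t, ht⟩ := hb
        rw [(hS.2.2 t).2, ht]
        simp
      subst hS0
      have h0 : (0 : ℝ) ≤ T.f ∅ := by exact_mod_cast hT.f_empty_nonneg
      simp only [CoinTree.expect_ret, outSet_emptyOutput]
      exact mul_le_of_le_one_left h0
        (mul_le_one₀ hc₁ (pow_nonneg hN'.1 d) (pow_le_one₀ hN'.1 hN'.2))

/-! ### Guessing one more item -/

instance (i : ℕ) (bs : Fin d → ℕ) : Decidable (T.CanPlace i bs) :=
  inferInstanceAs (Decidable (_ ∧ _ ∧ _))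

/-- The better one of two outputs. -/
def better (T : Instance d) (x y : Val) : Val := if T.f (outSet x) ≤ T.f (outSet y) then y else x

/-- All pairs of an item and a tuple of bins, one for each constraint. -/
def placements (T : Instance d) : List (Fin (d + 1) → ℕ) :=
  tuples (Fin.cons T.items fun t => (T.mkc t).bins : Fin (d + 1) → List ℕ)

theorem mem_placements {e : Fin (d + 1) → ℕ} :
    e ∈ T.placements ↔ e 0 ∈ T.items ∧ ∀ t, Fin.tail e t ∈ (T.mkc t).bins := by
  rw [placements, mem_tuples, Fin.forall_fin_succ]
  rfl

/-- The outputs that place the item `e 0` into the bins `e 1, …, e d` and leave the rest to an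
algorithm. -/
def placed (out : Instance d → CoinTree Val) (T : Instance d) (e : Fin (d + 1) → ℕ) :
    CoinTree Val :=
  (out (T.contract (e 0) (Fin.tail e))).map (extendOutput (e 0) (Fin.tail e))

/-- Replaces the output `b` by one that places the item `e 0` into the bins `e 1, …, e d`, if this
is possible and better. -/
def tryPlacement (out : Instance d → CoinTree Val) (T : Instance d) (b : Val)
    (e : Fin (d + 1) → ℕ) : CoinTree Val :=
  if T.CanPlace (e 0) (Fin.tail e) then (placed out T e).map (T.better b) else .ret b

/-- The best one among the output of an algorithm and its outputs after each placement of one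
item. -/
def guessItem (out : Instance d → CoinTree Val) (T : Instance d) : CoinTree Val :=
  (out T).bind fun v => CoinTree.foldl (tryPlacement out T) v T.placements

theorem le_better_left (x y : Val) : T.f (outSet x) ≤ T.f (outSet (T.better x y)) := by
  rw [better]
  split_ifs with h
  · exact h
  · exact le_rfl

theorem le_better_right (x y : Val) : T.f (outSet y) ≤ T.f (outSet (T.better x y)) := by
  rw [better]
  split_ifs with h
  · exact le_rfl
  · exact (not_le.1 h).le

theorem better_eq (x y : Val) : T.better x y = x ∨ T.better x y = y := by
  rw [better]
  split_ifs <;> simp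

namespace Approximates

variable {k : ℕ} {out : Instance d → CoinTree Val}

theorem isSolution_placed (h : Approximates r F C N ξ c k out) (hT : T.Valid F C)
    {e : Fin (d + 1) → ℕ} (he : T.CanPlace (e 0) (Fin.tail e)) :
    ∀ x ∈ (placed out T e).leaves, T.IsSolution (outSet x) (outAssignment x) := fun x hx => by
  obtain ⟨y, hy, rfl⟩ := CoinTree.mem_leaves_map.1 hx
  exact isSolution_extendOutput he (h.isSolution _ (hT.contract he) y hy)

theorem isSolution_tryPlacement (h : Approximates r F C N ξ c k out) (hT : T.Valid F C)
    (e : Fin (d + 1) → ℕ) {b : Val} (hb : T.IsSolution (outSet b) (outAssignment b)) :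
    ∀ x ∈ (tryPlacement out T b e).leaves, T.IsSolution (outSet x) (outAssignment x) := by
  intro x hx
  rw [tryPlacement] at hx
  split_ifs at hx with he
  · obtain ⟨y, hy, rfl⟩ := CoinTree.mem_leaves_map.1 hx
    rcases T.better_eq b y with hby | hby <;> rw [hby]
    · exact hb
    · exact h.isSolution_placed hT he y hy
  · simp only [CoinTree.leaves_ret, List.mem_singleton] at hx
    rwa [hx]

theorem le_of_mem_tryPlacement (e : Fin (d + 1) → ℕ) {b : Val} :
    ∀ x ∈ (tryPlacement out T b e).leaves, T.f (outSet b) ≤ T.f (outSet x) := by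
  intro x hx
  rw [tryPlacement] at hx
  split_ifs at hx with he
  · obtain ⟨y, hy, rfl⟩ := CoinTree.mem_leaves_map.1 hx
    exact le_better_left b y
  · simp only [CoinTree.leaves_ret, List.mem_singleton] at hx
    rw [hx]

theorem isSolution_guessItem (h : Approximates r F C N ξ c k out) (hT : T.Valid F C) :
    ∀ x ∈ (guessItem out T).leaves, T.IsSolution (outSet x) (outAssignment x) := by
  intro x hx
  obtain ⟨v, hv, hx⟩ := CoinTree.mem_leaves_bind.1 hx
  exact CoinTree.foldl_invariant (P := fun b => T.IsSolution (outSet b) (outAssignment b))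
    (fun e _ b hb => h.isSolution_tryPlacement hT e hb) (h.isSolution T hT v hv) x hx

theorem le_expect_guessItem (h : Approximates r F C N ξ c k out) (hT : T.Valid F C)
    {S : Finset ℕ} {A : Fin d → ℕ → Finset ℕ} (hS : T.IsSolution S A) {G : Finset ℕ} (hG : G ⊆ S)
    (hk : G.card ≤ k + 1)
    (hsmall : ∀ i ∈ S \ G, (ξ : ℚ) * (T.f (insert i G) - T.f G) ≤ T.f G) :
    c * (1 - 1 / (N : ℝ)) ^ d * (T.f S : ℝ) ≤
      ((guessItem out T).expect fun x => T.f (outSet x) : ℚ) := by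
  have hfold := fun (v : Val) (hv : v ∈ (out T).leaves) => CoinTree.le_expect_foldl
    (f := tryPlacement out T) (l := T.placements) (g := fun x => T.f (outSet x))
    (P := fun b => T.IsSolution (outSet b) (outAssignment b))
    (fun e _ b hb => h.isSolution_tryPlacement hT e hb)
    (fun e _ b _ => le_of_mem_tryPlacement e) (h.isSolution T hT v hv)
  rw [guessItem, CoinTree.expect_bind]
  rcases G.eq_empty_or_nonempty with rfl | ⟨i, hi⟩
  · refine (h.le_expect T hT S A hS ∅ hG (by simp) hsmall).trans ?_
    exact_mod_cast CoinTree.expect_mono fun v hv => (hfold v hv).1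
  · obtain ⟨bs, A', hbs, hS'⟩ := hS.contract hT (hG hi)
    have hiS : insert i (S.erase i) = S := Finset.insert_erase (hG hi)
    have hiG : insert i (G.erase i) = G := Finset.insert_erase hi
    have h1 := h.le_expect _ (hT.contract hbs) _ _ hS' (G.erase i) (Finset.erase_subset_erase i hG)
      (by rw [Finset.card_erase_of_mem hi]; omega) fun j hj => by
        simp only [Finset.mem_sdiff, Finset.mem_erase, not_and] at hj
        have hjG : j ∉ G := fun hjG => hj.2 hj.1.1 hjG
        have := hsmall j (Finset.mem_sdiff.2 ⟨hj.1.2, hjG⟩)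
        simp only [Instance.contract]
        rwa [Finset.insert_comm, hiG]
    simp only [Instance.contract] at h1
    rw [hiS] at h1
    refine h1.trans ?_
    norm_cast
    rw [← CoinTree.expect_const (out T)
      (CoinTree.expect (fun x => T.f (insert i (outSet x))) _)]
    refine CoinTree.expect_mono fun v hv => (hfold v hv).2 (Fin.cons i bs)
      (mem_placements.2 ⟨hbs.1, fun t => (hbs.2.2 t).1⟩) _ fun b _ => ?_
    rw [tryPlacement, if_pos (by simpa using hbs), CoinTree.expect_map, placed,
      CoinTree.expect_map]
    simp only [Fin.cons_zero, Fin.tail_cons]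
    refine CoinTree.expect_mono fun x _ => ?_
    rw [← outSet_extendOutput i bs x]
    exact le_better_right b _

end Approximates

end Instance

theorem Reads.canPlace {d : ℕ} {σ : Setting X} {inp : X → Val} {T : X → Instance d}
    (h : Reads σ inp T) {i : X → ℕ} {bs : X → Fin d → ℕ} (hi : Det σ inp fun x => .ofNat (i x))
    (hbs : ∀ t, Det σ inp fun x => .ofNat (bs x t)) (him : ∀ x, σ.dom x → i x ∈ (T x).items)
    (hbm : ∀ x, σ.dom x → ∀ t, bs x t ∈ ((T x).mkc t).bins) :
    Det σ inp fun x => Val.ofBool (decide ((T x).CanPlace (i x) (bs x))) := by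
  refine (Det.and (b := fun x => ∀ k, (T x).mem k {i x} = true)
    (c := fun x => ∀ t, ((T x).mkc t).weight (i x) ≤ ((T x).mkc t).cap (bs x t))
    ((h.forall_mem (s := fun x => .node (.ofNat (i x)) (.leaf 0)) (hi.node (Det.const _))).congr
      fun x _ => by simp [Val.toSet, Val.toList])
    (Det.restrict (Det.forall_fin (p := fun x t =>
      ((T x).mkc t).weight (i x) ≤ ((T x).mkc t).cap (bs x t)) fun t =>
        Det.le (h.weight t hi him) (h.cap t (hbs t) fun x hx => hbm x hx t)) _)).congr
    fun x hx => ?_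
  have h1 := him x hx
  have h2 := hbm x hx
  simp [Instance.CanPlace, h1, h2]

namespace Instance

variable {d N ξ : ℕ} {T : Instance d} {F : FunctionType} {C : ConstraintType} {r : Prop} {c : ℝ}

theorem det_better {σ : Setting X} {inp : X → Val} {T : X → Instance d} (h : Reads σ inp T)
    {x y : X → Val} (hx : Det σ inp x) (hy : Det σ inp y)
    (hxI : ∀ a, σ.dom a → outSet (x a) ⊆ (T a).I) (hyI : ∀ a, σ.dom a → outSet (y a) ⊆ (T a).I) :
    Det σ inp fun a => (T a).better (x a) (y a) :=
  Det.ite (c := fun a => (T a).f (outSet (x a)) ≤ (T a).f (outSet (y a)))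
    (Det.le (h.value hx.fst hxI) (h.value hy.fst hyI)) (hy.restrict _) (hx.restrict _)

namespace Approximates

variable {k : ℕ} {out : Instance d → CoinTree Val}

theorem computes_placed (h : Approximates r F C N ξ c k out) :
    Computes ((setting d r F C).pull Prod.fst fun y : Instance d × (Fin (d + 1) → ℕ) =>
        y.1.Valid F C ∧ y.1.CanPlace (y.2 0) (Fin.tail y.2))
      (fun y => .node y.1.code (tupleCode y.2)) fun y => placed out y.1 y.2 := by
  set σ := (setting d r F C).pull Prod.fst fun y : Instance d × (Fin (d + 1) → ℕ) =>
    y.1.Valid F C ∧ y.1.CanPlace (y.2 0) (Fin.tail y.2) with hσ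
  set inp : Instance d × (Fin (d + 1) → ℕ) → Val := fun y => .node y.1.code (tupleCode y.2)
  have hr : Reads σ inp fun y => y.1 :=
    reads.pull Prod.fst (fun _ hy => hy.1) (Det.fst Det.input)
  have he : ∀ t, Det σ inp fun y => .ofNat (y.2 t) := fun t =>
    Det.of_ofFn (h := fun (y : Instance d × (Fin (d + 1) → ℕ)) t => Val.ofNat (y.2 t))
      (Det.snd Det.input) t
  have hcode : Det σ inp fun y => (y.1.contract (y.2 0) (Fin.tail y.2)).code :=
    hr.contract_code (i := fun y => y.2 0) (bs := fun y => Fin.tail y.2) (he 0)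
      (fun t => he t.succ) fun y hy => hy.2.1
  have hout : Computes σ
      (fun y => .node (.ofNat (y.2 0)) (y.1.contract (y.2 0) (Fin.tail y.2)).code)
      fun y => out (y.1.contract (y.2 0) (Fin.tail y.2)) := by
    refine h.computes.contract (fun y : Instance d × (Fin (d + 1) → ℕ) =>
      y.1.contract (y.2 0) (Fin.tail y.2)) (fun y => .ofNat (y.2 0))
      id fun y hy => ⟨hy.1.contract hy.2, ?_,
        show (y.1.contract (y.2 0) (Fin.tail y.2)).valueSize ≤ y.1.valueSize from
          valueSize_contract_le hy.2.1⟩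
    rw [Val.label_ofNat]
    rfl
  refine Computes.map_input (f := fun y => extendOutput (y.2 0) (Fin.tail y.2))
    (Computes.seq ((he 0).node hcode) hout) ?_
  have he' := fun t => Det.comp
    (inp := fun z : (Instance d × (Fin (d + 1) → ℕ)) × Val => .node (inp z.1) z.2)
    (f := fun z => inp z.1) (Det.fst Det.input) ((he t).pull Prod.fst
    (dom := fun z : (Instance d × (Fin (d + 1) → ℕ)) × Val => σ.dom z.1 ∧
      z.2 ∈ (out (z.1.1.contract (z.1.2 0) (Fin.tail z.1.2))).leaves) fun _ hz => hz.1)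
  exact Det.extendOutput (he' 0) (fun t => he' t.succ) (Det.snd Det.input)

theorem computes_guessItem (h : Approximates r F C N ξ c k out) :
    Computes (setting d r F C) code (guessItem out) := by
  obtain ⟨g, ⟨p, hp⟩, hg⟩ := h.computes_placed.leaves_size
  have hL : Det (setting d r F C) code fun T => .ofList (T.placements.map tupleCode) :=
    Det.tuples (L := fun T : Instance d => (Fin.cons T.items fun t => (T.mkc t).bins :
      Fin (d + 1) → List ℕ)) fun t => by
      cases t using Fin.cases with
      | zero => exact reads.items
      | succ t => exact reads.binNames t
  -- The accumulator is the initial output or some output after a placement.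
  set G : Instance d → ℕ := fun T => p.eval (T.code.size +
    (Val.ofList (T.placements.map tupleCode)).size + 1 + T.valueSize) with hG
  have hGp : PolyBounded (setting d r F C) code G :=
    (((PolyBounded.inp_size.add hL.polyBounded).add (.const 1)).add .extra).eval p
  refine Computes.bind (enc := fun T v => .node T.code v)
    (Computes.pair_left Det.input h.computes) ?_
  set τ := (setting d r F C).pull Prod.fst fun y : Instance d × Val =>
    y.1.Valid F C ∧ y.2 ∈ (out y.1).leaves with hτ
  set inp : Instance d × Val → Val := fun y => .node y.1.code y.2 with hinp
  have hin : Det τ inp fun y => y.1.code := Det.fst Det.input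
  refine (Computes.foldl (l := fun y : Instance d × Val => y.1.placements)
    (ea := fun _ e => tupleCode e) (eb := fun _ b => b) (b₀ := fun y => y.2)
    (step := fun y => tryPlacement out y.1) (g := fun y => G y.1 + y.2.size)
    (fun y _ b => y.1.IsSolution (outSet b) (outAssignment b) ∧ b.size ≤ G y.1 + y.2.size)
    hin (Det.comp hin (hL.pull Prod.fst fun _ hy => hy.1)) (fun _ _ => Val.toList_ofList _)
    (Det.snd Det.input) ?_ (fun y hy => ⟨h.isSolution _ hy.1 _ hy.2, by omega⟩)
    (fun y hy l₁ e l₂ b hl hb b' hb' => ⟨h.isSolution_tryPlacement hy.1 e hb.1 b' hb', ?_⟩)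
    (.add ?_ (Det.snd Det.input).polyBounded) fun _ _ _ _ _ _ hb => hb.2).congr
    fun y _ => CoinTree.bind_ret_right _
  · refine Computes.congr (out := fun y => tryPlacement out y.1.1 y.2.2 y.2.1) ?_
      fun y _ => (CoinTree.bind_ret_right _).symm
    set υ := τ.pull Prod.fst fun y : (Instance d × Val) × (Fin (d + 1) → ℕ) × Val => τ.dom y.1 ∧
      ∃ l₁ l₂, y.1.1.placements = l₁ ++ y.2.1 :: l₂ ∧
        (y.1.1.IsSolution (outSet y.2.2) (outAssignment y.2.2) ∧ y.2.2.size ≤ G y.1.1 + y.1.2.size)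
      with hυ
    set inp' : (Instance d × Val) × (Fin (d + 1) → ℕ) × Val → Val := fun y =>
      .node y.1.1.code (.node (tupleCode y.2.1) y.2.2) with hinp'
    have hcode : Det υ inp' fun y => y.1.1.code := Det.fst Det.input
    have htuple : Det υ inp' fun y => tupleCode y.2.1 := Det.fst (Det.snd Det.input)
    have hbest : Det υ inp' fun y => y.2.2 := Det.snd (Det.snd Det.input)
    have hreads : Reads υ inp' fun y => y.1.1 := ⟨hcode, fun _ _ => rfl, fun _ _ => le_rfl⟩
    have he : ∀ t, Det υ inp' fun y => .ofNat (y.2.1 t) := fun t => Det.of_ofFn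
      (h := fun (y : (Instance d × Val) × (Fin (d + 1) → ℕ) × Val) t => Val.ofNat (y.2.1 t))
      htuple t
    have hmem : ∀ y, υ.dom y → y.2.1 ∈ y.1.1.placements := fun y hy => by
      obtain ⟨-, l₁, l₂, hl, -⟩ := hy
      rw [hl]
      simp
    refine Computes.ite (c := fun y : (Instance d × Val) × (Fin (d + 1) → ℕ) × Val =>
      y.1.1.CanPlace (y.2.1 0) (Fin.tail y.2.1))
      (hreads.canPlace (he 0) (fun t => he t.succ) (fun y hy => (mem_placements.1 (hmem y hy)).1)
        fun y hy => (mem_placements.1 (hmem y hy)).2)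
      (Computes.map_input (f := fun y => y.1.1.better y.2.2)
        (Computes.seq ((hcode.node htuple).restrict _) (h.computes_placed.transfer id
          fun y hy => ⟨(y.1.1, y.2.1), ⟨hy.1.1.1, hy.2⟩, rfl, le_rfl, rfl, rfl⟩)) ?_)
      (hbest.restrict _)
    refine det_better ((hreads.restrict _).pull Prod.fst (fun _ hz => hz.1) (Det.fst Det.input))
      (Det.snd (Det.snd (Det.fst Det.input))) (Det.snd Det.input) (fun z hz => ?_) fun z hz => ?_
    · obtain ⟨-, l₁, l₂, -, hb, -⟩ := hz.1.1
      exact hb.1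
    · exact (h.isSolution_placed hz.1.1.1.1 hz.1.2 _ hz.2).1
  · rw [tryPlacement] at hb'
    split_ifs at hb' with he
    · obtain ⟨x, hx, rfl⟩ := CoinTree.mem_leaves_map.1 hb'
      rcases y.1.better_eq b x with hbx | hbx <;> rw [hbx]
      · exact hb.2
      · have h1 := (hg (y.1, e) ⟨hy.1, he⟩ x hx).trans (hp (y.1, e) ⟨hy.1, he⟩)
        have h2 : (tupleCode e).size ≤ (Val.ofList (y.1.placements.map tupleCode)).size :=
          Val.size_le_size_ofList (List.mem_map_of_mem (by rw [hl]; simp))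
        refine (h1.trans (eval_le_eval p ?_)).trans (Nat.le_add_right _ _)
        change (Val.node y.1.code (tupleCode e)).size + y.1.valueSize ≤ y.1.code.size +
          (Val.ofList (y.1.placements.map tupleCode)).size + 1 + y.1.valueSize
        rw [Val.size_node]
        omega
    · simp only [CoinTree.leaves_ret, List.mem_singleton] at hb'
      rw [hb']
      exact hb.2
  · exact hGp.pull Prod.fst (fun _ hy => hy.1) fun y _ => by
      simp only [hinp, Val.size_node]
      omega

theorem guessItem (h : Approximates r F C N ξ c k out) :
    Approximates r F C N ξ c (k + 1) (guessItem out) :=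
  ⟨h.computes_guessItem, fun _ hT => h.isSolution_guessItem hT,
    fun _ hT _ _ hS _ hG hk hsmall => h.le_expect_guessItem hT hS hG hk hsmall⟩

end Approximates

theorem exists_approximates (hN : 1 ≤ N) (hξ : 1 ≤ ξ) (hc₀ : 0 ≤ c) (hc₁ : c ≤ 1)
    {A : Prog} (hr : r ∨ A.Deterministic) (hA : IsRestrictedApprox F C N ξ d c A) (k : ℕ) :
    ∃ out : Instance d → CoinTree Val, Approximates r F C N ξ c k out := by
  induction k with
  | zero => exact exists_approximates_zero hN hξ hc₀ hc₁ hr hA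
  | succ k ih =>
    obtain ⟨out, h⟩ := ih
    exact ⟨_, h.guessItem⟩

/-- Both claims at once: coins are available if and only if `r` holds. -/
theorem exists_isApprox (hN : 1 ≤ N) (hξ : 1 ≤ ξ) (hc₀ : 0 ≤ c) (hc₁ : c ≤ 1)
    {A : Prog} (hr : r ∨ A.Deterministic) (hA : IsRestrictedApprox F C N ξ d c A) :
    ∃ P : Prog, (r ∨ P.Deterministic) ∧ IsApprox F C d (c * (1 - (d : ℝ) / (N : ℝ))) P := by
  obtain ⟨out, h⟩ := exists_approximates hN hξ hc₀ hc₁ hr hA ξ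
  obtain ⟨P, hP, g, ⟨p, hp⟩, H⟩ := h.computes
  refine ⟨P, hP, p, fun T hT => ?_⟩
  obtain ⟨E, hE, hE', hEg⟩ := H T hT
  refine ⟨E, hE, fun x hx => ⟨(hEg x hx).trans (hp T hT), h.isSolution T hT _ ?_⟩, fun v hv => ?_⟩
  · rw [← hE', CoinTree.mem_leaves_map]
    exact ⟨x, hx, rfl⟩
  · obtain ⟨⟨S, A, hS, rfl⟩, -⟩ := hv
    obtain ⟨G, hG, hk, hsmall⟩ := hT.function_type.isSubmodular.exists_greedy hS.1 ξ
    have h1 := h.le_expect T hT S A hS G hG hk hsmall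
    rw [← hE', CoinTree.expect_map] at h1
    refine le_trans (mul_le_mul_of_nonneg_right (mul_le_mul_of_nonneg_left ?_ hc₀) ?_) h1
    · -- Bernoulli's inequality
      have hN' : 1 / (N : ℝ) ≤ 1 := by
        rw [div_le_one (by exact_mod_cast hN)]
        exact_mod_cast hN
      have := one_add_mul_le_pow (a := -(1 / (N : ℝ))) (by linarith) d
      calc 1 - (d : ℝ) / N = 1 + d * -(1 / (N : ℝ)) := by ring
        _ ≤ _ := this
        _ = _ := by rw [← sub_eq_add_neg]
    · exact_mod_cast hT.function_type.isSubmodular.1 S hS.1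

end Instance

end MKCP

theorem lemma4p2 (F : MKCP.FunctionType) (C : MKCP.ConstraintType) (N ξ d : ℕ)
    (hN : 1 ≤ N) (hξ : 1 ≤ ξ) (c : ℝ) (hc₀ : 0 ≤ c) (hc₁ : c ≤ 1) :
    ((∃ A : MKCP.Prog, MKCP.IsRestrictedApprox F C N ξ d c A) →
      ∃ P : MKCP.Prog, MKCP.IsApprox F C d (c * (1 - (d : ℝ) / (N : ℝ))) P) ∧
    ((∃ A : MKCP.Prog, A.Deterministic ∧ MKCP.IsRestrictedApprox F C N ξ d c A) →
      ∃ P : MKCP.Prog, P.Deterministic ∧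
        MKCP.IsApprox F C d (c * (1 - (d : ℝ) / (N : ℝ))) P) := by
  constructor
  · rintro ⟨A, hA⟩
    obtain ⟨P, -, hP⟩ :=
      MKCP.Instance.exists_isApprox hN hξ hc₀ hc₁ (r := True) (.inl trivial) hA
    exact ⟨P, hP⟩
  · rintro ⟨A, hdet, hA⟩
    obtain ⟨P, hdet', hP⟩ :=
      MKCP.Instance.exists_isApprox hN hξ hc₀ hc₁ (r := False) (.inr hdet) hA
    exact ⟨P, hdet'.resolve_left id, hP⟩
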